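/- Let $\mathcal V$ be a cartesian closed category with pullbacks and all small coproducts that is extensive, i.e. for every small family $(X_i)_i$ of objects the coproduct functor $\prod_i \mathcal V_{/X_i}\to\mathcal V_{/\coprod_i X_i}$ is an equivalence. Let $\mathcal I$ and $\mathcal C$ be $\mathcal V$-categories (with sets of objects), let $G\colon\mathcal I\to\mathcal C$ and $W\colon\mathcal I\to\mathcal V$ be $\mathcal V$-functors, let $L\in\mathcal C$ be an object and let $\lambda\colon W\Rightarrow\mathcal C(L,G-)$ be a $\mathcal V$-natural transformation of $\mathcal V$-functors $\mathcal I\to\mathcal V$. The following are equivalent: (i) $(L,\lambda)$ is a $W$-weighted $\mathcal V$-limit of $G$; (iii) $(L,\lambda)$ is an internal limit of the composite of internal functors $\int_{\mathcal I}W\xrightarrow{\pi_W}\mathrm{Int}\,\mathcal I\xrightarrow{\mathrm{Int}\,G}\mathrm{Int}\,\mathcal C$. Thus weighted $\mathcal V$-limits are conical internal limits. The notions are as follows. *Weighted limits.* $\mathcal V^{\mathcal I}$ denotes the $\mathcal V$-category of $\mathcal V$-functors $\mathcal I\to\mathcal V$, with hom-object $\mathcal V^{\mathcal I}(F,F')$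 the equalizer of the two maps $\prod_{a}[Fa,F'a]\rightrightarrows\prod_{a,b}[\mathcal I(a,b),[Fa,F'b]]$. The pair $(L,\lambda)$ is a $W$-weighted $\mathcal V$-limit of $G$ if the $\mathcal V$-natural transformation $\lambda^*\colon\mathcal C(-,L)\Rightarrow\mathcal V^{\mathcal I}(W,\mathcal C(-,G))$ of $\mathcal V$-functors $\mathcal C^{\mathrm{op}}\to\mathcal V$ that corresponds to the element $\lambda$ of $\mathcal V^{\mathcal I}(W,\mathcal C(L,G-))$ under the enriched Yoneda lemma is an isomorphism. *Internalization and internal category of elements.* $\mathrm{Int}\,\mathcal C$ is the internal category in $\mathcal V$ with object of objects $\coprod_{A\in\mathcal C}1$, object of morphisms $\coprod_{A,B\in\mathcal C}\mathcal C(A,B)$, and structure induced by that of $\mathcal C$; $\mathrm{Int}\,G$ is the internal functor induced by $G$. The internal category $\int_{\mathcal I}W$ has object of objects $\coprod_{a}Wa$ and object of morphisms $\coprod_{a,b}Wa\times\mathcal I(a,b)$; its source and target are induced by the projections $Wa\times\mathcal I(a,b)\to Wa$ and the action maps $Wa\times\mathcal I(a,b)\to Wb$, its identities and composition by those of $\mathcal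 I$; $\pi_W$ is induced by the maps $Wa\to 1$ and the projections $Wa\times\mathcal I(a,b)\to\mathcal I(a,b)$. *Internal limits.* For internal categories $\mathbb I,\mathbb A$ in $\mathcal V$, let $[\![\mathbb I,\mathbb A]\!]$ be the internal hom of $\mathrm{Cat}(\mathcal V)$: its generalized objects and morphisms at $X\in\mathcal V$ are the internal functors $\mathbb I\times\mathrm{cst}X\to\mathbb A$ and the internal natural transformations between them, where $\mathrm{cst}X$ is the constant internal category at $X$. Let $\Delta\colon\mathbb A\to[\![\mathbb I,\mathbb A]\!]$ be the diagonal. For an internal functor $F\colon\mathbb I\to\mathbb A$, viewed as an element of $[\![\mathbb I,\mathbb A]\!]$, the internal category of cones over $F$ is the comma internal category $\Delta\downarrow F$. An element $T$ of an internal category $\mathbb A$ is an internal terminal object if the projection $\mathbb A_{/T}\to\mathbb A$ from the slice internal category is an isomorphism of internal categories. An internal limit of $F$ is an internal terminal object of $\Delta\downarrow F$. In (iii), $(L,\lambda)$ is regarded as the element of $\Delta\downarrow(\mathrm{Int}\,G\circ\pi_W)$ given by the object $L$ of $\mathrm{Int}\,\mathcal C$ and the internal natural transformation $\Delta L\Rightarrow\mathrm{Int}\,G\circ\pi_W$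 whose underlying map $\coprod_a Wa\to\coprod_{A,B}\mathcal C(A,B)$ is induced by the components $\lambda_a\colon Wa\to\mathcal C(L,Ga)$. -/

import Mathlib

open CategoryTheory CategoryTheory.Limits CategoryTheory.MonoidalCategory
open scoped CategoryTheory.MonoidalClosed

universe w v u

noncomputable section

namespace EnrInt

section Extensivity

variable {V : Type u} [Category.{v} V] [HasCoproducts.{w} V]

/-- For a family `X` of objects, the coproduct functor
`∏ i, V / X i ⥤ V / (∐ X)` sending `(Y i ⟶ X i)ᵢ` to `∐ Y ⟶ ∐ X`. -/
def overSigma {ι : Type w} (X : ι → V) : (∀ i, Over (X i)) ⥤ Over (∐ X) where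
  obj Y := Over.mk (Limits.Sigma.map fun i => (Y i).hom)
  map f := Over.homMk (Limits.Sigma.map fun i => (f i).left)

/-- A category with small coproducts is extensive if, for every small family `X`, the coproduct
functor `∏ i, V / X i ⥤ V / (∐ X)` is an equivalence of categories. -/
class Extensive (V : Type u) [Category.{v} V] [HasCoproducts.{w} V] : Prop where
  isEquivalence : ∀ {ι : Type w} (X : ι → V), (overSigma X).IsEquivalence

theorem overSigma_essSurj [Extensive.{w} V] {ι : Type w} (X : ι → V) {Z : V} (f : Z ⟶ ∐ X) :
    ∃ (Y : ∀ i, Over (X i)) (h : (∐ fun i => (Y i).left) ⟶ Z), IsIso h ∧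
      h ≫ f = Limits.Sigma.map fun i => (Y i).hom := by
  have : (overSigma X).IsEquivalence := Extensive.isEquivalence X
  let e := (overSigma X).objObjPreimageIso (Over.mk f)
  exact ⟨(overSigma X).objPreimage (Over.mk f), e.hom.left,
    inferInstanceAs (IsIso ((Over.forget _).map e.hom)), Over.w e.hom⟩

theorem overSigma_full [Extensive.{w} V] {ι : Type w} {X Y Y' : ι → V} (g : ∀ i, Y i ⟶ X i)
    (g' : ∀ i, Y' i ⟶ X i) (h : ∐ Y ⟶ ∐ Y') (w : h ≫ Limits.Sigma.map g' = Limits.Sigma.map g) :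
    ∃ k : ∀ i, Y i ⟶ Y' i, (∀ i, k i ≫ g' i = g i) ∧
      ∀ i, Sigma.ι Y i ≫ h = k i ≫ Sigma.ι Y' i := by
  have : (overSigma X).IsEquivalence := Extensive.isEquivalence X
  let m : (overSigma X).obj (fun i => Over.mk (g i)) ⟶ (overSigma X).obj (fun i => Over.mk (g' i)) :=
    Over.homMk h w
  obtain ⟨k, hk⟩ := (overSigma X).map_surjective m
  have : h = Limits.Sigma.map fun i => (k i).left :=
    (congrArg (fun q => q.left) hk).symm
  refine ⟨fun i => (k i).left, fun i => Over.w (k i), fun i => ?_⟩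
  rw [this]
  exact Sigma.ι_map (fun i => (k i).left) i

/-- Every map into a coproduct decomposes its domain as a coproduct. -/
theorem exists_cover [Extensive.{w} V] {ι : Type w} (X : ι → V) {Z : V} (f : Z ⟶ ∐ X) :
    ∃ (Y : ι → V) (y : ∀ i, Y i ⟶ Z) (g : ∀ i, Y i ⟶ X i),
      (∀ i, y i ≫ f = g i ≫ Sigma.ι X i) ∧ IsIso (Sigma.desc y) := by
  obtain ⟨Y, h, hi, hf⟩ := overSigma_essSurj X f
  refine ⟨fun i => (Y i).left, fun i => Sigma.ι (fun i => (Y i).left) i ≫ h,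
    fun i => (Y i).hom, fun i => ?_, ?_⟩
  · simp [hf]
  · convert hi
    apply Sigma.hom_ext; intro i; simp

theorem cover_ext {ι : Type w} {Y : ι → V} {Z T : V} {y : ∀ i, Y i ⟶ Z}
    (hy : IsIso (Sigma.desc y)) {a b : Z ⟶ T} (h : ∀ i, y i ≫ a = y i ≫ b) : a = b := by
  rw [← cancel_epi (Sigma.desc y)]
  apply Sigma.hom_ext; intro i; simpa using h i

/-- The family with value `Z` at `a` and the initial object elsewhere. -/
def single {ι : Type w} (a : ι) (Z : V) (i : ι) : V := ∐ fun _ : PLift (a = i) => Z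

def singleIn {ι : Type w} (a : ι) (Z : V) : Z ⟶ single a Z a :=
  Sigma.ι (fun _ : PLift (a = a) => Z) ⟨rfl⟩

def singleOut {ι : Type w} {a : ι} {Z : V} {X : ι → V} (f : Z ⟶ X a) (i : ι) : single a Z i ⟶ X i :=
  Sigma.desc fun h : PLift (a = i) => f ≫ eqToHom (congrArg X h.down)

theorem singleIn_out {ι : Type w} {a : ι} {Z : V} {X : ι → V} (f : Z ⟶ X a) :
    singleIn a Z ≫ singleOut f a = f :=
  (Sigma.ι_desc _ _).trans (by simp)

theorem single_ext {ι : Type w} {a : ι} {Z T : V} {f g : single a Z a ⟶ T}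
    (h : singleIn a Z ≫ f = singleIn a Z ≫ g) : f = g :=
  Sigma.hom_ext _ _ fun _ => h

theorem sigma_single_ext {ι : Type w} {a : ι} {Z T : V} {f g : ∐ single a Z ⟶ T}
    (h : singleIn a Z ≫ Sigma.ι (single a Z) a ≫ f = singleIn a Z ≫ Sigma.ι (single a Z) a ≫ g) :
    f = g := by
  apply Sigma.hom_ext
  intro i
  apply Sigma.hom_ext
  rintro ⟨rfl⟩
  exact h

theorem exists_sigma_single {ι : Type w} (a : ι) {Z T : V} (p : Z ⟶ T) :
    ∃ m : ∐ single a Z ⟶ T, singleIn a Z ≫ Sigma.ι (single a Z) a ≫ m = p :=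
  ⟨Sigma.desc (singleOut (X := fun _ => T) p), by
    simpa using singleIn_out (X := fun _ => T) p⟩

theorem single_w {ι : Type w} {a : ι} {Z : V} {X : ι → V} (f : Z ⟶ X a) :
    singleIn a Z ≫ Sigma.ι (single a Z) a ≫ Limits.Sigma.map (singleOut f) = f ≫ Sigma.ι X a := by
  rw [Sigma.ι_map, ← Category.assoc, singleIn_out]

theorem exists_lift [Extensive.{w} V] {ι : Type w} {X Y : ι → V} (g : ∀ i, Y i ⟶ X i) {Z : V}
    (p : Z ⟶ ∐ Y) {a : ι} (q : Z ⟶ X a) (h : p ≫ Limits.Sigma.map g = q ≫ Sigma.ι X a) :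
    ∃ r : Z ⟶ Y a, r ≫ Sigma.ι Y a = p ∧ r ≫ g a = q := by
  obtain ⟨m, hm⟩ := exists_sigma_single a p
  obtain ⟨k, hk, hk'⟩ := overSigma_full (singleOut q) g m
    (sigma_single_ext (by
      rw [single_w, ← h, ← hm]; simp))
  refine ⟨singleIn a Z ≫ k a, ?_, ?_⟩
  · rw [Category.assoc, ← hk', hm]
  · rw [Category.assoc, hk, singleIn_out]

theorem sigma_ι_inj [Extensive.{w} V] {ι : Type w} {X : ι → V} {a : ι} {Z : V}
    {p q : Z ⟶ X a} (h : p ≫ Sigma.ι X a = q ≫ Sigma.ι X a) : p = q := by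
  obtain ⟨k, hk, hk'⟩ := overSigma_full (singleOut p) (singleOut q) (𝟙 (∐ single a Z))
    (sigma_single_ext (by rw [Category.id_comp, single_w, single_w, h]))
  obtain ⟨c, hc⟩ := exists_sigma_single a (𝟙 Z)
  have hs : ∀ r : Z ⟶ X a, Sigma.ι (single a Z) a ≫ c ≫ r = singleOut r a := fun r =>
    single_ext (by
      rw [singleIn_out, ← Category.assoc, ← Category.assoc, Category.assoc (singleIn a Z), hc]
      simp)
  have h4 : singleOut p a = singleOut q a := by
    rw [← hk a, ← hs q, ← Category.assoc, ← hk', Category.comp_id]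
  rw [← singleIn_out p, h4, singleIn_out]

theorem sigma_disjoint [Extensive.{w} V] [CartesianMonoidalCategory V] [MonoidalClosed V]
    {ι : Type w} {X : ι → V} {a b : ι} (hab : a ≠ b) {Z : V}
    (p : Z ⟶ X a) (q : Z ⟶ X b) (h : p ≫ Sigma.ι X a = q ≫ Sigma.ι X b) :
    Nonempty (IsInitial Z) := by
  obtain ⟨m, hm⟩ := exists_sigma_single a (singleIn b Z ≫ Sigma.ι (single b Z) b)
  obtain ⟨k, -, -⟩ := overSigma_full (singleOut p) (singleOut q) m
    (sigma_single_ext (by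
      rw [single_w, h, ← single_w q, ← Category.assoc (singleIn b Z), ← hm]; simp))
  have t : IsInitial (single b Z a) :=
    IsInitial.ofUniqueHom (fun T => Sigma.desc fun h => absurd h.down hab.symm)
      (fun T m => Sigma.hom_ext _ _ fun h => absurd h.down hab.symm)
  have := CategoryTheory.strict_initial t (singleIn a Z ≫ k a)
  exact ⟨IsInitial.ofIso t (asIso (singleIn a Z ≫ k a)).symm⟩

end Extensivity

section Products

open CartesianMonoidalCategory MonoidalClosed

variable {V : Type u} [Category.{v} V] [CartesianMonoidalCategory V] [MonoidalClosed V]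
  [HasCoproducts.{w} V]

theorem tensor_sigma_ext {ι : Type w} {X : ι → V} {Z T : V} {f g : Z ⊗ ∐ X ⟶ T}
    (h : ∀ i, Z ◁ Sigma.ι X i ≫ f = Z ◁ Sigma.ι X i ≫ g) : f = g := by
  apply curry_injective
  apply Sigma.hom_ext
  intro i
  rw [← curry_natural_left, ← curry_natural_left, h]

theorem exists_tensor_desc {ι : Type w} {X : ι → V} {Z T : V} (f : ∀ i, Z ⊗ X i ⟶ T) :
    ∃ m : Z ⊗ ∐ X ⟶ T, ∀ i, Z ◁ Sigma.ι X i ≫ m = f i :=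
  ⟨uncurry (Sigma.desc fun i => curry (f i)), fun i => by
    rw [← uncurry_natural_left]; simp⟩

theorem hasProduct_aux [HasPullbacks V] {J : Type w} (Y : J → V) {S E : V} (s : J → (𝟙_ V ⟶ S))
    (e : ∀ j, Y j ⟶ E) (p : E ⟶ S) (h1 : ∀ j, e j ≫ p = toUnit _ ≫ s j)
    (h2 : ∀ (Z : V) (q : Z ⟶ E) (j : J), q ≫ p = toUnit _ ≫ s j → ∃ r, r ≫ e j = q)
    (h3 : ∀ (Z : V) (j : J) (r r' : Z ⟶ Y j), r ≫ e j = r' ≫ e j → r = r')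
    (h4 : ∀ (Z T : V) (f g : Z ⊗ S ⟶ T), (∀ j, Z ◁ s j ≫ f = Z ◁ s j ≫ g) → f = g)
    (h5 : ∀ (Z T : V) (f : J → (Z ⊗ 𝟙_ V ⟶ T)), ∃ m : Z ⊗ S ⟶ T, ∀ j, Z ◁ s j ≫ m = f j) :
    HasProduct Y := by
  let P := pullback ((ihom S).map p) (curry (fst S (𝟙_ V)))
  obtain ⟨at', hat⟩ : ∃ at' : ∀ (Z : V) (j : J), Z ⟶ S ⊗ Z,
    ∀ Z j, at' Z j = lift (toUnit Z ≫ s j) (𝟙 Z) := ⟨_, fun _ _ => rfl⟩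
  have at_nat : ∀ {Z Z' : V} (f : Z ⟶ Z') (j : J), f ≫ at' Z' j = at' Z j ≫ S ◁ f := by
    intro Z Z' f j; ext <;> simp [hat]
  let ev : S ⊗ P ⟶ E := uncurry (pullback.fst _ _)
  have ev_w : ev ≫ p = fst _ _ := by
    have h : pullback.fst _ _ ≫ (ihom S).map p = pullback.snd _ _ ≫ curry (fst S (𝟙_ V)) :=
      pullback.condition
    have := congrArg uncurry h
    rw [uncurry_natural_right, uncurry_natural_left, uncurry_curry] at this
    simpa using this
  have hπ (j : J) := h2 P (at' P j ≫ ev) j (by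
    rw [Category.assoc, ev_w]; simp [hat])
  choose π hπ using hπ
  have hlift {Z : V} (f : ∀ j, Z ⟶ Y j) : ∃ r : Z ⟶ P, ∀ j, r ≫ π j = f j := by
    obtain ⟨m, hm⟩ := h5 Z E fun j => fst _ _ ≫ f j ≫ e j
    let m' : S ⊗ Z ⟶ E := lift (snd _ _) (fst _ _) ≫ m
    have hm' : ∀ j, at' Z j ≫ m' = f j ≫ e j := by
      intro j
      have : at' Z j ≫ lift (snd _ _) (fst _ _) = lift (𝟙 Z) (toUnit Z) ≫ Z ◁ s j := by
        ext <;> simp [hat]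
      simp only [m']
      rw [← Category.assoc, this, Category.assoc, hm]
      simp
    have hmp : m' ≫ p = fst _ _ := by
      have : m ≫ p = snd _ _ := by
        apply h4
        intro j
        rw [← Category.assoc, hm, whiskerLeft_snd, Category.assoc, Category.assoc, h1,
          ← Category.assoc, ← Category.assoc]
        congr 1
        exact toUnit_unique _ _
      simp only [m', Category.assoc, this]
      simp
    refine ⟨pullback.lift (curry m') (toUnit Z) (by
      rw [← curry_natural_right, hmp, ← curry_natural_left]; simp), fun j => ?_⟩
    apply h3
    rw [Category.assoc, hπ, ← Category.assoc, at_nat, Category.assoc, ← uncurry_natural_left,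
      pullback.lift_fst, uncurry_curry, hm']
  have huniq {Z : V} (r r' : Z ⟶ P) (h : ∀ j, r ≫ π j = r' ≫ π j) : r = r' := by
    apply pullback.hom_ext
    · apply uncurry_injective
      rw [uncurry_natural_left, uncurry_natural_left]
      change S ◁ r ≫ ev = S ◁ r' ≫ ev
      suffices hs : lift (snd _ _) (fst _ _) ≫ S ◁ r ≫ ev =
          lift (snd _ _) (fst _ _) ≫ S ◁ r' ≫ ev by
        have := congrArg (lift (snd S Z) (fst S Z) ≫ ·) hs
        simp only [← Category.assoc] at this
        simpa using this
      apply h4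
      intro j
      have he : ∀ r : Z ⟶ P, Z ◁ s j ≫ lift (snd _ _) (fst _ _) ≫ S ◁ r ≫ ev =
          fst _ _ ≫ r ≫ π j ≫ e j := by
        intro r
        rw [hπ, ← Category.assoc r, at_nat]
        simp only [← Category.assoc]
        congr 2
        have : snd Z (𝟙_ V) = toUnit _ := toUnit_unique _ _
        ext <;> simp [hat, this]
      rw [he, he, ← Category.assoc r, h, Category.assoc]
    · exact toUnit_unique _ _
  exact ⟨⟨⟨Fan.mk P π, Fan.IsLimit.mk _ (fun s => (hlift s.proj).choose)
    (fun s => (hlift s.proj).choose_spec) (fun s m hm => huniq _ _ fun j => by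
      rw [(hlift s.proj).choose_spec]; exact hm j)⟩⟩⟩

theorem hasProducts_of_extensive [Extensive.{w} V] [HasPullbacks V] : HasProducts.{w} V := by
  intro J
  have key : ∀ Y : J → V, HasProduct Y := fun Y =>
    hasProduct_aux Y (fun j => Sigma.ι (fun _ : J => 𝟙_ V) j) (fun j => Sigma.ι Y j)
      (Limits.Sigma.map fun _ => toUnit _) (fun j => by simp)
      (fun Z q j h => (exists_lift _ _ _ h).imp fun _ h => h.1)
      (fun Z j r r' h => sigma_ι_inj h) (fun Z T f g h => tensor_sigma_ext h)
      (fun Z T f => exists_tensor_desc f)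
  exact ⟨fun F => hasLimit_of_iso (Discrete.natIsoFunctor (F := F)).symm⟩

instance [Extensive.{w} V] [HasPullbacks V] {J : Type w} :
    HasLimitsOfShape (Discrete J) V := hasProducts_of_extensive J

instance [HasPullbacks V] : HasEqualizers V :=
  hasEqualizers_of_hasPullbacks_and_binary_products

end Products

section Enriched

open CartesianMonoidalCategory MonoidalClosed

variable {V : Type u} [Category.{v} V] [CartesianMonoidalCategory V]

section General

variable {C : Type*} [EnrichedCategory V C] {D : Type*} [EnrichedCategory V D]

/-- Composition of generalized elements of the hom-objects of a `V`-category. -/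
def ecomp {Z : V} {a b c : C} (f : Z ⟶ (a ⟶[V] b)) (g : Z ⟶ (b ⟶[V] c)) : Z ⟶ (a ⟶[V] c) :=
  lift f g ≫ eComp V a b c

theorem comp_ecomp {Z' Z : V} (z : Z' ⟶ Z) {a b c : C} (f : Z ⟶ (a ⟶[V] b)) (g : Z ⟶ (b ⟶[V] c)) :
    z ≫ ecomp f g = ecomp (z ≫ f) (z ≫ g) := by
  simp [ecomp, ← Category.assoc]

theorem ecomp_assoc {Z : V} {a b c d : C} (f : Z ⟶ (a ⟶[V] b)) (g : Z ⟶ (b ⟶[V] c))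
    (h : Z ⟶ (c ⟶[V] d)) : ecomp (ecomp f g) h = ecomp f (ecomp g h) := by
  have h1 : lift f (lift g h) ≫ (α_ _ _ _).inv ≫ eComp V a b c ▷ _ = lift (ecomp f g) h := by
    simp [ecomp]
  have h2 : lift f (lift g h) ≫ _ ◁ eComp V b c d = lift f (ecomp g h) := by
    simp [ecomp]
  have := congrArg (lift f (lift g h) ≫ ·) (e_assoc V a b c d)
  simp only [← Category.assoc] at this h1 h2
  rw [h1, h2] at this
  exact this

theorem id_ecomp {Z : V} {a b : C} (f : Z ⟶ (a ⟶[V] b)) : ecomp (toUnit Z ≫ eId V a) f = f := by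
  have h : f ≫ (λ_ _).inv ≫ eId V a ▷ _ = lift (toUnit Z ≫ eId V a) f := by
    apply CartesianMonoidalCategory.hom_ext <;> simp
  have := congrArg (f ≫ ·) (e_id_comp V a b)
  simp only [Category.comp_id, ← Category.assoc] at this h
  rw [h] at this
  exact this

theorem ecomp_id {Z : V} {a b : C} (f : Z ⟶ (a ⟶[V] b)) : ecomp f (toUnit Z ≫ eId V b) = f := by
  have h : f ≫ (ρ_ _).inv ≫ _ ◁ eId V b = lift f (toUnit Z ≫ eId V b) := by
    apply CartesianMonoidalCategory.hom_ext <;> simp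
  have := congrArg (f ≫ ·) (e_comp_id V a b)
  simp only [Category.comp_id, ← Category.assoc] at this h
  rw [h] at this
  exact this

theorem ecomp_map (F : EnrichedFunctor V C D) {Z : V} {a b c : C} (f : Z ⟶ (a ⟶[V] b))
    (g : Z ⟶ (b ⟶[V] c)) :
    ecomp f g ≫ F.map a c = ecomp (f ≫ F.map a b) (g ≫ F.map b c) := by
  simp [ecomp]

theorem map_comp_of {obj : C → D} {map : ∀ a b : C, (a ⟶[V] b) ⟶ (obj a ⟶[V] obj b)} {a b c : C}
    (h : ∀ {Z : V} (f : Z ⟶ (a ⟶[V] b)) (g : Z ⟶ (b ⟶[V] c)),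
      ecomp f g ≫ map a c = ecomp (f ≫ map a b) (g ≫ map b c)) :
    eComp V a b c ≫ map a c = (map a b ⊗ₘ map b c) ≫ eComp V (obj a) (obj b) (obj c) := by
  have := h (fst _ _) (snd _ _)
  simp only [ecomp, lift_fst_snd, Category.id_comp] at this
  rw [this]
  congr 1
  apply CartesianMonoidalCategory.hom_ext <;> simp

/-- A `V`-natural transformation between `V`-functors. -/
structure VNatTrans (F G : EnrichedFunctor V C D) where
  app : ∀ a : C, 𝟙_ V ⟶ (F.obj a ⟶[V] G.obj a)
  naturality : ∀ a b : C,
    ecomp (F.map a b) (toUnit _ ≫ app b) = ecomp (toUnit _ ≫ app a) (G.map a b)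

/-- A `V`-natural transformation is an isomorphism if it has a `V`-natural inverse. -/
def VNatTrans.IsIso {F G : EnrichedFunctor V C D} (α : VNatTrans F G) : Prop :=
  ∃ β : VNatTrans G F, ∀ a : C, ecomp (α.app a) (β.app a) = eId V (F.obj a) ∧
    ecomp (β.app a) (α.app a) = eId V (G.obj a)

end General

section Closed

variable [MonoidalClosed V]

/-- Evaluation of a generalized element of an internal hom at a generalized element. -/
def act {Z X Y : V} (a : Z ⟶ X) (f : Z ⟶ (ihom X).obj Y) : Z ⟶ Y := lift a f ≫ (ihom.ev X).app Y

theorem comp_act {Z' Z X Y : V} (z : Z' ⟶ Z) (a : Z ⟶ X) (f : Z ⟶ (ihom X).obj Y) :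
    z ≫ act a f = act (z ≫ a) (z ≫ f) := by
  simp [act, ← Category.assoc]

theorem act_curry {Z Z' X Y : V} (a : Z ⟶ X) (z : Z ⟶ Z') (m : X ⊗ Z' ⟶ Y) :
    act a (z ≫ curry m) = lift a z ≫ m := by
  have : lift a (z ≫ curry m) = lift a z ≫ X ◁ curry m := by simp
  rw [act, this, Category.assoc, whiskerLeft_curry_ihom_ev_app]

theorem act_curry_assoc {Z Z' Z'' X Y : V} (a : Z ⟶ X) (z : Z ⟶ Z'') (z' : Z'' ⟶ Z')
    (m : X ⊗ Z' ⟶ Y) : act a (z ≫ z' ≫ curry m) = lift a (z ≫ z') ≫ m := by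
  rw [← Category.assoc, act_curry]

theorem act_point {Z X Y : V} (a : Z ⟶ X) (z : Z ⟶ 𝟙_ V) (f : 𝟙_ V ⟶ (ihom X).obj Y) :
    act a (z ≫ f) = a ≫ uncurry' f := by
  have : lift a (z ≫ f) = a ≫ (ρ_ X).inv ≫ X ◁ f := by
    apply CartesianMonoidalCategory.hom_ext <;> simp
    congr 1; exact toUnit_unique _ _
  rw [act, this, uncurry', uncurry_eq]; simp

theorem act_curry' {Z X Y : V} (a : Z ⟶ X) (z : Z ⟶ 𝟙_ V) (f : X ⟶ Y) :
    act a (z ≫ curry' f) = a ≫ f := by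
  rw [act_point, uncurry'_curry']

theorem act_ecomp {Z X Y T : V} (a : Z ⟶ X) (f : Z ⟶ (ihom X).obj Y) (g : Z ⟶ (ihom Y).obj T) :
    act a (ecomp (V := V) (C := V) f g) = act (act a f) g := by
  have : lift a (lift f g) ≫ (α_ X ((ihom X).obj Y) ((ihom Y).obj T)).inv ≫
      (ihom.ev X).app Y ▷ _ = lift (act a f) g := by
    simp [act]
  change act a (lift f g ≫ curry _) = _
  rw [act_curry, MonoidalClosed.compTranspose_eq]
  simp only [← Category.assoc] at this ⊢
  rw [this]; rfl

theorem act_id {Z X : V} (a : Z ⟶ X) (z : Z ⟶ 𝟙_ V) :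
    act a (z ≫ eId V (C := V) X) = a := by
  change act a (z ≫ curry _) = _
  rw [act_curry]; simp

theorem hom_ext_act {Z X Y : V} {f g : Z ⟶ (ihom X).obj Y}
    (h : ∀ {Z' : V} (z : Z' ⟶ Z) (a : Z' ⟶ X), act a (z ≫ f) = act a (z ≫ g)) : f = g := by
  apply uncurry_injective
  have e : ∀ f : Z ⟶ (ihom X).obj Y, uncurry f = act (fst X Z) (snd X Z ≫ f) := by
    intro f
    rw [uncurry_eq, act]; congr 1
    ext <;> simp
  rw [e, e]
  exact h _ _

variable {C : Type*} [EnrichedCategory V C]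

/-- The covariant representable `V`-functor `C(c, -)`. -/
def coRep (c : C) : EnrichedFunctor V C V where
  obj a := c ⟶[V] a
  map a b := curry (eComp V c a b)
  map_id a := hom_ext_act fun z f => by
    rw [act_id, ← Category.assoc, act_curry]
    have := ecomp_id f
    rwa [← toUnit_unique (z ≫ 𝟙 _) (toUnit _), Category.comp_id] at this
  map_comp a b d := map_comp_of (D := V) (obj := fun a => (c ⟶[V] a))
    (map := fun a b => curry (eComp V c a b)) fun {Z} f g => hom_ext_act fun z p => by
    refine Eq.trans ?_ (congrArg (act p) (comp_ecomp (C := V) z _ _).symm)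
    refine Eq.trans ?_ (act_ecomp _ _ _).symm
    rw [act_curry_assoc (V := V) p, act_curry_assoc (V := V), act_curry_assoc (V := V), comp_ecomp]
    exact (ecomp_assoc _ _ _).symm

theorem act_comp_coRep {I : Type*} [EnrichedCategory V I]
    (G : EnrichedFunctor V I C) (A : C) {Z : V} {a b : I}
    (x : Z ⟶ (A ⟶[V] G.obj a)) (k : Z ⟶ (a ⟶[V] b)) :
    act x (k ≫ (G.comp V (coRep A)).map a b) = ecomp x (k ≫ G.map a b) :=
  act_curry_assoc _ _ _ _

/-- A family of maps in `V` satisfying the naturality condition is a `V`-natural transformation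
between `V`-functors with values in `V`. -/
def VNatTrans.ofMaps {F G : EnrichedFunctor V C V} (f : ∀ a, F.obj a ⟶ G.obj a)
    (h : ∀ {Z : V} (a b : C) (x : Z ⟶ F.obj a) (k : Z ⟶ (a ⟶[V] b)),
      act x (k ≫ F.map a b) ≫ f b = act (x ≫ f a) (k ≫ G.map a b)) : VNatTrans F G where
  app a := curry' (f a)
  naturality a b := hom_ext_act fun z x => by
    rw [comp_ecomp (C := V), comp_ecomp (C := V), act_ecomp, act_ecomp, ← Category.assoc z,
      act_curry', ← Category.assoc z, act_curry', h]

/-- The map underlying a component of a `V`-natural transformation with values in `V`. -/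
def VNatTrans.toMap {F G : EnrichedFunctor V C V} (α : VNatTrans F G) (a : C) :
    F.obj a ⟶ G.obj a := uncurry' (α.app a)

theorem VNatTrans.toMap_nat {F G : EnrichedFunctor V C V} (α : VNatTrans F G) {Z : V} (a b : C)
    (x : Z ⟶ F.obj a) (k : Z ⟶ (a ⟶[V] b)) :
    act x (k ≫ F.map a b) ≫ α.toMap b = act (x ≫ α.toMap a) (k ≫ G.map a b) := by
  have := congrArg (fun q => act x (k ≫ q)) (α.naturality a b)
  beta_reduce at this
  rw [comp_ecomp (C := V), comp_ecomp (C := V), act_ecomp, act_ecomp, ← Category.assoc k,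
    ← Category.assoc k, act_point, act_point] at this
  exact this

/-- For `x : F d`, the `V`-natural transformation `D(d, -) ⇒ F` corresponding to `x` under
the enriched Yoneda lemma. -/
def yonedaTrans (F : EnrichedFunctor V C V) {d : C} (x : 𝟙_ V ⟶ F.obj d) :
    VNatTrans (coRep d) F :=
  VNatTrans.ofMaps
    (fun a => (act (toUnit (d ⟶[V] a) ≫ x) (F.map d a) : (d ⟶[V] a) ⟶ F.obj a))
    fun {Z} a b y k => by
    have h1 : act y (k ≫ (coRep d).map a b) = ecomp y k := act_curry _ _ _
    have h2 : ∀ (c : C) (q : Z ⟶ (d ⟶[V] c)), q ≫ act (toUnit (d ⟶[V] c) ≫ x) (F.map d c) =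
        act (toUnit Z ≫ x) (q ≫ F.map d c) := fun c q => by
      rw [comp_act, ← Category.assoc, toUnit_unique (q ≫ toUnit _) (toUnit Z)]
    refine (congrArg (· ≫ act (toUnit (d ⟶[V] b) ≫ x) (F.map d b)) h1).trans ?_
    refine (h2 b _).trans ?_
    refine Eq.trans ?_ (congrArg (fun q => act q (k ≫ F.map a b)) (h2 a y)).symm
    refine (congrArg (act (toUnit Z ≫ x)) (ecomp_map F (a := d) y k)).trans ?_
    exact act_ecomp (V := V) _ _ _

/-- `F` is represented by the pair `(d, x)`. -/
def IsRepresentedBy (F : EnrichedFunctor V C V) (d : C) (x : 𝟙_ V ⟶ F.obj d) : Prop :=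
  (yonedaTrans F x).IsIso

end Closed

end Enriched

section FunctorCategory

open CartesianMonoidalCategory MonoidalClosed

variable {V : Type u} [Category.{v} V] [CartesianMonoidalCategory V] [MonoidalClosed V]
  [HasCoproducts.{w} V] [Extensive.{w} V] [HasPullbacks V]
variable {I : Type w} [EnrichedCategory V I] {D : Type*} [EnrichedCategory V D]

/-- The map `∏ a, D(F a, G a) ⟶ ∏ (a, b), [I(a, b), D(F a, G b)]` given by precomposing with `F`. -/
def funHomLeft (F G : EnrichedFunctor V I D) :
    (∏ᶜ fun a : I => (F.obj a ⟶[V] G.obj a)) ⟶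
      ∏ᶜ fun p : I × I => (ihom (p.1 ⟶[V] p.2)).obj (F.obj p.1 ⟶[V] G.obj p.2) :=
  Pi.lift fun p => curry (ecomp (fst _ _ ≫ F.map p.1 p.2) (snd _ _ ≫ Pi.π _ p.2))

/-- The map `∏ a, D(F a, G a) ⟶ ∏ (a, b), [I(a, b), D(F a, G b)]` given by postcomposing with
`G`. -/
def funHomRight (F G : EnrichedFunctor V I D) :
    (∏ᶜ fun a : I => (F.obj a ⟶[V] G.obj a)) ⟶
      ∏ᶜ fun p : I × I => (ihom (p.1 ⟶[V] p.2)).obj (F.obj p.1 ⟶[V] G.obj p.2) :=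
  Pi.lift fun p => curry (ecomp (snd _ _ ≫ Pi.π _ p.1) (fst _ _ ≫ G.map p.1 p.2))

/-- The hom-object of the functor `V`-category from `F` to `G`. -/
def funHom (F G : EnrichedFunctor V I D) : V := equalizer (funHomLeft F G) (funHomRight F G)

/-- The inclusion of the object of `V`-natural transformations into the product. -/
def funIncl (F G : EnrichedFunctor V I D) :
    funHom F G ⟶ ∏ᶜ fun a : I => (F.obj a ⟶[V] G.obj a) :=
  equalizer.ι (funHomLeft F G) (funHomRight F G)

theorem funIncl_w (F G : EnrichedFunctor V I D) :
    funIncl F G ≫ funHomLeft F G = funIncl F G ≫ funHomRight F G :=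
  equalizer.condition (funHomLeft F G) (funHomRight F G)

/-- The component at `a` of the object of `V`-natural transformations. -/
def funProj (F G : EnrichedFunctor V I D) (a : I) : funHom F G ⟶ (F.obj a ⟶[V] G.obj a) :=
  funIncl F G ≫ Pi.π _ a

theorem funHom_ext {F G : EnrichedFunctor V I D} {Z : V} {f g : Z ⟶ funHom F G}
    (h : ∀ a, f ≫ funProj F G a = g ≫ funProj F G a) : f = g :=
  equalizer.hom_ext (Pi.hom_ext _ _ fun a => by
    have := h a
    simp only [funProj, ← Category.assoc] at this
    exact this)

theorem lift_funHom (F G : EnrichedFunctor V I D) {Z : V}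
    (x : Z ⟶ ∏ᶜ fun a : I => (F.obj a ⟶[V] G.obj a)) (a b : I) {Z' : V}
    (k : Z' ⟶ (a ⟶[V] b)) (z : Z' ⟶ Z) :
    act k (z ≫ x ≫ funHomLeft F G ≫ Pi.π _ (a, b)) =
      ecomp (k ≫ F.map a b) ((z ≫ x) ≫ Pi.π _ b) ∧
    act k (z ≫ x ≫ funHomRight F G ≫ Pi.π _ (a, b)) =
      ecomp ((z ≫ x) ≫ Pi.π _ a) (k ≫ G.map a b) := by
  constructor
  · rw [funHomLeft, Pi.lift_π, act_curry_assoc, comp_ecomp]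
    simp
  · rw [funHomRight, Pi.lift_π, act_curry_assoc, comp_ecomp]
    simp

theorem funProj_wedge {F G : EnrichedFunctor V I D} {Z : V} {a b : I} (k : Z ⟶ (a ⟶[V] b))
    (h : Z ⟶ funHom F G) :
    ecomp (k ≫ F.map a b) (h ≫ funProj F G b) = ecomp (h ≫ funProj F G a) (k ≫ G.map a b) := by
  have h1 := lift_funHom F G (funIncl F G) a b k h
  rw [← Category.assoc (funIncl F G), ← Category.assoc (funIncl F G), funIncl_w] at h1
  have := h1.1.symm.trans h1.2
  simpa only [funProj, Category.assoc] using this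

theorem exists_funLift {F G : EnrichedFunctor V I D} {Z : V} (f : ∀ a, Z ⟶ (F.obj a ⟶[V] G.obj a))
    (hf : ∀ (Z' : V) (z : Z' ⟶ Z) (a b : I) (k : Z' ⟶ (a ⟶[V] b)),
      ecomp (k ≫ F.map a b) (z ≫ f b) = ecomp (z ≫ f a) (k ≫ G.map a b)) :
    ∃ m : Z ⟶ funHom F G, ∀ a, m ≫ funProj F G a = f a := by
  refine ⟨equalizer.lift (Pi.lift f) (limit.hom_ext fun ⟨p⟩ => ?_), fun a => ?_⟩
  · refine hom_ext_act fun z k => ?_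
    have h1 := lift_funHom F G (Pi.lift f) p.1 p.2 k z
    have := (h1.1.trans ?_).trans h1.2.symm
    · simpa only [Category.assoc] using this
    · simpa using hf _ z p.1 p.2 k
  · refine (Category.assoc _ (funIncl F G) (Pi.π _ a)).symm.trans ?_
    refine (congrArg (· ≫ Pi.π _ a) (equalizer.lift_ι (Pi.lift f) _)).trans ?_
    simp

/-- The generalized `V`-natural transformation with the given components. -/
def funLift {F G : EnrichedFunctor V I D} {Z : V} (f : ∀ a, Z ⟶ (F.obj a ⟶[V] G.obj a))
    (hf : ∀ (Z' : V) (z : Z' ⟶ Z) (a b : I) (k : Z' ⟶ (a ⟶[V] b)),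
      ecomp (k ≫ F.map a b) (z ≫ f b) = ecomp (z ≫ f a) (k ≫ G.map a b)) : Z ⟶ funHom F G :=
  (exists_funLift f hf).choose

theorem funLift_proj {F G : EnrichedFunctor V I D} {Z : V} (f : ∀ a, Z ⟶ (F.obj a ⟶[V] G.obj a))
    (hf : ∀ (Z' : V) (z : Z' ⟶ Z) (a b : I) (k : Z' ⟶ (a ⟶[V] b)),
      ecomp (k ≫ F.map a b) (z ≫ f b) = ecomp (z ≫ f a) (k ≫ G.map a b)) (a : I) :
    funLift f hf ≫ funProj F G a = f a :=
  (exists_funLift f hf).choose_spec a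

/-- Vertical composition of generalized `V`-natural transformations. -/
def funComp {F G H : EnrichedFunctor V I D} {Z : V} (f : Z ⟶ funHom F G) (g : Z ⟶ funHom G H) :
    Z ⟶ funHom F H :=
  funLift (fun a => ecomp (f ≫ funProj F G a) (g ≫ funProj G H a)) fun Z' z a b k => by
    rw [comp_ecomp, comp_ecomp, ← ecomp_assoc, ← Category.assoc z, funProj_wedge, ecomp_assoc,
      ← Category.assoc z, funProj_wedge, ← ecomp_assoc, Category.assoc, Category.assoc]

theorem funComp_proj {F G H : EnrichedFunctor V I D} {Z : V} (f : Z ⟶ funHom F G)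
    (g : Z ⟶ funHom G H) (a : I) :
    funComp f g ≫ funProj F H a = ecomp (f ≫ funProj F G a) (g ≫ funProj G H a) :=
  funLift_proj (F := F) _ _ a

/-- The generalized identity `V`-natural transformation. -/
def funId (F : EnrichedFunctor V I D) (Z : V) : Z ⟶ funHom F F :=
  funLift (fun a => toUnit Z ≫ eId V (F.obj a)) fun Z' z a b k => by
    rw [← Category.assoc, toUnit_unique (z ≫ toUnit Z) (toUnit Z'), ← Category.assoc,
      toUnit_unique (z ≫ toUnit Z) (toUnit Z'), ecomp_id, id_ecomp]

theorem funId_proj (F : EnrichedFunctor V I D) (Z : V) (a : I) :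
    funId F Z ≫ funProj F F a = toUnit Z ≫ eId V (F.obj a) :=
  funLift_proj (F := F) _ _ a

theorem comp_funComp {F G H : EnrichedFunctor V I D} {Z' Z : V} (z : Z' ⟶ Z) (f : Z ⟶ funHom F G)
    (g : Z ⟶ funHom G H) : z ≫ funComp f g = funComp (z ≫ f) (z ≫ g) :=
  funHom_ext fun a => by
    rw [Category.assoc, funComp_proj, funComp_proj, comp_ecomp, Category.assoc, Category.assoc]

theorem comp_funId {F : EnrichedFunctor V I D} {Z' Z : V} (z : Z' ⟶ Z) :
    z ≫ funId F Z = funId F Z' :=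
  funHom_ext fun a => by
    rw [Category.assoc, funId_proj, funId_proj, ← Category.assoc, toUnit_unique (z ≫ toUnit Z) (toUnit Z')]

/-- The `V`-category of `V`-functors from `I` to `D`. -/
instance functorCategory : EnrichedCategory V (EnrichedFunctor V I D) where
  Hom F G := funHom F G
  id F := funId F (𝟙_ V)
  comp F G H := funComp (fst (funHom F G) (funHom G H)) (snd (funHom F G) (funHom G H))
  id_comp F G := by
    rw [comp_funComp, comp_funComp]
    refine funHom_ext fun a => ?_
    rw [funComp_proj]
    have h1 : (λ_ (funHom F G)).inv ≫ funId F (𝟙_ V) ▷ funHom F G ≫ fst _ _ = funId F _ := by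
      rw [whiskerRight_fst, ← Category.assoc, comp_funId]
    rw [h1]
    simp [funId_proj, id_ecomp]
  comp_id F G := by
    rw [comp_funComp, comp_funComp]
    refine funHom_ext fun a => ?_
    rw [funComp_proj]
    have h1 : (ρ_ (funHom F G)).inv ≫ funHom F G ◁ funId G (𝟙_ V) ≫ snd _ _ = funId G _ := by
      rw [whiskerLeft_snd, ← Category.assoc, comp_funId]
    rw [h1]
    simp [funId_proj, ecomp_id]
  assoc F G H K := by
    refine funHom_ext fun a => ?_
    simp only [comp_funComp, funComp_proj, Category.assoc, whiskerRight_fst_assoc,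
      whiskerRight_snd_assoc, whiskerLeft_fst_assoc, whiskerLeft_snd_assoc, comp_ecomp,
      associator_inv_fst_fst_assoc, associator_inv_fst_snd_assoc, associator_inv_snd_assoc,
      ecomp_assoc]

theorem funCategory_ecomp {F G H : EnrichedFunctor V I D} {Z : V} (f : Z ⟶ funHom F G)
    (g : Z ⟶ funHom G H) :
    ecomp (V := V) (C := EnrichedFunctor V I D) (a := F) (b := G) (c := H) f g = funComp f g := by
  change lift f g ≫ funComp _ _ = _
  rw [comp_funComp, lift_fst, lift_snd]

/-- The element of the hom-object of the functor `V`-category corresponding to a `V`-natural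
transformation. -/
def VNatTrans.elt {F G : EnrichedFunctor V I D} (α : VNatTrans F G) : 𝟙_ V ⟶ funHom F G :=
  funLift α.app fun Z' z a b k => by
    have := congrArg (k ≫ ·) (α.naturality a b)
    beta_reduce at this
    rw [comp_ecomp, comp_ecomp, ← Category.assoc k, ← Category.assoc k,
      toUnit_unique (k ≫ toUnit _) z] at this
    exact this

end FunctorCategory

section WeightedLimits

open CartesianMonoidalCategory MonoidalClosed Opposite

variable {V : Type u} [Category.{v} V] [CartesianMonoidalCategory V] [BraidedCategory V]

theorem op_ecomp {C : Type*} [EnrichedCategory V C] {Z : V} {a b c : Cᵒᵖ} (f : Z ⟶ (a ⟶[V] b))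
    (g : Z ⟶ (b ⟶[V] c)) :
    ecomp f g = ecomp (C := C) (a := c.unop) (b := b.unop) (c := a.unop) g f := by
  have : lift f g ≫ (β_ _ _).hom = lift g f := by
    apply CartesianMonoidalCategory.hom_ext <;> simp
  change lift f g ≫ (β_ _ _).hom ≫ eComp V c.unop b.unop a.unop = _
  rw [← Category.assoc, this]; rfl

variable [MonoidalClosed V] [HasCoproducts.{w} V] [Extensive.{w} V] [HasPullbacks V]
variable {I : Type w} [EnrichedCategory V I] {C : Type*} [EnrichedCategory V C]

theorem act_comp_coRep' (G : EnrichedFunctor V I C) (A : C) {Z Z' : V} {a b : I}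
    (x : Z ⟶ (A ⟶[V] G.obj a)) (z : Z ⟶ Z') (k : Z' ⟶ (a ⟶[V] b)) :
    act x (z ≫ k ≫ (G.comp V (coRep A)).map a b) = ecomp x ((z ≫ k) ≫ G.map a b) :=
  (congrArg (act x) (Category.assoc _ _ _).symm).trans (act_comp_coRep G A x (z ≫ k))

/-- Precomposition with a generalized element of a hom-object. -/
def preMap (A B c : C) : (B ⟶[V] A) ⟶ (ihom (A ⟶[V] c)).obj (B ⟶[V] c) :=
  curry (ecomp (snd (A ⟶[V] c) (B ⟶[V] A)) (fst (A ⟶[V] c) (B ⟶[V] A)))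

theorem act_preMap {A B c : C} {Z : V} (x : Z ⟶ (A ⟶[V] c)) (z : Z ⟶ (B ⟶[V] A)) :
    act x (z ≫ preMap A B c) = ecomp z x := by
  rw [preMap, act_curry, comp_ecomp, lift_fst, lift_snd]

theorem act_preMap' {A B c : C} {Z Z' : V} (x : Z ⟶ (A ⟶[V] c)) (z : Z ⟶ Z')
    (k : Z' ⟶ (B ⟶[V] A)) : act x (z ≫ k ≫ preMap A B c) = ecomp (z ≫ k) x :=
  (congrArg (act x) (Category.assoc _ _ _).symm).trans (act_preMap x (z ≫ k))

theorem preMap_nat (G : EnrichedFunctor V I C) (A B : C) {Z : V} (z : Z ⟶ (B ⟶[V] A)) (a b : I)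
    (k : Z ⟶ (a ⟶[V] b)) :
    ecomp (V := V) (C := V) (k ≫ (G.comp V (coRep A)).map a b) (z ≫ preMap A B (G.obj b)) =
      ecomp (V := V) (C := V) (z ≫ preMap A B (G.obj a)) (k ≫ (G.comp V (coRep B)).map a b) := by
  refine hom_ext_act fun {Z'} z' x => ?_
  refine (congrArg (act x) (comp_ecomp (C := V) z' _ _)).trans ?_
  refine Eq.trans ?_ (congrArg (act x) (comp_ecomp (C := V) z' _ _)).symm
  refine (act_ecomp _ _ _).trans (Eq.trans ?_ (act_ecomp _ _ _).symm)
  refine (congrArg (act · _) (act_comp_coRep' G A x z' k)).trans ?_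
  refine Eq.trans ?_ (congrArg (act · _) (act_preMap' x z' z)).symm
  refine (act_preMap' _ _ _).trans (Eq.trans ?_ (act_comp_coRep' G B _ _ _).symm)
  exact (ecomp_assoc _ _ _).symm

/-- Precomposition with a generalized element of a hom-object, as a `V`-natural transformation. -/
def preTrans (G : EnrichedFunctor V I C) (A B : C) :
    (B ⟶[V] A) ⟶ funHom (G.comp V (coRep A)) (G.comp V (coRep B)) :=
  funLift (F := G.comp V (coRep A)) (G := G.comp V (coRep B)) (fun a => preMap A B (G.obj a))
    fun Z z a b k => preMap_nat G A B z a b k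

theorem preTrans_proj (G : EnrichedFunctor V I C) (A B : C) (a : I) :
    preTrans G A B ≫ funProj _ _ a = preMap A B (G.obj a) :=
  funLift_proj (F := G.comp V (coRep A)) _ _ a

theorem preTrans_id (G : EnrichedFunctor V I C) (A : C) :
    eId V A ≫ preTrans G A A = funId (G.comp V (coRep A)) (𝟙_ V) := by
  refine funHom_ext fun a => ?_
  rw [Category.assoc, preTrans_proj, funId_proj]
  refine hom_ext_act fun {Z} z x => ?_
  refine Eq.trans ?_ (Eq.trans (act_id x (z ≫ toUnit _)).symm (by simp))
  refine (act_preMap' _ _ _).trans ?_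
  rw [toUnit_unique z (toUnit Z)]
  exact id_ecomp _

theorem preTrans_comp (G : EnrichedFunctor V I C) (A B D : C) {Z : V} (f : Z ⟶ (B ⟶[V] A))
    (g : Z ⟶ (D ⟶[V] B)) :
    ecomp g f ≫ preTrans G A D = funComp (f ≫ preTrans G A B) (g ≫ preTrans G B D) := by
  refine funHom_ext fun a => ?_
  rw [Category.assoc, preTrans_proj, funComp_proj, Category.assoc, Category.assoc, preTrans_proj,
    preTrans_proj]
  refine hom_ext_act fun z x => ?_
  refine Eq.trans ?_ (congrArg (act x) (comp_ecomp (C := V) z _ _)).symm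
  refine Eq.trans ?_ (act_ecomp _ _ _).symm
  refine (act_preMap' _ _ _).trans (Eq.trans ?_ (act_preMap' _ _ _).symm)
  refine Eq.trans ?_ (congrArg (ecomp (z ≫ g)) (act_preMap' _ _ _)).symm
  rw [comp_ecomp]
  exact ecomp_assoc _ _ _

/-- The `V`-functor `A ↦ C(A, G -)` from `Cᵒᵖ` to `V^I`. -/
def homFunctor (G : EnrichedFunctor V I C) : EnrichedFunctor V Cᵒᵖ (EnrichedFunctor V I V) where
  obj A := G.comp V (coRep A.unop)
  map A B := preTrans G A.unop B.unop
  map_id A := preTrans_id G A.unop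
  map_comp A B D := map_comp_of (C := Cᵒᵖ) (D := EnrichedFunctor V I V)
    (obj := fun A => G.comp V (coRep A.unop)) (map := fun A B => preTrans G A.unop B.unop)
    fun f g => by
      rw [op_ecomp]
      exact (preTrans_comp G A.unop B.unop D.unop f g).trans (funCategory_ecomp _ _).symm

/-- The `V`-functor `A ↦ V^I(W, C(A, G -))` from `Cᵒᵖ` to `V`. -/
def coneFunctor (W : EnrichedFunctor V I V) (G : EnrichedFunctor V I C) : EnrichedFunctor V Cᵒᵖ V :=
  (homFunctor G).comp V (coRep W)

/-- `(L, lam)` is a `W`-weighted `V`-limit of `G`: the `V`-functor `A ↦ V^I(W, C(A, G -))` is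
represented by `L` together with its element `lam`. -/
def IsWeightedLimit (W : EnrichedFunctor V I V) (G : EnrichedFunctor V I C) (L : C)
    (lam : VNatTrans W (G.comp V (coRep L))) : Prop :=
  IsRepresentedBy (coneFunctor W G) (op L) lam.elt

end WeightedLimits

section InternalCategories

variable {V : Type u} [Category.{v} V] [HasPullbacks V]

/-- An internal category in a category with pullbacks. -/
structure InternalCat (V : Type u) [Category.{v} V] [HasPullbacks V] where
  obj₀ : V
  obj₁ : V
  s : obj₁ ⟶ obj₀
  t : obj₁ ⟶ obj₀
  i : obj₀ ⟶ obj₁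
  c : pullback t s ⟶ obj₁
  i_s : i ≫ s = 𝟙 obj₀
  i_t : i ≫ t = 𝟙 obj₀
  c_s : c ≫ s = pullback.fst t s ≫ s
  c_t : c ≫ t = pullback.snd t s ≫ t
  id_c : pullback.lift (s ≫ i) (𝟙 obj₁) (by rw [Category.assoc, i_t, Category.comp_id,
    Category.id_comp]) ≫ c = 𝟙 obj₁
  c_id : pullback.lift (𝟙 obj₁) (t ≫ i) (by rw [Category.assoc, i_s, Category.comp_id,
    Category.id_comp]) ≫ c = 𝟙 obj₁
  assoc : ∀ {X : V} (f g h : X ⟶ obj₁) (h₁ : f ≫ t = g ≫ s) (h₂ : g ≫ t = h ≫ s),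
    pullback.lift (pullback.lift f g h₁ ≫ c) h (by rw [Category.assoc, c_t,
      pullback.lift_snd_assoc, h₂]) ≫ c =
    pullback.lift f (pullback.lift g h h₂ ≫ c) (by rw [Category.assoc, c_s,
      pullback.lift_fst_assoc, h₁]) ≫ c

namespace InternalCat

/-- Composition of composable generalized morphisms of an internal category. -/
def comp (A : InternalCat V) {X : V} (f g : X ⟶ A.obj₁) (h : f ≫ A.t = g ≫ A.s) : X ⟶ A.obj₁ :=
  pullback.lift f g h ≫ A.c

variable (A B : InternalCat V)

theorem comp_s {X : V} (f g : X ⟶ A.obj₁) (h : f ≫ A.t = g ≫ A.s) :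
    A.comp f g h ≫ A.s = f ≫ A.s := by
  rw [comp, Category.assoc, c_s, pullback.lift_fst_assoc]

theorem comp_t {X : V} (f g : X ⟶ A.obj₁) (h : f ≫ A.t = g ≫ A.s) :
    A.comp f g h ≫ A.t = g ≫ A.t := by
  rw [comp, Category.assoc, c_t, pullback.lift_snd_assoc]

theorem whisker_eq {X Y : V} (z : Y ⟶ X) {f g : X ⟶ A.obj₁} (h : f ≫ A.t = g ≫ A.s) :
    (z ≫ f) ≫ A.t = (z ≫ g) ≫ A.s := by
  rw [Category.assoc, Category.assoc, h]

theorem precomp {X Y : V} (z : Y ⟶ X) (f g : X ⟶ A.obj₁) (h : f ≫ A.t = g ≫ A.s) :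
    z ≫ A.comp f g h = A.comp (z ≫ f) (z ≫ g) (A.whisker_eq z h) := by
  rw [comp, comp, ← Category.assoc]
  congr 1
  apply pullback.hom_ext <;> simp [pullback.lift_fst, pullback.lift_snd]

theorem comp_congr {X : V} {f g f' g' : X ⟶ A.obj₁} (hf : f = f') (hg : g = g')
    (h : f ≫ A.t = g ≫ A.s) :
    A.comp f g h = A.comp f' g' (by rw [← hf, ← hg, h]) := by
  subst hf; subst hg; rfl

theorem comp_assoc {X : V} (f g k : X ⟶ A.obj₁) (h₁ : f ≫ A.t = g ≫ A.s)
    (h₂ : g ≫ A.t = k ≫ A.s) :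
    A.comp (A.comp f g h₁) k (by rw [comp_t, h₂]) =
      A.comp f (A.comp g k h₂) (by rw [comp_s, h₁]) :=
  A.assoc f g k h₁ h₂

theorem id_comp {X : V} (a : X ⟶ A.obj₀) (f : X ⟶ A.obj₁) (h : (a ≫ A.i) ≫ A.t = f ≫ A.s) :
    A.comp (a ≫ A.i) f h = f := by
  have ha : a = f ≫ A.s := by rw [← h, Category.assoc, i_t, Category.comp_id]
  subst ha
  have := congrArg (f ≫ ·) A.id_c
  simp only [← Category.assoc, Category.comp_id] at this
  rw [comp]
  convert this using 2
  apply pullback.hom_ext <;> simp [pullback.lift_fst, pullback.lift_snd]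

theorem comp_id {X : V} (a : X ⟶ A.obj₀) (f : X ⟶ A.obj₁) (h : f ≫ A.t = (a ≫ A.i) ≫ A.s) :
    A.comp f (a ≫ A.i) h = f := by
  have ha : a = f ≫ A.t := by rw [h, Category.assoc, i_s, Category.comp_id]
  subst ha
  have := congrArg (f ≫ ·) A.c_id
  simp only [← Category.assoc, Category.comp_id] at this
  rw [comp]
  convert this using 2
  apply pullback.hom_ext <;> simp [pullback.lift_fst, pullback.lift_snd]

theorem ofElements_key {obj₀ obj₁ : V} {s t : obj₁ ⟶ obj₀}
    {comp : ∀ (X : V) (f g : X ⟶ obj₁), f ≫ t = g ≫ s → (X ⟶ obj₁)}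
    (precomp : ∀ (X Y : V) (z : Y ⟶ X) (f g : X ⟶ obj₁) (h : f ≫ t = g ≫ s)
      (h' : (z ≫ f) ≫ t = (z ≫ g) ≫ s), z ≫ comp X f g h = comp Y (z ≫ f) (z ≫ g) h')
    (X : V) (f g : X ⟶ obj₁) (h : f ≫ t = g ≫ s) :
    pullback.lift f g h ≫ comp _ (pullback.fst t s) (pullback.snd t s) pullback.condition =
      comp X f g h := by
  rw [precomp _ _ _ _ _ _ (by rw [pullback.lift_fst, pullback.lift_snd, h])]
  congr 1
  · exact pullback.lift_fst _ _ _
  · exact pullback.lift_snd _ _ _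

/-- An internal category given by its composition of generalized morphisms. -/
@[reducible] def ofElements (obj₀ obj₁ : V) (s t : obj₁ ⟶ obj₀) (i : obj₀ ⟶ obj₁)
    (comp : ∀ (X : V) (f g : X ⟶ obj₁), f ≫ t = g ≫ s → (X ⟶ obj₁))
    (precomp : ∀ (X Y : V) (z : Y ⟶ X) (f g : X ⟶ obj₁) (h : f ≫ t = g ≫ s)
      (h' : (z ≫ f) ≫ t = (z ≫ g) ≫ s), z ≫ comp X f g h = comp Y (z ≫ f) (z ≫ g) h')
    (i_s : i ≫ s = 𝟙 obj₀) (i_t : i ≫ t = 𝟙 obj₀)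
    (comp_s : ∀ (X : V) (f g : X ⟶ obj₁) (h : f ≫ t = g ≫ s), comp X f g h ≫ s = f ≫ s)
    (comp_t : ∀ (X : V) (f g : X ⟶ obj₁) (h : f ≫ t = g ≫ s), comp X f g h ≫ t = g ≫ t)
    (id_comp : ∀ (X : V) (f : X ⟶ obj₁) (h : (f ≫ s ≫ i) ≫ t = f ≫ s),
      comp X (f ≫ s ≫ i) f h = f)
    (comp_id : ∀ (X : V) (f : X ⟶ obj₁) (h : f ≫ t = (f ≫ t ≫ i) ≫ s),
      comp X f (f ≫ t ≫ i) h = f)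
    (assoc : ∀ (X : V) (f g k : X ⟶ obj₁) (h₁ : f ≫ t = g ≫ s) (h₂ : g ≫ t = k ≫ s)
      (h₃ : comp X f g h₁ ≫ t = k ≫ s) (h₄ : f ≫ t = comp X g k h₂ ≫ s),
      comp X (comp X f g h₁) k h₃ = comp X f (comp X g k h₂) h₄) : InternalCat V :=
  { obj₀ := obj₀
    obj₁ := obj₁
    s := s
    t := t
    i := i
    c := comp _ (pullback.fst t s) (pullback.snd t s) pullback.condition
    i_s := i_s
    i_t := i_t
    c_s := comp_s _ _ _ _
    c_t := comp_t _ _ _ _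
    id_c := by
      rw [ofElements_key precomp]
      have := id_comp _ (𝟙 obj₁) (by simp [i_t])
      simpa only [Category.id_comp] using this
    c_id := by
      rw [ofElements_key precomp]
      have := comp_id _ (𝟙 obj₁) (by simp [i_s])
      simpa only [Category.id_comp] using this
    assoc := fun f g h h₁ h₂ => by
      refine (ofElements_key precomp _ _ _ _).trans (Eq.trans ?_ (ofElements_key precomp _ _ _ _).symm)
      have e₁ := ofElements_key precomp _ f g h₁
      have e₂ := ofElements_key precomp _ g h h₂
      have := assoc _ f g h h₁ h₂ (by rw [comp_t, h₂]) (by rw [comp_s, h₁])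
      simp only [e₁, e₂]
      exact this }

theorem ofElements_comp (obj₀ obj₁ : V) (s t : obj₁ ⟶ obj₀) (i : obj₀ ⟶ obj₁)
    (comp : ∀ (X : V) (f g : X ⟶ obj₁), f ≫ t = g ≫ s → (X ⟶ obj₁))
    (precomp : ∀ (X Y : V) (z : Y ⟶ X) (f g : X ⟶ obj₁) (h : f ≫ t = g ≫ s)
      (h' : (z ≫ f) ≫ t = (z ≫ g) ≫ s), z ≫ comp X f g h = comp Y (z ≫ f) (z ≫ g) h')
    (i_s : i ≫ s = 𝟙 obj₀) (i_t : i ≫ t = 𝟙 obj₀)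
    (comp_s : ∀ (X : V) (f g : X ⟶ obj₁) (h : f ≫ t = g ≫ s), comp X f g h ≫ s = f ≫ s)
    (comp_t : ∀ (X : V) (f g : X ⟶ obj₁) (h : f ≫ t = g ≫ s), comp X f g h ≫ t = g ≫ t)
    (id_comp : ∀ (X : V) (f : X ⟶ obj₁) (h : (f ≫ s ≫ i) ≫ t = f ≫ s),
      comp X (f ≫ s ≫ i) f h = f)
    (comp_id : ∀ (X : V) (f : X ⟶ obj₁) (h : f ≫ t = (f ≫ t ≫ i) ≫ s),
      comp X f (f ≫ t ≫ i) h = f)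
    (assoc : ∀ (X : V) (f g k : X ⟶ obj₁) (h₁ : f ≫ t = g ≫ s) (h₂ : g ≫ t = k ≫ s)
      (h₃ : comp X f g h₁ ≫ t = k ≫ s) (h₄ : f ≫ t = comp X g k h₂ ≫ s),
      comp X (comp X f g h₁) k h₃ = comp X f (comp X g k h₂) h₄) {X : V} (f g : X ⟶ obj₁)
    (h : f ≫ t = g ≫ s) :
    (ofElements obj₀ obj₁ s t i comp precomp i_s i_t comp_s comp_t
       id_comp comp_id assoc).comp f g h =
      comp X f g h :=
  ofElements_key precomp X f g h

/-- An internal functor. -/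
@[ext]
structure Hom (A B : InternalCat V) where
  map₀ : A.obj₀ ⟶ B.obj₀
  map₁ : A.obj₁ ⟶ B.obj₁
  map_s : map₁ ≫ B.s = A.s ≫ map₀
  map_t : map₁ ≫ B.t = A.t ≫ map₀
  map_i : A.i ≫ map₁ = map₀ ≫ B.i
  map_c : A.c ≫ map₁ = B.comp (pullback.fst A.t A.s ≫ map₁) (pullback.snd A.t A.s ≫ map₁)
    (by rw [Category.assoc, Category.assoc, map_s, map_t, pullback.condition_assoc])

variable {A B}

theorem Hom.map_eq (F : Hom A B) {X : V} {f g : X ⟶ A.obj₁} (h : f ≫ A.t = g ≫ A.s) :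
    (f ≫ F.map₁) ≫ B.t = (g ≫ F.map₁) ≫ B.s := by
  rw [Category.assoc, Category.assoc, F.map_s, F.map_t, reassoc_of% h]

theorem Hom.map_comp (F : Hom A B) {X : V} (f g : X ⟶ A.obj₁) (h : f ≫ A.t = g ≫ A.s) :
    A.comp f g h ≫ F.map₁ = B.comp (f ≫ F.map₁) (g ≫ F.map₁) (F.map_eq h) := by
  rw [comp, Category.assoc, F.map_c, precomp]
  exact B.comp_congr (pullback.lift_fst_assoc _ _ _ _) (pullback.lift_snd_assoc _ _ _ _) _

theorem Hom.map_c_of {map₁ : A.obj₁ ⟶ B.obj₁}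
    (h : ∀ (X : V) (f g : X ⟶ A.obj₁) (h : f ≫ A.t = g ≫ A.s)
      (h' : (f ≫ map₁) ≫ B.t = (g ≫ map₁) ≫ B.s),
      A.comp f g h ≫ map₁ = B.comp (f ≫ map₁) (g ≫ map₁) h')
    (h' : (pullback.fst A.t A.s ≫ map₁) ≫ B.t = (pullback.snd A.t A.s ≫ map₁) ≫ B.s) :
    A.c ≫ map₁ = B.comp (pullback.fst A.t A.s ≫ map₁) (pullback.snd A.t A.s ≫ map₁) h' := by
  rw [← h _ _ _ pullback.condition, comp]
  congr 1
  have : pullback.lift (pullback.fst A.t A.s) (pullback.snd A.t A.s) pullback.condition = 𝟙 _ := by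
    apply pullback.hom_ext <;> simp [pullback.lift_fst, pullback.lift_snd]
  rw [this, Category.id_comp]

/-- The category `Cat(V)` of internal categories and internal functors. -/
instance : Category (InternalCat V) where
  Hom := Hom
  id A :=
    { map₀ := 𝟙 _
      map₁ := 𝟙 _
      map_s := by simp
      map_t := by simp
      map_i := by simp
      map_c := Hom.map_c_of (fun X f g h h' => by
        rw [Category.comp_id]; exact A.comp_congr (by simp) (by simp) _) _ }
  comp F G :=
    { map₀ := F.map₀ ≫ G.map₀
      map₁ := F.map₁ ≫ G.map₁
      map_s := by rw [Category.assoc, G.map_s, ← Category.assoc, F.map_s, Category.assoc]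
      map_t := by rw [Category.assoc, G.map_t, ← Category.assoc, F.map_t, Category.assoc]
      map_i := by rw [← Category.assoc, F.map_i, Category.assoc, G.map_i, Category.assoc]
      map_c := Hom.map_c_of (fun X f g h h' => by
        rw [← Category.assoc, F.map_comp, G.map_comp]
        exact comp_congr _ (by simp) (by simp) _) _ }
  id_comp F := by apply Hom.ext <;> simp
  comp_id F := by apply Hom.ext <;> simp
  assoc F G H := by apply Hom.ext <;> simp

theorem hom_ext {F G : A ⟶ B} (h₀ : F.map₀ = G.map₀) (h₁ : F.map₁ = G.map₁) : F = G :=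
  Hom.ext h₀ h₁

theorem id_map₀ (A : InternalCat V) : Hom.map₀ (𝟙 A) = 𝟙 A.obj₀ := rfl
theorem id_map₁ (A : InternalCat V) : Hom.map₁ (𝟙 A) = 𝟙 A.obj₁ := rfl
theorem comp_map₀ {A B C : InternalCat V} (F : A ⟶ B) (G : B ⟶ C) :
    (F ≫ G).map₀ = F.map₀ ≫ G.map₀ := rfl
theorem comp_map₁ {A B C : InternalCat V} (F : A ⟶ B) (G : B ⟶ C) :
    (F ≫ G).map₁ = F.map₁ ≫ G.map₁ := rfl

/-- The constant internal category at an object of `V`. -/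
@[reducible] def cst (X : V) : InternalCat V :=
  ofElements X X (𝟙 X) (𝟙 X) (𝟙 X) (fun _ f _ _ => f) (fun _ _ _ _ _ _ _ => rfl) (by simp) (by simp)
    (fun _ _ _ _ => rfl) (fun _ _ _ h => h) (by simp) (by simp) (by simp)

/-- The internal functor `cst X ⟶ A` corresponding to a generalized object of `A`. -/
@[reducible] def ofObj (A : InternalCat V) {X : V} (a : X ⟶ A.obj₀) : cst X ⟶ A where
  map₀ := a
  map₁ := a ≫ A.i
  map_s := by
    exact (Category.assoc a A.i A.s).trans (by
      rw [A.i_s, Category.comp_id]; exact (Category.id_comp a).symm)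
  map_t := by
    exact (Category.assoc a A.i A.t).trans (by
      rw [A.i_t, Category.comp_id]; exact (Category.id_comp a).symm)
  map_i := Category.id_comp _
  map_c := Hom.map_c_of (fun Y f g h h' => by
    have e : f = g := (Category.comp_id f).symm.trans (h.trans (Category.comp_id g))
    subst e
    have e' : (cst X).comp f f h = f := pullback.lift_fst _ _ _
    rw [e']
    have e₂ : f ≫ a ≫ A.i = (f ≫ a) ≫ A.i := (Category.assoc _ _ _).symm
    exact ((A.comp_congr e₂ rfl _).trans (A.id_comp _ _ _)).symm) _

/-- An internal natural transformation, together with its source and target internal functors. -/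
@[ext]
structure Transf (A B : InternalCat V) where
  src : A ⟶ B
  tgt : A ⟶ B
  app : A.obj₀ ⟶ B.obj₁
  app_s : app ≫ B.s = src.map₀
  app_t : app ≫ B.t = tgt.map₀
  naturality : B.comp src.map₁ (A.t ≫ app)
      (by rw [Category.assoc, app_s, src.map_t]) =
    B.comp (A.s ≫ app) tgt.map₁ (by rw [Category.assoc, app_t, tgt.map_s])

theorem Transf.nat (α : Transf A B) {X : V} (f : X ⟶ A.obj₁)
    (h : (f ≫ α.src.map₁) ≫ B.t = (f ≫ A.t ≫ α.app) ≫ B.s)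
    (h' : (f ≫ A.s ≫ α.app) ≫ B.t = (f ≫ α.tgt.map₁) ≫ B.s) :
    B.comp (f ≫ α.src.map₁) (f ≫ A.t ≫ α.app) h =
      B.comp (f ≫ A.s ≫ α.app) (f ≫ α.tgt.map₁) h' := by
  exact (B.precomp f _ _ (by rw [Category.assoc, α.app_s, α.src.map_t])).symm.trans
    ((congrArg (f ≫ ·) α.naturality).trans (B.precomp f _ _ _))

/-- The whiskering of an internal natural transformation with an internal functor. -/
def Transf.whisker {A' : InternalCat V} (H : A' ⟶ A) (α : Transf A B) : Transf A' B where
  src := H ≫ α.src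
  tgt := H ≫ α.tgt
  app := H.map₀ ≫ α.app
  app_s := by rw [Category.assoc, α.app_s]; rfl
  app_t := by rw [Category.assoc, α.app_t]; rfl
  naturality := by
    have h₁ : A'.t ≫ H.map₀ ≫ α.app = H.map₁ ≫ A.t ≫ α.app := by
      rw [← Category.assoc, ← H.map_t, Category.assoc]
    have h₂ : A'.s ≫ H.map₀ ≫ α.app = H.map₁ ≫ A.s ≫ α.app := by
      rw [← Category.assoc, ← H.map_s, Category.assoc]
    simp only [h₁, h₂]
    exact α.nat H.map₁ _ _

/-- The identity internal natural transformation. -/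
def Transf.id (F : A ⟶ B) : Transf A B where
  src := F
  tgt := F
  app := F.map₀ ≫ B.i
  app_s := by rw [Category.assoc, B.i_s, Category.comp_id]
  app_t := by rw [Category.assoc, B.i_t, Category.comp_id]
  naturality := by
    simp only [← Category.assoc]
    rw [B.comp_id, B.id_comp]

/-- Vertical composition of internal natural transformations. -/
def Transf.vcomp (α β : Transf A B) (h : α.tgt = β.src) : Transf A B where
  src := α.src
  tgt := β.tgt
  app := B.comp α.app β.app (by rw [α.app_t, β.app_s, h])
  app_s := by rw [B.comp_s, α.app_s]
  app_t := by rw [B.comp_t, β.app_t]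
  naturality := by
    have hα := α.naturality
    have hβ := β.naturality
    have h₀ : α.app ≫ B.t = β.app ≫ B.s := by rw [α.app_t, β.app_s, h]
    have e₁ : α.src.map₁ ≫ B.t = (A.t ≫ α.app) ≫ B.s := by
      rw [Category.assoc, α.app_s, α.src.map_t]
    have e₂ : (A.s ≫ β.app) ≫ B.t = β.tgt.map₁ ≫ B.s := by
      rw [Category.assoc, β.app_t, β.tgt.map_s]
    have e₃ : (A.s ≫ α.app) ≫ B.t = α.tgt.map₁ ≫ B.s := by
      rw [Category.assoc, α.app_t, α.tgt.map_s]
    have e₄ : α.tgt.map₁ ≫ B.t = (A.t ≫ β.app) ≫ B.s := by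
      rw [h, Category.assoc, β.app_s, β.src.map_t]
    simp only [B.precomp]
    rw [← B.comp_assoc _ _ _ e₁ (B.whisker_eq A.t h₀), B.comp_assoc _ _ _ (B.whisker_eq A.s h₀) e₂]
    refine (B.comp_congr hα rfl _).trans ?_
    refine Eq.trans ?_ (B.comp_congr rfl hβ (by
      rw [B.comp_s, e₃, h]))
    rw [B.comp_assoc _ _ _ e₃ e₄]
    exact B.comp_congr rfl (B.comp_congr (by rw [h]) rfl _) _

end InternalCat

end InternalCategories

section Presheaves

/-- A presheaf of sets on `V`. -/
structure Psh (V : Type u) [Category.{v} V] where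
  obj : V → Type v
  map : ∀ {X Y : V}, (X ⟶ Y) → obj Y → obj X
  map_id : ∀ {X : V} (x : obj X), map (𝟙 X) x = x
  map_comp : ∀ {X Y Z : V} (f : X ⟶ Y) (g : Y ⟶ Z) (x : obj Z), map (f ≫ g) x = map f (map g x)

variable {V : Type u} [Category.{v} V]

namespace Psh

/-- A presheaf is representable if it has a universal element. -/
def Representable (P : Psh V) : Prop :=
  ∃ (Y : V) (y : P.obj Y), ∀ (X : V) (x : P.obj X), ∃! f : X ⟶ Y, P.map f y = x

variable {P : Psh V} (h : P.Representable)

/-- The object representing a representable presheaf. -/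
def Representable.repr : V := h.choose

/-- The universal element of a representable presheaf. -/
def Representable.elt : P.obj h.repr := h.choose_spec.choose

/-- The map classifying an element of a representable presheaf. -/
def Representable.lift {X : V} (x : P.obj X) : X ⟶ h.repr :=
  (h.choose_spec.choose_spec X x).choose

theorem Representable.map_lift {X : V} (x : P.obj X) : P.map (h.lift x) h.elt = x :=
  (h.choose_spec.choose_spec X x).choose_spec.1

theorem Representable.eq_of {X : V} {f g : X ⟶ h.repr} (e : P.map f h.elt = P.map g h.elt) :
    f = g :=
  (h.choose_spec.choose_spec X (P.map g h.elt)).unique e rfl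

theorem Representable.lift_eq {X : V} {x : P.obj X} {f : X ⟶ h.repr} (e : P.map f h.elt = x) :
    h.lift x = f :=
  h.eq_of ((h.map_lift x).trans e.symm)

theorem Representable.comp_lift {X Y : V} (z : Y ⟶ X) (x : P.obj X) :
    z ≫ h.lift x = h.lift (P.map z x) :=
  h.eq_of (by rw [P.map_comp, h.map_lift, h.map_lift])

end Psh

/-- A presheaf of categories on `V`, given by its presheaves of objects and of morphisms. -/
structure CatPsh (V : Type u) [Category.{v} V] where
  ob : Psh V
  mor : Psh V
  s : ∀ {X : V}, mor.obj X → ob.obj X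
  t : ∀ {X : V}, mor.obj X → ob.obj X
  i : ∀ {X : V}, ob.obj X → mor.obj X
  comp : ∀ {X : V} (f g : mor.obj X), t f = s g → mor.obj X
  map_s : ∀ {X Y : V} (z : Y ⟶ X) (f : mor.obj X), s (mor.map z f) = ob.map z (s f)
  map_t : ∀ {X Y : V} (z : Y ⟶ X) (f : mor.obj X), t (mor.map z f) = ob.map z (t f)
  map_i : ∀ {X Y : V} (z : Y ⟶ X) (a : ob.obj X), i (ob.map z a) = mor.map z (i a)
  map_comp : ∀ {X Y : V} (z : Y ⟶ X) (f g : mor.obj X) (h : t f = s g)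
    (h' : t (mor.map z f) = s (mor.map z g)),
    mor.map z (comp f g h) = comp (mor.map z f) (mor.map z g) h'
  i_s : ∀ {X : V} (a : ob.obj X), s (i a) = a
  i_t : ∀ {X : V} (a : ob.obj X), t (i a) = a
  comp_s : ∀ {X : V} (f g : mor.obj X) (h : t f = s g), s (comp f g h) = s f
  comp_t : ∀ {X : V} (f g : mor.obj X) (h : t f = s g), t (comp f g h) = t g
  id_comp : ∀ {X : V} (f : mor.obj X) (h : t (i (s f)) = s f), comp (i (s f)) f h = f
  comp_id : ∀ {X : V} (f : mor.obj X) (h : t f = s (i (t f))), comp f (i (t f)) h = f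
  assoc : ∀ {X : V} (f g k : mor.obj X) (h₁ : t f = s g) (h₂ : t g = s k)
    (h₃ : t (comp f g h₁) = s k) (h₄ : t f = s (comp g k h₂)),
    comp (comp f g h₁) k h₃ = comp f (comp g k h₂) h₄

namespace CatPsh

variable [HasPullbacks V] (P : CatPsh V) (h₀ : P.ob.Representable) (h₁ : P.mor.Representable)

theorem s_w {X : V} (f : X ⟶ h₁.repr) :
    P.ob.map (f ≫ h₀.lift (P.s h₁.elt)) h₀.elt = P.s (P.mor.map f h₁.elt) := by
  rw [P.ob.map_comp, h₀.map_lift, P.map_s]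

theorem t_w {X : V} (f : X ⟶ h₁.repr) :
    P.ob.map (f ≫ h₀.lift (P.t h₁.elt)) h₀.elt = P.t (P.mor.map f h₁.elt) := by
  rw [P.ob.map_comp, h₀.map_lift, P.map_t]

theorem i_w {X : V} (f : X ⟶ h₀.repr) :
    P.mor.map (f ≫ h₁.lift (P.i h₀.elt)) h₁.elt = P.i (P.ob.map f h₀.elt) := by
  rw [P.mor.map_comp, h₁.map_lift, P.map_i]

theorem comp_w {X : V} {f g : X ⟶ h₁.repr}
    (h : f ≫ h₀.lift (P.t h₁.elt) = g ≫ h₀.lift (P.s h₁.elt)) :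
    P.t (P.mor.map f h₁.elt) = P.s (P.mor.map g h₁.elt) := by
  rw [← P.t_w h₀ h₁, ← P.s_w h₀ h₁, h]

theorem comp_congr {X : V} {f g f' g' : P.mor.obj X} (hf : f = f') (hg : g = g') (h : P.t f = P.s g)
    (h' : P.t f' = P.s g') : P.comp f g h = P.comp f' g' h' := by
  subst hf; subst hg; rfl

/-- The internal category whose generalized objects and morphisms are given by a presheaf of
categories with representable presheaves of objects and morphisms. -/
@[reducible] def toInternal : InternalCat V :=
  InternalCat.ofElements h₀.repr h₁.repr (h₀.lift (P.s h₁.elt)) (h₀.lift (P.t h₁.elt))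
    (h₁.lift (P.i h₀.elt))
    (fun _ f g h => h₁.lift (P.comp (P.mor.map f h₁.elt) (P.mor.map g h₁.elt) (P.comp_w h₀ h₁ h)))
    (fun _ _ z f g h h' => by
      rw [h₁.comp_lift]
      congr 1
      rw [P.map_comp z _ _ _ (by rw [← P.mor.map_comp, ← P.mor.map_comp]; exact P.comp_w h₀ h₁ h')]
      exact P.comp_congr (P.mor.map_comp _ _ _).symm (P.mor.map_comp _ _ _).symm _ _)
    (h₀.eq_of (by rw [P.s_w, h₁.map_lift, P.i_s, P.ob.map_id]))
    (h₀.eq_of (by rw [P.t_w, h₁.map_lift, P.i_t, P.ob.map_id]))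
    (fun _ f g h => h₀.eq_of (by rw [P.s_w, P.s_w, h₁.map_lift, P.comp_s]))
    (fun _ f g h => h₀.eq_of (by rw [P.t_w, P.t_w, h₁.map_lift, P.comp_t]))
    (fun _ f h => h₁.lift_eq (by
      have e : P.mor.map (f ≫ h₀.lift (P.s h₁.elt) ≫ h₁.lift (P.i h₀.elt)) h₁.elt =
          P.i (P.s (P.mor.map f h₁.elt)) := by
        rw [← Category.assoc, P.i_w, P.s_w]
      exact ((P.comp_congr e rfl _ (P.i_t _)).trans (P.id_comp _ _)).symm))
    (fun _ f h => h₁.lift_eq (by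
      have e : P.mor.map (f ≫ h₀.lift (P.t h₁.elt) ≫ h₁.lift (P.i h₀.elt)) h₁.elt =
          P.i (P.t (P.mor.map f h₁.elt)) := by
        rw [← Category.assoc, P.i_w, P.t_w]
      exact ((P.comp_congr rfl e _ (P.i_s _).symm).trans (P.comp_id _ _)).symm))
    (fun _ f g k e₁ e₂ e₃ e₄ => h₁.eq_of (by
      refine (h₁.map_lift _).trans (Eq.trans ?_ (h₁.map_lift _).symm)
      have w₁ := P.comp_w h₀ h₁ e₁
      have w₂ := P.comp_w h₀ h₁ e₂
      refine (P.comp_congr (h₁.map_lift _) rfl _ (by rw [P.comp_t]; exact w₂)).trans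
        (Eq.trans ?_ (P.comp_congr rfl (h₁.map_lift _) _ (by rw [P.comp_s]; exact w₁)).symm)
      exact P.assoc _ _ _ w₁ w₂ _ _))

theorem toInternal_comp {X : V} (f g : X ⟶ h₁.repr)
    (h : f ≫ h₀.lift (P.t h₁.elt) = g ≫ h₀.lift (P.s h₁.elt)) :
    (P.toInternal h₀ h₁).comp f g h =
      h₁.lift (P.comp (P.mor.map f h₁.elt) (P.mor.map g h₁.elt) (P.comp_w h₀ h₁ h)) :=
  InternalCat.ofElements_comp ..

/-- An internal functor into the internal category given by a presheaf of categories. -/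
def lift (A : InternalCat V) (φ₀ : P.ob.obj A.obj₀) (φ₁ : P.mor.obj A.obj₁)
    (hs : P.s φ₁ = P.ob.map A.s φ₀) (ht : P.t φ₁ = P.ob.map A.t φ₀)
    (hi : P.mor.map A.i φ₁ = P.i φ₀)
    (hc : ∀ {X : V} (f g : X ⟶ A.obj₁) (h : f ≫ A.t = g ≫ A.s)
      (h' : P.t (P.mor.map f φ₁) = P.s (P.mor.map g φ₁)),
      P.mor.map (A.comp f g h) φ₁ = P.comp (P.mor.map f φ₁) (P.mor.map g φ₁) h') :
    A ⟶ P.toInternal h₀ h₁ where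
  map₀ := h₀.lift φ₀
  map₁ := h₁.lift φ₁
  map_s := h₀.eq_of (by
    refine (P.s_w h₀ h₁ _).trans ?_
    rw [h₁.map_lift, hs, P.ob.map_comp, h₀.map_lift])
  map_t := h₀.eq_of (by
    refine (P.t_w h₀ h₁ _).trans ?_
    rw [h₁.map_lift, ht, P.ob.map_comp, h₀.map_lift])
  map_i := h₁.eq_of (by
    refine Eq.trans ?_ (P.i_w h₀ h₁ _).symm
    rw [P.mor.map_comp, h₁.map_lift, hi, h₀.map_lift])
  map_c := InternalCat.Hom.map_c_of (A := A) (B := P.toInternal h₀ h₁) (map₁ := h₁.lift φ₁)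
      (fun X f g h h' => by
    refine Eq.trans ?_ (P.toInternal_comp h₀ h₁ _ _ h').symm
    rw [h₁.comp_lift]
    congr 1
    have e : ∀ f : X ⟶ A.obj₁, P.mor.map (f ≫ h₁.lift φ₁) h₁.elt = P.mor.map f φ₁ := fun f => by
      rw [P.mor.map_comp, h₁.map_lift]
    have w : P.t (P.mor.map f φ₁) = P.s (P.mor.map g φ₁) := by
      rw [P.map_t, P.map_s, hs, ht, ← P.ob.map_comp, ← P.ob.map_comp, h]
    rw [hc f g h w]
    exact P.comp_congr (e f).symm (e g).symm _ _) _

/-- An internal functor out of the internal category given by a presheaf of categories. -/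
def desc (A : InternalCat V) (ψ₀ : ∀ {X : V}, P.ob.obj X → (X ⟶ A.obj₀))
    (ψ₁ : ∀ {X : V}, P.mor.obj X → (X ⟶ A.obj₁))
    (nat₀ : ∀ {X Y : V} (z : Y ⟶ X) (a : P.ob.obj X), ψ₀ (P.ob.map z a) = z ≫ ψ₀ a)
    (nat₁ : ∀ {X Y : V} (z : Y ⟶ X) (a : P.mor.obj X), ψ₁ (P.mor.map z a) = z ≫ ψ₁ a)
    (hs : ∀ {X : V} (f : P.mor.obj X), ψ₁ f ≫ A.s = ψ₀ (P.s f))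
    (ht : ∀ {X : V} (f : P.mor.obj X), ψ₁ f ≫ A.t = ψ₀ (P.t f))
    (hi : ∀ {X : V} (a : P.ob.obj X), ψ₁ (P.i a) = ψ₀ a ≫ A.i)
    (hc : ∀ {X : V} (f g : P.mor.obj X) (h : P.t f = P.s g) (h' : ψ₁ f ≫ A.t = ψ₁ g ≫ A.s),
      ψ₁ (P.comp f g h) = A.comp (ψ₁ f) (ψ₁ g) h') :
    P.toInternal h₀ h₁ ⟶ A where
  map₀ := ψ₀ h₀.elt
  map₁ := ψ₁ h₁.elt
  map_s := (hs _).trans (by rw [← h₀.map_lift (P.s h₁.elt), nat₀])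
  map_t := (ht _).trans (by rw [← h₀.map_lift (P.t h₁.elt), nat₀])
  map_i := by
    rw [← hi, ← h₁.map_lift (P.i h₀.elt), nat₁]
  map_c := InternalCat.Hom.map_c_of (fun X f g h h' => by
    refine (congrArg (· ≫ ψ₁ h₁.elt) (P.toInternal_comp h₀ h₁ f g h)).trans ?_
    beta_reduce
    rw [← nat₁, h₁.map_lift]
    have w := P.comp_w h₀ h₁ h
    rw [hc _ _ w (by rw [ht, hs, w])]
    exact A.comp_congr (nat₁ _ _) (nat₁ _ _) _) _

end CatPsh

end Presheaves

section Constructions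

open CartesianMonoidalCategory MonoidalClosed

variable {V : Type u} [Category.{v} V]

/-- A condition on the generalized elements of `E` is closed if it is given by a subobject. -/
def ClosedPred {E : V} (p : ∀ X : V, (X ⟶ E) → Prop) : Prop :=
  ∃ (E' : V) (e : E' ⟶ E), Mono e ∧ ∀ (X : V) (x : X ⟶ E), p X x ↔ ∃ x', x' ≫ e = x

theorem ClosedPred.trivial (E : V) : ClosedPred fun (X : V) (_ : X ⟶ E) => True :=
  ⟨E, 𝟙 E, inferInstance, fun _ x => ⟨fun _ => ⟨x, Category.comp_id x⟩, fun _ => True.intro⟩⟩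

theorem ClosedPred.eq [HasEqualizers V] {E : V} {p : ∀ X : V, (X ⟶ E) → Prop} (hp : ClosedPred p)
    {Y : V} (a b : ∀ (X : V) (x : X ⟶ E), p X x → (X ⟶ Y))
    (ha : ∀ (X X' : V) (z : X' ⟶ X) (x : X ⟶ E) (h : p X x) (h' : p X' (z ≫ x)),
      a X' (z ≫ x) h' = z ≫ a X x h)
    (hb : ∀ (X X' : V) (z : X' ⟶ X) (x : X ⟶ E) (h : p X x) (h' : p X' (z ≫ x)),
      b X' (z ≫ x) h' = z ≫ b X x h) :
    ClosedPred fun X x => ∃ h : p X x, a X x h = b X x h := by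
  obtain ⟨E', e, he, hpe⟩ := hp
  have h₀ : p E' e := (hpe E' e).2 ⟨𝟙 _, Category.id_comp e⟩
  refine ⟨equalizer (a E' e h₀) (b E' e h₀), equalizer.ι _ _ ≫ e, inferInstance, fun X x => ?_⟩
  constructor
  · rintro ⟨h, hx⟩
    obtain ⟨x', rfl⟩ := (hpe X x).1 h
    rw [ha _ _ x' e h₀, hb _ _ x' e h₀] at hx
    exact ⟨equalizer.lift x' hx, by rw [← Category.assoc, equalizer.lift_ι]⟩
  · rintro ⟨x', rfl⟩
    have h : p X (x' ≫ equalizer.ι _ _ ≫ e) := (hpe _ _).2 ⟨x' ≫ equalizer.ι _ _, by simp⟩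
    refine ⟨h, ?_⟩
    have e' := Category.assoc x' (equalizer.ι (a E' e h₀) (b E' e h₀)) e
    have ha' := ha _ _ (x' ≫ equalizer.ι (a E' e h₀) (b E' e h₀)) e h₀ (by rw [e']; exact h)
    have hb' := hb _ _ (x' ≫ equalizer.ι (a E' e h₀) (b E' e h₀)) e h₀ (by rw [e']; exact h)
    rw [Category.assoc x' _ (a E' e h₀)] at ha'
    rw [Category.assoc x' _ (b E' e h₀), ← equalizer.condition, ← ha'] at hb'
    simp only [e'] at hb'
    exact hb'.symm

theorem ClosedPred.eq_tensor [CartesianMonoidalCategory V] [MonoidalClosed V] [HasEqualizers V]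
    {E : V} {p : ∀ X : V, (X ⟶ E) → Prop} (hp : ClosedPred p)
    {N Y : V} (a b : ∀ (X : V) (x : X ⟶ E), p X x → (N ⊗ X ⟶ Y))
    (ha : ∀ (X X' : V) (z : X' ⟶ X) (x : X ⟶ E) (h : p X x) (h' : p X' (z ≫ x)),
      a X' (z ≫ x) h' = N ◁ z ≫ a X x h)
    (hb : ∀ (X X' : V) (z : X' ⟶ X) (x : X ⟶ E) (h : p X x) (h' : p X' (z ≫ x)),
      b X' (z ≫ x) h' = N ◁ z ≫ b X x h) :
    ClosedPred fun X x => ∃ h : p X x, a X x h = b X x h := by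
  have := hp.eq (fun X x h => curry (a X x h)) (fun X x h => curry (b X x h))
    (fun X X' z x h h' => by rw [ha X X' z x h, curry_natural_left])
    (fun X X' z x h h' => by rw [hb X X' z x h, curry_natural_left])
  simpa only [(curry_injective (A := N)).eq_iff] using this

theorem Psh.Representable.of_closed (P : Psh V) {E : V} (φ : ∀ X : V, P.obj X → (X ⟶ E))
    (nat : ∀ (X Y : V) (z : Y ⟶ X) (a : P.obj X), φ Y (P.map z a) = z ≫ φ X a)
    (inj : ∀ (X : V) (a b : P.obj X), φ X a = φ X b → a = b)
    {p : ∀ X : V, (X ⟶ E) → Prop} (hp : ClosedPred p)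
    (h : ∀ (X : V) (x : X ⟶ E), p X x ↔ ∃ a, φ X a = x) : P.Representable := by
  obtain ⟨E', e, he, hpe⟩ := hp
  obtain ⟨u, hu⟩ := (h E' e).1 ((hpe E' e).2 ⟨𝟙 _, Category.id_comp e⟩)
  refine ⟨E', u, fun X x => ?_⟩
  obtain ⟨x', hx'⟩ := (hpe X (φ X x)).1 ((h X _).2 ⟨x, rfl⟩)
  refine ⟨x', inj _ _ _ (by rw [nat, hu, hx']), fun y hy => ?_⟩
  rw [← cancel_mono e, hx', ← hy, nat, hu]

theorem lift_inj_iff [CartesianMonoidalCategory V] {X Y Z : V} {a a' : X ⟶ Y} {b b' : X ⟶ Z} :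
    lift a b = lift a' b' ↔ a = a' ∧ b = b' := by
  constructor
  · intro h
    exact ⟨by rw [← lift_fst a b, h, lift_fst], by rw [← lift_snd a b, h, lift_snd]⟩
  · rintro ⟨rfl, rfl⟩; rfl

theorem lift_fst_snd_comp [CartesianMonoidalCategory V] {X Y Z : V} (x : X ⟶ Y ⊗ Z) :
    lift (x ≫ fst _ _) (x ≫ snd _ _) = x := by
  apply CartesianMonoidalCategory.hom_ext <;> simp

variable [HasPullbacks V]

namespace InternalCat

section Comma

variable {A B C : InternalCat V} (H : A ⟶ C) (K : B ⟶ C)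

/-- Generalized objects of a comma internal category: an arrow `H a ⟶ K b`. -/
@[ext]
structure CommaOb (X : V) where
  left : X ⟶ A.obj₀
  right : X ⟶ B.obj₀
  arr : X ⟶ C.obj₁
  arr_s : arr ≫ C.s = left ≫ H.map₀
  arr_t : arr ≫ C.t = right ≫ K.map₀

/-- Generalized morphisms of a comma internal category: a commutative square
from an arrow `src : H a ⟶ K b` to an arrow `tgt : H a' ⟶ K b'` whose horizontal sides are the
images of `left : a ⟶ a'` and `right : b ⟶ b'`. -/
@[ext]
structure CommaMor (X : V) where
  left : X ⟶ A.obj₁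
  right : X ⟶ B.obj₁
  src : X ⟶ C.obj₁
  tgt : X ⟶ C.obj₁
  src_s : src ≫ C.s = (left ≫ A.s) ≫ H.map₀
  src_t : src ≫ C.t = (right ≫ B.s) ≫ K.map₀
  tgt_s : tgt ≫ C.s = (left ≫ A.t) ≫ H.map₀
  tgt_t : tgt ≫ C.t = (right ≫ B.t) ≫ K.map₀
  w : C.comp src (right ≫ K.map₁) (by rw [src_t, Category.assoc, Category.assoc, K.map_s]) =
    C.comp (left ≫ H.map₁) tgt (by rw [tgt_s, Category.assoc, Category.assoc, H.map_t])

/-- The presheaf of objects of a comma internal category. -/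
@[reducible] def commaOb : Psh V where
  obj X := CommaOb H K X
  map z x :=
    { left := z ≫ x.left
      right := z ≫ x.right
      arr := z ≫ x.arr
      arr_s := by rw [Category.assoc, Category.assoc, x.arr_s]
      arr_t := by rw [Category.assoc, Category.assoc, x.arr_t] }
  map_id x := by apply CommaOb.ext <;> exact Category.id_comp _
  map_comp f g x := by apply CommaOb.ext <;> exact Category.assoc _ _ _

/-- The presheaf of morphisms of a comma internal category. -/
@[reducible] def commaMor : Psh V where
  obj X := CommaMor H K X
  map z x :=
    { left := z ≫ x.left
      right := z ≫ x.right
      src := z ≫ x.src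
      tgt := z ≫ x.tgt
      src_s := by simp only [Category.assoc, x.src_s]
      src_t := by simp only [Category.assoc, x.src_t]
      tgt_s := by simp only [Category.assoc, x.tgt_s]
      tgt_t := by simp only [Category.assoc, x.tgt_t]
      w := by
        refine (C.comp_congr rfl (Category.assoc _ _ _) _).trans
          (Eq.trans ?_ (C.comp_congr (Category.assoc _ _ _) rfl _).symm)
        exact (C.precomp z _ _ (by rw [x.src_t, Category.assoc, Category.assoc, K.map_s])).symm.trans
          ((congrArg (z ≫ ·) x.w).trans (C.precomp z _ _ _)) }
  map_id x := by apply CommaMor.ext <;> exact Category.id_comp _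
  map_comp f g x := by apply CommaMor.ext <;> exact Category.assoc _ _ _

/-- The presheaf of categories defining a comma internal category. -/
@[reducible] def commaPsh : CatPsh V where
  ob := commaOb H K
  mor := commaMor H K
  s f := ⟨f.left ≫ A.s, f.right ≫ B.s, f.src, f.src_s, f.src_t⟩
  t f := ⟨f.left ≫ A.t, f.right ≫ B.t, f.tgt, f.tgt_s, f.tgt_t⟩
  i x :=
    { left := x.left ≫ A.i
      right := x.right ≫ B.i
      src := x.arr
      tgt := x.arr
      src_s := by rw [Category.assoc x.left, A.i_s, Category.comp_id, x.arr_s]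
      src_t := by rw [Category.assoc x.right, B.i_s, Category.comp_id, x.arr_t]
      tgt_s := by rw [Category.assoc x.left, A.i_t, Category.comp_id, x.arr_s]
      tgt_t := by rw [Category.assoc x.right, B.i_t, Category.comp_id, x.arr_t]
      w := by
        have h₁ : (x.right ≫ B.i) ≫ K.map₁ = (x.right ≫ K.map₀) ≫ C.i := by
          rw [Category.assoc, Category.assoc, K.map_i]
        have h₂ : (x.left ≫ A.i) ≫ H.map₁ = (x.left ≫ H.map₀) ≫ C.i := by
          rw [Category.assoc, Category.assoc, H.map_i]
        simp only [h₁, h₂]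
        rw [C.comp_id, C.id_comp] }
  comp f g h :=
    { left := A.comp f.left g.left (congrArg CommaOb.left h)
      right := B.comp f.right g.right (congrArg CommaOb.right h)
      src := f.src
      tgt := g.tgt
      src_s := by rw [A.comp_s, f.src_s]
      src_t := by rw [B.comp_s, f.src_t]
      tgt_s := by rw [A.comp_t, g.tgt_s]
      tgt_t := by rw [B.comp_t, g.tgt_t]
      w := by
        have h₀ : f.tgt = g.src := congrArg CommaOb.arr h
        have hl : f.left ≫ A.t = g.left ≫ A.s := congrArg CommaOb.left h
        have hr : f.right ≫ B.t = g.right ≫ B.s := congrArg CommaOb.right h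
        have hf := f.w
        have hg := g.w
        have e₁ : f.src ≫ C.t = (f.right ≫ K.map₁) ≫ C.s := by
          rw [f.src_t, Category.assoc, Category.assoc, K.map_s]
        have e₂ : (f.left ≫ H.map₁) ≫ C.t = f.tgt ≫ C.s := by
          rw [f.tgt_s, Category.assoc, Category.assoc, H.map_t]
        have e₃ : g.src ≫ C.t = (g.right ≫ K.map₁) ≫ C.s := by
          rw [g.src_t, Category.assoc, Category.assoc, K.map_s]
        have e₄ : (g.left ≫ H.map₁) ≫ C.t = g.tgt ≫ C.s := by
          rw [g.tgt_s, Category.assoc, Category.assoc, H.map_t]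
        refine (C.comp_congr rfl (K.map_comp _ _ hr) _).trans
          (Eq.trans ?_ (C.comp_congr (H.map_comp _ _ hl) rfl _).symm)
        rw [← C.comp_assoc _ _ _ e₁ (K.map_eq hr), C.comp_assoc _ _ _ (H.map_eq hl) e₄]
        refine (C.comp_congr hf rfl _).trans (Eq.trans ?_ (C.comp_congr rfl hg (by
          rw [C.comp_s, e₂, h₀])))
        rw [C.comp_assoc _ _ _ e₂ (by rw [h₀, e₃])]
        exact C.comp_congr rfl (C.comp_congr h₀ rfl _) _ }
  map_s z f := by apply CommaOb.ext <;> first | rfl | exact Category.assoc _ _ _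
  map_t z f := by apply CommaOb.ext <;> first | rfl | exact Category.assoc _ _ _
  map_i z f := by apply CommaMor.ext <;> first | rfl | exact Category.assoc _ _ _
  map_comp z f g h h' := by apply CommaMor.ext <;> first | rfl | exact InternalCat.precomp _ _ _ _ _
  i_s x := by
    apply CommaOb.ext
    · exact (Category.assoc _ _ _).trans (by rw [A.i_s, Category.comp_id])
    · exact (Category.assoc _ _ _).trans (by rw [B.i_s, Category.comp_id])
    · rfl
  i_t x := by
    apply CommaOb.ext
    · exact (Category.assoc _ _ _).trans (by rw [A.i_t, Category.comp_id])
    · exact (Category.assoc _ _ _).trans (by rw [B.i_t, Category.comp_id])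
    · rfl
  comp_s f g h := by apply CommaOb.ext <;> first | rfl | exact InternalCat.comp_s _ _ _ _
  comp_t f g h := by apply CommaOb.ext <;> first | rfl | exact InternalCat.comp_t _ _ _ _
  id_comp f h := by apply CommaMor.ext <;> first | rfl | exact InternalCat.id_comp _ _ _ _
  comp_id f h := by apply CommaMor.ext <;> first | rfl | exact InternalCat.comp_id _ _ _ _
  assoc f g k h₁ h₂ h₃ h₄ := by
    apply CommaMor.ext
    · exact A.comp_assoc _ _ _ (congrArg CommaOb.left h₁) (congrArg CommaOb.left h₂)
    · exact B.comp_assoc _ _ _ (congrArg CommaOb.right h₁) (congrArg CommaOb.right h₂)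
    · rfl
    · rfl

variable [CartesianMonoidalCategory V]

theorem commaOb_representable : (commaOb H K).Representable := by
  refine .of_closed (commaOb H K) (E := A.obj₀ ⊗ B.obj₀ ⊗ C.obj₁)
    (fun X x => lift x.left (lift x.right x.arr)) ?_ ?_
    (((ClosedPred.trivial _).eq
      (fun X x _ => (x ≫ snd _ _ ≫ snd _ _) ≫ C.s) (fun X x _ => (x ≫ fst _ _) ≫ H.map₀)
      ?_ ?_).eq
      (fun X x _ => (x ≫ snd _ _ ≫ snd _ _) ≫ C.t) (fun X x _ => (x ≫ snd _ _ ≫ fst _ _) ≫ K.map₀)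
      ?_ ?_) ?_
  · intros; simp
  · intro X a b h
    simp only [lift_inj_iff] at h
    exact CommaOb.ext h.1 h.2.1 h.2.2
  all_goals first | (intros; simp only [Category.assoc]; done) | skip
  intro X x
  constructor
  · rintro ⟨⟨-, h₁⟩, h₂⟩
    exact ⟨⟨_, _, _, h₁, h₂⟩, by
      simp only [← Category.assoc, lift_fst_snd_comp]⟩
  · rintro ⟨a, rfl⟩
    exact ⟨⟨trivial, by simpa using a.arr_s⟩, by simpa using a.arr_t⟩

theorem commaMor_representable : (commaMor H K).Representable := by
  refine .of_closed (commaMor H K) (E := A.obj₁ ⊗ B.obj₁ ⊗ C.obj₁ ⊗ C.obj₁)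
    (fun X x => lift x.left (lift x.right (lift x.src x.tgt))) ?_ ?_
    ((((((ClosedPred.trivial _).eq
      (fun X x _ => (x ≫ snd _ _ ≫ snd _ _ ≫ fst _ _) ≫ C.s)
      (fun X x _ => ((x ≫ fst _ _) ≫ A.s) ≫ H.map₀) ?_ ?_).eq
      (fun X x _ => (x ≫ snd _ _ ≫ snd _ _ ≫ fst _ _) ≫ C.t)
      (fun X x _ => ((x ≫ snd _ _ ≫ fst _ _) ≫ B.s) ≫ K.map₀) ?_ ?_).eq
      (fun X x _ => (x ≫ snd _ _ ≫ snd _ _ ≫ snd _ _) ≫ C.s)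
      (fun X x _ => ((x ≫ fst _ _) ≫ A.t) ≫ H.map₀) ?_ ?_).eq
      (fun X x _ => (x ≫ snd _ _ ≫ snd _ _ ≫ snd _ _) ≫ C.t)
      (fun X x _ => ((x ≫ snd _ _ ≫ fst _ _) ≫ B.t) ≫ K.map₀) ?_ ?_).eq
      (fun X x h => C.comp (x ≫ snd _ _ ≫ snd _ _ ≫ fst _ _)
        ((x ≫ snd _ _ ≫ fst _ _) ≫ K.map₁) (by
          obtain ⟨⟨⟨-, h⟩, -⟩, -⟩ := h
          rw [h, Category.assoc _ K.map₁, K.map_s, Category.assoc _ B.s]))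
      (fun X x h => C.comp ((x ≫ fst _ _) ≫ H.map₁) (x ≫ snd _ _ ≫ snd _ _ ≫ snd _ _) (by
          obtain ⟨⟨-, h⟩, -⟩ := h
          rw [h, Category.assoc _ H.map₁, H.map_t, Category.assoc _ A.t])) ?_ ?_) ?_
  · intros; simp
  · intro X a b h
    simp only [lift_inj_iff] at h
    exact CommaMor.ext h.1 h.2.1 h.2.2.1 h.2.2.2
  all_goals first
    | (intros; simp only [Category.assoc]; done)
    | (intros; rw [C.precomp]; exact C.comp_congr (by simp only [Category.assoc])
        (by simp only [Category.assoc]) _)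
    | skip
  intro X x
  constructor
  · rintro ⟨⟨⟨⟨⟨_, h₁⟩, h₂⟩, h₃⟩, h₄⟩, h₅⟩
    exact ⟨⟨_, _, _, _, h₁, h₂, h₃, h₄, h₅⟩, by
      simp only [← Category.assoc, lift_fst_snd_comp]⟩
  · rintro ⟨a, rfl⟩
    refine ⟨⟨⟨⟨⟨trivial, by simpa using a.src_s⟩, by simpa using a.src_t⟩, by simpa using a.tgt_s⟩,
      by simpa using a.tgt_t⟩, ?_⟩
    exact (C.comp_congr (by simp) (by simp) _).trans (a.w.trans (C.comp_congr (by simp) (by simp) _))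

/-- The comma internal category of two internal functors. -/
@[reducible] def comma : InternalCat V :=
  (commaPsh H K).toInternal (commaOb_representable H K) (commaMor_representable H K)

/-- The projection from a comma internal category to the domain of the first functor. -/
def commaProj : comma H K ⟶ A :=
  (commaPsh H K).desc (commaOb_representable H K) (commaMor_representable H K) A
    (fun x => x.left) (fun f => f.left) (fun _ _ => rfl) (fun _ _ => rfl) (fun _ => rfl)
    (fun _ => rfl) (fun _ => rfl) (fun _ _ _ _ => rfl)

end Comma

section Terminal

variable [CartesianMonoidalCategory V]

/-- The terminal internal category. -/
@[reducible] def point (V : Type u) [Category.{v} V] [HasPullbacks V]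
    [CartesianMonoidalCategory V] : InternalCat V :=
  cst (𝟙_ V)

/-- The slice internal category of an internal category over an element. -/
@[reducible] def slice (A : InternalCat V) (T : point V ⟶ A) : InternalCat V := comma (𝟙 A) T

/-- An element `T` of an internal category `A` is an internal terminal object if the projection
from the slice internal category over `T` to `A` is an isomorphism of internal categories. -/
def IsInternalTerminal {A : InternalCat V} (T : point V ⟶ A) : Prop :=
  IsIso (commaProj (𝟙 A) T)

end Terminal

end InternalCat

end Constructions

section InternalHom

open CartesianMonoidalCategory MonoidalClosed

variable {V : Type u} [Category.{v} V] [HasPullbacks V] [CartesianMonoidalCategory V]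

namespace InternalCat

theorem prodCst_fst {I : InternalCat V} {X Z : V} {f g : Z ⟶ I.obj₁ ⊗ X}
    (h : f ≫ I.t ▷ X = g ≫ I.s ▷ X) : (f ≫ fst _ _) ≫ I.t = (g ≫ fst _ _) ≫ I.s := by
  have := congrArg (· ≫ fst _ _) h
  simpa using this

theorem prodCst_snd {I : InternalCat V} {X Z : V} {f g : Z ⟶ I.obj₁ ⊗ X}
    (h : f ≫ I.t ▷ X = g ≫ I.s ▷ X) : f ≫ snd _ _ = g ≫ snd _ _ := by
  have := congrArg (· ≫ snd _ _) h
  simpa using this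

/-- The product of an internal category with a constant internal category. -/
@[reducible] def prodCst (I : InternalCat V) (X : V) : InternalCat V :=
  ofElements (I.obj₀ ⊗ X) (I.obj₁ ⊗ X) (I.s ▷ X) (I.t ▷ X) (I.i ▷ X)
    (fun _ f g h => lift (I.comp (f ≫ fst _ _) (g ≫ fst _ _) (prodCst_fst h)) (f ≫ snd _ _))
    (fun _ _ z f g h h' => by
      rw [comp_lift, I.precomp]
      congr 1
      · exact I.comp_congr (Category.assoc _ _ _).symm (Category.assoc _ _ _).symm _
      · exact (Category.assoc _ _ _).symm)
    (by rw [← comp_whiskerRight, I.i_s, id_whiskerRight])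
    (by rw [← comp_whiskerRight, I.i_t, id_whiskerRight])
    (fun _ f g h => by
      apply CartesianMonoidalCategory.hom_ext <;> simp [I.comp_s])
    (fun _ f g h => by
      have := prodCst_snd h
      apply CartesianMonoidalCategory.hom_ext <;> simp [I.comp_t, this])
    (fun _ f h => by
      apply CartesianMonoidalCategory.hom_ext
      · rw [lift_fst]
        refine (I.comp_congr (f' := (f ≫ fst _ _ ≫ I.s) ≫ I.i) (by simp) rfl _).trans ?_
        exact I.id_comp _ _ _
      · simp)
    (fun _ f h => by
      apply CartesianMonoidalCategory.hom_ext
      · rw [lift_fst]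
        refine (I.comp_congr (g' := (f ≫ fst _ _ ≫ I.t) ≫ I.i) rfl (by simp) _).trans ?_
        exact I.comp_id _ _ _
      · simp)
    (fun _ f g k h₁ h₂ h₃ h₄ => by
      apply CartesianMonoidalCategory.hom_ext
      · refine (lift_fst _ _).trans (Eq.trans ?_ (lift_fst _ _).symm)
        refine (I.comp_congr (lift_fst _ _) rfl _).trans
          (Eq.trans ?_ (I.comp_congr rfl (lift_fst _ _) _).symm)
        exact I.comp_assoc _ _ _ (prodCst_fst h₁) (prodCst_fst h₂)
      · simp)

theorem prodCst_comp (I : InternalCat V) (X : V) {Z : V} (f g : Z ⟶ I.obj₁ ⊗ X)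
    (h : f ≫ I.t ▷ X = g ≫ I.s ▷ X) :
    (I.prodCst X).comp f g h =
      lift (I.comp (f ≫ fst _ _) (g ≫ fst _ _) (prodCst_fst h)) (f ≫ snd _ _) :=
  ofElements_comp ..

/-- The functoriality of `I × cst X` in `X`. -/
@[reducible] def prodCstMap (I : InternalCat V) {X Y : V} (z : X ⟶ Y) :
    I.prodCst X ⟶ I.prodCst Y where
  map₀ := I.obj₀ ◁ z
  map₁ := I.obj₁ ◁ z
  map_s := whisker_exchange I.s z
  map_t := whisker_exchange I.t z
  map_i := (whisker_exchange I.i z).symm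
  map_c := Hom.map_c_of (A := I.prodCst X) (B := I.prodCst Y) (map₁ := I.obj₁ ◁ z)
      (fun Z f g h h' => by
    rw [prodCst_comp, prodCst_comp]
    apply CartesianMonoidalCategory.hom_ext
    · simp
    · simp) _

/-- The projection `I × cst X ⟶ I`. -/
@[reducible] def prodCstFst (I : InternalCat V) (X : V) : I.prodCst X ⟶ I where
  map₀ := fst _ _
  map₁ := fst _ _
  map_s := by simp
  map_t := by simp
  map_i := by simp
  map_c := Hom.map_c_of (A := I.prodCst X) (B := I) (map₁ := fst _ _) (fun Z f g h h' => by
    rw [prodCst_comp, lift_fst]) _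

/-- The projection `I × cst X ⟶ cst X`. -/
@[reducible] def prodCstSnd (I : InternalCat V) (X : V) : I.prodCst X ⟶ cst X where
  map₀ := snd _ _
  map₁ := snd _ _
  map_s := by simp
  map_t := by simp
  map_i := by simp
  map_c := Hom.map_c_of (A := I.prodCst X) (B := cst X) (map₁ := snd _ _) (fun Z f g h h' => by
    rw [prodCst_comp, lift_snd]
    exact (ofElements_comp (s := 𝟙 X) (t := 𝟙 X) (i := 𝟙 X) (comp := fun _ f _ _ => f) ..).symm) _

variable (I A : InternalCat V)

/-- The presheaf of objects of the internal functor category: its generalized objects at `X` are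
the internal functors `I × cst X ⟶ A`. -/
@[reducible] def homOb : Psh V where
  obj X := I.prodCst X ⟶ A
  map z F := I.prodCstMap z ≫ F
  map_id F := hom_ext (by simp [comp_map₀]) (by simp [comp_map₁])
  map_comp f g F := hom_ext (by simp [comp_map₀]) (by simp [comp_map₁])

/-- The presheaf of morphisms of the internal functor category: its generalized morphisms at `X`
are the internal natural transformations between internal functors `I × cst X ⟶ A`. -/
@[reducible] def homMor : Psh V where
  obj X := Transf (I.prodCst X) A
  map z α := α.whisker (I.prodCstMap z)
  map_id α := Transf.ext ((homOb I A).map_id _) ((homOb I A).map_id _) (by simp [Transf.whisker])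
  map_comp f g α := Transf.ext ((homOb I A).map_comp _ _ _) ((homOb I A).map_comp _ _ _)
    (by simp [Transf.whisker])

/-- The presheaf of categories defining the internal functor category. -/
@[reducible] def homPsh : CatPsh V where
  ob := homOb I A
  mor := homMor I A
  s α := α.src
  t α := α.tgt
  i F := Transf.id F
  comp α β h := α.vcomp β h
  map_s _ _ := rfl
  map_t _ _ := rfl
  map_i z F := Transf.ext rfl rfl (Category.assoc _ _ _)
  map_comp z α β h h' := Transf.ext rfl rfl (A.precomp _ _ _ _)
  i_s _ := rfl
  i_t _ := rfl
  comp_s _ _ _ := rfl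
  comp_t _ _ _ := rfl
  id_comp α h := Transf.ext rfl rfl (A.id_comp _ _ _)
  comp_id α h := Transf.ext rfl rfl (A.comp_id _ _ _)
  assoc α β γ h₁ h₂ h₃ h₄ := Transf.ext rfl rfl (A.comp_assoc _ _ _ _ _)

variable {I A}

theorem comp_fst_snd (A : InternalCat V) :
    A.comp (pullback.fst A.t A.s) (pullback.snd A.t A.s) pullback.condition = A.c := by
  have : pullback.lift (pullback.fst A.t A.s) (pullback.snd A.t A.s) pullback.condition = 𝟙 _ := by
    apply pullback.hom_ext
    · rw [pullback.lift_fst, Category.id_comp]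
    · rw [pullback.lift_snd, Category.id_comp]
  rw [comp, this, Category.id_comp]

theorem prodCst_hom_c {X : V} (F : I.prodCst X ⟶ A) :
    I.c ▷ X ≫ F.map₁ = A.comp (pullback.fst I.t I.s ▷ X ≫ F.map₁)
      (pullback.snd I.t I.s ▷ X ≫ F.map₁) (by
        apply F.map_eq
        rw [← comp_whiskerRight, pullback.condition, comp_whiskerRight]) := by
  have h := F.map_comp (pullback.fst I.t I.s ▷ X) (pullback.snd I.t I.s ▷ X)
    (by rw [← comp_whiskerRight, pullback.condition, comp_whiskerRight])
  refine Eq.trans ?_ h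
  rw [prodCst_comp]
  congr 1
  apply CartesianMonoidalCategory.hom_ext
  · rw [whiskerRight_fst, lift_fst, ← I.comp_fst_snd, I.precomp]
    exact I.comp_congr (whiskerRight_fst _ _).symm (whiskerRight_fst _ _).symm _
  · rw [whiskerRight_snd, lift_snd, whiskerRight_snd]

/-- An internal functor `I × cst X ⟶ A` from its underlying maps. -/
def prodCstHom {X : V} (f₀ : I.obj₀ ⊗ X ⟶ A.obj₀) (f₁ : I.obj₁ ⊗ X ⟶ A.obj₁)
    (hs : f₁ ≫ A.s = I.s ▷ X ≫ f₀) (ht : f₁ ≫ A.t = I.t ▷ X ≫ f₀) (hi : I.i ▷ X ≫ f₁ = f₀ ≫ A.i)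
    (hc : I.c ▷ X ≫ f₁ = A.comp (pullback.fst I.t I.s ▷ X ≫ f₁) (pullback.snd I.t I.s ▷ X ≫ f₁) (by
      rw [Category.assoc, Category.assoc, hs, ht, ← comp_whiskerRight_assoc, pullback.condition,
        comp_whiskerRight_assoc])) : I.prodCst X ⟶ A where
  map₀ := f₀
  map₁ := f₁
  map_s := hs
  map_t := ht
  map_i := hi
  map_c := Hom.map_c_of (A := I.prodCst X) (B := A) (map₁ := f₁) (fun Z f g h h' => by
    have hq := congrArg (lift (pullback.lift _ _ (prodCst_fst h)) (f ≫ snd _ _) ≫ ·) hc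
    beta_reduce at hq
    rw [A.precomp] at hq
    have e₁ : lift (pullback.lift _ _ (prodCst_fst h)) (f ≫ snd _ _) ≫
        pullback.fst I.t I.s ▷ X ≫ f₁ = f ≫ f₁ := by
      rw [← Category.assoc]
      congr 1
      apply CartesianMonoidalCategory.hom_ext
      · simp [pullback.lift_fst]
      · simp
    have e₂ : lift (pullback.lift _ _ (prodCst_fst h)) (f ≫ snd _ _) ≫
        pullback.snd I.t I.s ▷ X ≫ f₁ = g ≫ f₁ := by
      rw [← Category.assoc]
      congr 1
      apply CartesianMonoidalCategory.hom_ext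
      · simp [pullback.lift_snd]
      · simpa using prodCst_snd h
    refine Eq.trans ?_ (hq.trans (A.comp_congr e₁ e₂ _))
    rw [prodCst_comp, ← Category.assoc]
    congr 1
    apply CartesianMonoidalCategory.hom_ext
    · rw [lift_fst, Category.assoc, whiskerRight_fst, lift_fst_assoc]; rfl
    · simp) _

/-- The constant internal functor `I × cst X ⟶ cst X ⟶ A` at a generalized object of `A`. -/
@[reducible] def diagOb (I : InternalCat V) {X : V} (a : X ⟶ A.obj₀) : I.prodCst X ⟶ A :=
  I.prodCstSnd X ≫ A.ofObj a

/-- The constant internal natural transformation at a generalized morphism of `A`. -/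
@[reducible] def diagMor (I : InternalCat V) {X : V} (f : X ⟶ A.obj₁) : Transf (I.prodCst X) A where
  src := diagOb I (f ≫ A.s)
  tgt := diagOb I (f ≫ A.t)
  app := snd _ _ ≫ f
  app_s := Category.assoc _ _ _
  app_t := Category.assoc _ _ _
  naturality := by
    have e₁ : I.t ▷ X ≫ snd _ _ ≫ f = snd _ _ ≫ f := by rw [whiskerRight_snd_assoc]
    have e₂ : I.s ▷ X ≫ snd _ _ ≫ f = snd _ _ ≫ f := by rw [whiskerRight_snd_assoc]
    have e₃ : (diagOb I (f ≫ A.s)).map₁ = (snd _ _ ≫ f ≫ A.s) ≫ A.i := (Category.assoc _ _ _).symm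
    have e₄ : (diagOb I (f ≫ A.t)).map₁ = (snd _ _ ≫ f ≫ A.t) ≫ A.i := (Category.assoc _ _ _).symm
    refine (A.comp_congr e₃ e₁ _).trans (Eq.trans ?_ (A.comp_congr e₂ e₄ _).symm)
    rw [A.id_comp, A.comp_id]

theorem map_diagOb {X Y : V} (z : Y ⟶ X) (a : X ⟶ A.obj₀) :
    (homOb I A).map z (diagOb I a) = diagOb I (z ≫ a) :=
  hom_ext (whiskerLeft_snd_assoc _ _ _)
    ((whiskerLeft_snd_assoc _ _ _).trans (congrArg (snd _ _ ≫ ·) (Category.assoc _ _ _).symm))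

theorem map_diagMor {X Y : V} (z : Y ⟶ X) (f : X ⟶ A.obj₁) :
    (homMor I A).map z (diagMor I f) = diagMor I (z ≫ f) :=
  Transf.ext
    ((map_diagOb z _).trans (congrArg (diagOb I) (Category.assoc _ _ _).symm))
    ((map_diagOb z _).trans (congrArg (diagOb I) (Category.assoc _ _ _).symm))
    (whiskerLeft_snd_assoc _ _ _)

/-- The internal functor to the terminal internal category. -/
@[reducible] def toPoint (I : InternalCat V) : I ⟶ point V where
  map₀ := toUnit _
  map₁ := toUnit _
  map_s := toUnit_unique _ _
  map_t := toUnit_unique _ _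
  map_i := toUnit_unique _ _
  map_c := toUnit_unique _ _

/-- A cone over an internal functor `F : I ⟶ A`: an object `pt` of `A` together with an internal
natural transformation to `F` from the constant internal functor `I ⟶ * ⟶ A` at `pt`. -/
structure Cone (F : I ⟶ A) where
  pt : 𝟙_ V ⟶ A.obj₀
  transf : Transf I A
  src_eq : transf.src = toPoint I ≫ A.ofObj pt
  tgt_eq : transf.tgt = F

theorem Cone.whisker_src {F : I ⟶ A} (c : Cone F) :
    (c.transf.whisker (I.prodCstFst (𝟙_ V))).src = diagOb I c.pt :=
  (congrArg (I.prodCstFst (𝟙_ V) ≫ ·) c.src_eq).trans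
    (show I.prodCstFst (𝟙_ V) ≫ toPoint I ≫ A.ofObj c.pt = I.prodCstSnd (𝟙_ V) ≫ A.ofObj c.pt by
      rw [← Category.assoc]
      congr 1
      exact hom_ext (toUnit_unique _ _) (toUnit_unique _ _))

theorem Cone.whisker_tgt {F : I ⟶ A} (c : Cone F) :
    (c.transf.whisker (I.prodCstFst (𝟙_ V))).tgt = I.prodCstFst (𝟙_ V) ≫ F :=
  congrArg (I.prodCstFst (𝟙_ V) ≫ ·) c.tgt_eq

variable [MonoidalClosed V]

theorem homOb_representable : (homOb I A).Representable := by
  refine .of_closed (homOb I A) (E := (ihom I.obj₀).obj A.obj₀ ⊗ (ihom I.obj₁).obj A.obj₁)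
    (fun X F => lift (curry F.map₀) (curry F.map₁)) ?_ ?_
    (((((ClosedPred.trivial _).eq_tensor
      (fun X x _ => uncurry (x ≫ snd _ _) ≫ A.s)
      (fun X x _ => I.s ▷ X ≫ uncurry (x ≫ fst _ _)) ?_ ?_).eq_tensor
      (fun X x _ => uncurry (x ≫ snd _ _) ≫ A.t)
      (fun X x _ => I.t ▷ X ≫ uncurry (x ≫ fst _ _)) ?_ ?_).eq_tensor
      (fun X x _ => I.i ▷ X ≫ uncurry (x ≫ snd _ _))
      (fun X x _ => uncurry (x ≫ fst _ _) ≫ A.i) ?_ ?_).eq_tensor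
      (fun X x _ => I.c ▷ X ≫ uncurry (x ≫ snd _ _))
      (fun X x h => A.comp (pullback.fst I.t I.s ▷ X ≫ uncurry (x ≫ snd _ _))
        (pullback.snd I.t I.s ▷ X ≫ uncurry (x ≫ snd _ _)) (by
          obtain ⟨⟨⟨-, hs⟩, ht⟩, -⟩ := h
          rw [Category.assoc, Category.assoc, hs, ht, ← comp_whiskerRight_assoc,
            pullback.condition, comp_whiskerRight_assoc])) ?_ ?_) ?_
  · intro X Y z F
    simp only [comp_map₀, comp_map₁]
    rw [curry_natural_left, curry_natural_left, comp_lift]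
  · intro X F G h
    simp only [lift_inj_iff] at h
    exact hom_ext (curry_injective h.1) (curry_injective h.2)
  all_goals first
    | (intros; simp only [Category.assoc, uncurry_natural_left, whisker_exchange_assoc]; done)
    | (intros; rw [A.precomp]; exact A.comp_congr
        (by simp only [Category.assoc, uncurry_natural_left, whisker_exchange_assoc])
        (by simp only [Category.assoc, uncurry_natural_left, whisker_exchange_assoc]) _)
    | skip
  intro X x
  constructor
  · rintro ⟨⟨⟨⟨_, hs⟩, ht⟩, hi⟩, hc⟩
    refine ⟨prodCstHom _ _ hs ht hi hc, ?_⟩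
    simp only [prodCstHom, curry_uncurry, lift_fst_snd_comp]
  · rintro ⟨F, rfl⟩
    have e₀ : uncurry (lift (curry F.map₀) (curry F.map₁) ≫ fst _ _) = F.map₀ := by
      rw [lift_fst, uncurry_curry]
    have e₁ : uncurry (lift (curry F.map₀) (curry F.map₁) ≫ snd _ _) = F.map₁ := by
      rw [lift_snd, uncurry_curry]
    simp only [e₀, e₁]
    exact ⟨⟨⟨⟨trivial, F.map_s⟩, F.map_t⟩, F.map_i⟩, prodCst_hom_c F⟩

theorem homMor_representable : (homMor I A).Representable := by
  have h₀ : (homOb I A).Representable := homOb_representable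
  obtain ⟨F, hF⟩ : ∃ F : ∀ {X : V}, (X ⟶ h₀.repr) → (I.prodCst X ⟶ A),
    ∀ {X : V} (x : X ⟶ h₀.repr), F x = (homOb I A).map x h₀.elt := ⟨fun x => _, fun x => rfl⟩
  have hF' : ∀ {X Y : V} (z : X ⟶ Y) (x : Y ⟶ h₀.repr), F (z ≫ x) = I.prodCstMap z ≫ F x := by
    intro X Y z x
    rw [hF, hF, (homOb I A).map_comp]
  have hF₀ : ∀ {X Y : V} (z : X ⟶ Y) (x : Y ⟶ h₀.repr),
      (F (z ≫ x)).map₀ = I.obj₀ ◁ z ≫ (F x).map₀ := fun z x => by rw [hF']; rfl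
  have hF₁ : ∀ {X Y : V} (z : X ⟶ Y) (x : Y ⟶ h₀.repr),
      (F (z ≫ x)).map₁ = I.obj₁ ◁ z ≫ (F x).map₁ := fun z x => by rw [hF']; rfl
  have hl : ∀ {X : V} (G : I.prodCst X ⟶ A), F (h₀.lift G) = G := fun G => by
    rw [hF]; exact h₀.map_lift G
  have hl' : ∀ {X : V} (x : X ⟶ h₀.repr), h₀.lift (F x) = x := fun x => h₀.lift_eq (hF x).symm
  refine .of_closed (homMor I A) (E := h₀.repr ⊗ h₀.repr ⊗ (ihom I.obj₀).obj A.obj₁)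
    (fun X α => lift (h₀.lift α.src) (lift (h₀.lift α.tgt) (curry α.app))) ?_ ?_
    ((((ClosedPred.trivial _).eq_tensor
      (fun X x _ => uncurry (x ≫ snd _ _ ≫ snd _ _) ≫ A.s)
      (fun X x _ => (F (x ≫ fst _ _)).map₀) ?_ ?_).eq_tensor
      (fun X x _ => uncurry (x ≫ snd _ _ ≫ snd _ _) ≫ A.t)
      (fun X x _ => (F (x ≫ snd _ _ ≫ fst _ _)).map₀) ?_ ?_).eq_tensor
      (fun X x h => A.comp (F (x ≫ fst _ _)).map₁
        (I.t ▷ X ≫ uncurry (x ≫ snd _ _ ≫ snd _ _)) (by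
          obtain ⟨⟨-, hs⟩, -⟩ := h
          rw [Category.assoc, hs]; exact Hom.map_t _))
      (fun X x h => A.comp (I.s ▷ X ≫ uncurry (x ≫ snd _ _ ≫ snd _ _))
        (F (x ≫ snd _ _ ≫ fst _ _)).map₁ (by
          obtain ⟨-, ht⟩ := h
          rw [Category.assoc, ht]; exact (Hom.map_s (F (x ≫ snd _ _ ≫ fst _ _))).symm)) ?_ ?_) ?_
  · intro X Y z α
    simp only [comp_lift, h₀.comp_lift, Transf.whisker, curry_natural_left]
  · intro X α β h
    simp only [lift_inj_iff] at h
    refine Transf.ext ?_ ?_ (curry_injective h.2.2)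
    · rw [← hl α.src, h.1, hl]
    · rw [← hl α.tgt, h.2.1, hl]
  all_goals first
    | (intros; simp only [Category.assoc, uncurry_natural_left, whisker_exchange_assoc, hF₀]; done)
    | (intros; rw [A.precomp]; exact A.comp_congr
        (by simp only [Category.assoc, uncurry_natural_left, whisker_exchange_assoc, hF₁])
        (by simp only [Category.assoc, uncurry_natural_left, whisker_exchange_assoc, hF₁]) _)
    | skip
  intro X x
  constructor
  · rintro ⟨⟨⟨_, hs⟩, ht⟩, hn⟩
    refine ⟨⟨F (x ≫ fst _ _), F (x ≫ snd _ _ ≫ fst _ _), uncurry (x ≫ snd _ _ ≫ snd _ _), hs, ht,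
      hn⟩, ?_⟩
    simp only [curry_uncurry, hl']
    simp only [← Category.assoc, lift_fst_snd_comp]
  · rintro ⟨α, rfl⟩
    have e₀ : F (lift (h₀.lift α.src) (lift (h₀.lift α.tgt) (curry α.app)) ≫ fst _ _) = α.src := by
      rw [lift_fst, hl]
    have e₁ : F (lift (h₀.lift α.src) (lift (h₀.lift α.tgt) (curry α.app)) ≫ snd _ _ ≫ fst _ _) =
        α.tgt := by
      rw [lift_snd_assoc, lift_fst, hl]
    have e₂ : uncurry (lift (h₀.lift α.src) (lift (h₀.lift α.tgt) (curry α.app)) ≫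
        snd _ _ ≫ snd _ _) = α.app := by
      rw [lift_snd_assoc, lift_snd, uncurry_curry]
    simp only [e₀, e₁, e₂]
    exact ⟨⟨⟨trivial, α.app_s⟩, α.app_t⟩, α.naturality⟩

/-- The internal functor category: the internal hom of `Cat(V)`. -/
@[reducible] def functorCat (I A : InternalCat V) : InternalCat V :=
  (homPsh I A).toInternal homOb_representable homMor_representable

/-- The diagonal internal functor, sending a generalized object of `A` to the constant internal
functor at it. -/
def diag (I A : InternalCat V) : A ⟶ functorCat I A :=
  (homPsh I A).lift homOb_representable homMor_representable A
    (diagOb I (𝟙 A.obj₀)) (diagMor I (𝟙 A.obj₁))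
    ((congrArg (diagOb I) (by simp)).trans (map_diagOb A.s (𝟙 A.obj₀)).symm)
    ((congrArg (diagOb I) (by simp)).trans (map_diagOb A.t (𝟙 A.obj₀)).symm)
    ((map_diagMor A.i (𝟙 A.obj₁)).trans (Transf.ext
      (congrArg (diagOb I) (by simp [A.i_s]))
      (congrArg (diagOb I) (by simp [A.i_t])) (by simp [Transf.id, comp_map₀])))
    (fun f g h h' => (map_diagMor (A.comp f g h) (𝟙 A.obj₁)).trans (Transf.ext
      ((congrArg (diagOb I) (by simp [A.comp_s])).trans (map_diagOb f (𝟙 A.obj₁ ≫ A.s)).symm)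
      ((congrArg (diagOb I) (by simp [A.comp_t])).trans (map_diagOb g (𝟙 A.obj₁ ≫ A.t)).symm)
      (by
        have e : ∀ {X : V} (k : X ⟶ A.obj₁),
            I.obj₀ ◁ k ≫ snd _ _ ≫ 𝟙 A.obj₁ = snd _ _ ≫ k := by
          intro X k; simp
        refine Eq.trans ?_ (A.comp_congr (e f) (e g) _).symm
        rw [← A.precomp _ _ _ h]
        exact congrArg (snd _ _ ≫ ·) (Category.comp_id _))))

/-- The element of the internal functor category corresponding to an internal functor. -/
def functorElt (F : I ⟶ A) : point V ⟶ functorCat I A :=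
  ofObj (X := 𝟙_ V) (functorCat I A)
    (homOb_representable.lift (P := homOb I A) (I.prodCstFst (𝟙_ V) ≫ F))

/-- The internal category of cones over an internal functor. -/
@[reducible] def cones (F : I ⟶ A) : InternalCat V := comma (diag I A) (functorElt F)

/-- The element of the internal category of cones corresponding to a cone. -/
def Cone.elt {F : I ⟶ A} (c : Cone F) : point V ⟶ cones F :=
  ofObj (X := 𝟙_ V) (cones F) ((commaOb_representable (diag I A) (functorElt F)).lift
    { left := c.pt
      right := 𝟙 _
      arr := homMor_representable.lift (P := homMor I A) (c.transf.whisker (I.prodCstFst (𝟙_ V)))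
      arr_s := (homOb_representable (I := I) (A := A)).eq_of (by
        refine ((homPsh I A).s_w homOb_representable homMor_representable _).trans ?_
        rw [Psh.Representable.map_lift]
        refine c.whisker_src.trans (Eq.symm ?_)
        refine ((homOb I A).map_comp _ _ _).trans ?_
        refine (congrArg ((homOb I A).map c.pt)
          ((homOb_representable (I := I) (A := A)).map_lift _)).trans ?_
        exact (map_diagOb c.pt (𝟙 A.obj₀)).trans (congrArg (diagOb I) (Category.comp_id _)))
      arr_t := (homOb_representable (I := I) (A := A)).eq_of (by
        refine ((homPsh I A).t_w homOb_representable homMor_representable _).trans ?_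
        rw [Psh.Representable.map_lift]
        refine c.whisker_tgt.trans (Eq.symm ?_)
        refine (congrArg (fun q => (homOb I A).map q homOb_representable.elt)
          (Category.id_comp _)).trans ?_
        exact (homOb_representable (I := I) (A := A)).map_lift _) })

/-- A cone over an internal functor is an internal limit if the corresponding element is an internal
terminal object of the internal category of cones. -/
def IsInternalLimit {F : I ⟶ A} (c : Cone F) : Prop := IsInternalTerminal c.elt

end InternalCat

end InternalHom

section Families

open CartesianMonoidalCategory MonoidalClosed

variable {V : Type u} [Category.{v} V]

/-- A category in `V` whose object of objects and object of morphisms are given as families of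
objects of `V`. -/
structure FamCat (V : Type u) [Category.{v} V] (ι : Type w) where
  ob : ι → V
  mor : ι → ι → V
  s : ∀ a b, mor a b ⟶ ob a
  t : ∀ a b, mor a b ⟶ ob b
  i : ∀ a, ob a ⟶ mor a a
  comp : ∀ {X : V} {a b c : ι} (f : X ⟶ mor a b) (g : X ⟶ mor b c), f ≫ t a b = g ≫ s b c →
    (X ⟶ mor a c)
  precomp : ∀ {X Y : V} {a b c : ι} (z : Y ⟶ X) (f : X ⟶ mor a b) (g : X ⟶ mor b c)
    (h : f ≫ t a b = g ≫ s b c) (h' : (z ≫ f) ≫ t a b = (z ≫ g) ≫ s b c),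
    z ≫ comp f g h = comp (z ≫ f) (z ≫ g) h'
  i_s : ∀ a, i a ≫ s a a = 𝟙 (ob a)
  i_t : ∀ a, i a ≫ t a a = 𝟙 (ob a)
  comp_s : ∀ {X : V} {a b c : ι} (f : X ⟶ mor a b) (g : X ⟶ mor b c)
    (h : f ≫ t a b = g ≫ s b c), comp f g h ≫ s a c = f ≫ s a b
  comp_t : ∀ {X : V} {a b c : ι} (f : X ⟶ mor a b) (g : X ⟶ mor b c)
    (h : f ≫ t a b = g ≫ s b c), comp f g h ≫ t a c = g ≫ t b c
  id_comp : ∀ {X : V} {a b : ι} (f : X ⟶ mor a b) (h : (f ≫ s a b ≫ i a) ≫ t a a = f ≫ s a b),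
    comp (f ≫ s a b ≫ i a) f h = f
  comp_id : ∀ {X : V} {a b : ι} (f : X ⟶ mor a b) (h : f ≫ t a b = (f ≫ t a b ≫ i b) ≫ s b b),
    comp f (f ≫ t a b ≫ i b) h = f
  assoc : ∀ {X : V} {a b c d : ι} (f : X ⟶ mor a b) (g : X ⟶ mor b c) (k : X ⟶ mor c d)
    (h₁ : f ≫ t a b = g ≫ s b c) (h₂ : g ≫ t b c = k ≫ s c d)
    (h₃ : comp f g h₁ ≫ t a c = k ≫ s c d) (h₄ : f ≫ t a b = comp g k h₂ ≫ s b d),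
    comp (comp f g h₁) k h₃ = comp f (comp g k h₂) h₄

variable [CartesianMonoidalCategory V] [MonoidalClosed V] [HasCoproducts.{w} V] [Extensive.{w} V]

theorem initial_hom_ext {Z Z' T : V} (h : Nonempty (IsInitial Z)) (z : Z' ⟶ Z) (f g : Z' ⟶ T) :
    f = g := by
  obtain ⟨h⟩ := h
  have := CategoryTheory.strict_initial h z
  exact (IsInitial.ofIso h (asIso z).symm).hom_ext f g

theorem sigma_cases {ι : Type w} {N : ι → ι → V} {Z : V} {a b a' b' : ι} {p : Z ⟶ N a b}
    {q : Z ⟶ N a' b'} (h : p ≫ Sigma.ι (fun x : ι × ι => N x.1 x.2) (a, b) =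
      q ≫ Sigma.ι (fun x : ι × ι => N x.1 x.2) (a', b')) :
    Nonempty (IsInitial Z) ∨ (a = a' ∧ b = b' ∧ HEq p q) := by
  by_cases e : (a, b) = (a', b')
  · obtain ⟨rfl, rfl⟩ := Prod.mk.inj e
    exact Or.inr ⟨rfl, rfl, heq_of_eq
      (sigma_ι_inj (X := fun x : ι × ι => N x.1 x.2) (a := (a, b)) h)⟩
  · exact Or.inl (sigma_disjoint (X := fun x : ι × ι => N x.1 x.2) e p q h)

namespace FamCat

variable {ι : Type w} (F : FamCat V ι)

/-- The total object of objects. -/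
@[reducible] def obj₀ : V := ∐ F.ob

/-- The total object of morphisms. -/
@[reducible] def obj₁ : V := ∐ fun p : ι × ι => F.mor p.1 p.2

/-- The coproduct inclusion into the total object of objects. -/
@[reducible] def inOb (a : ι) : F.ob a ⟶ F.obj₀ := Sigma.ι F.ob a

/-- The coproduct inclusion into the total object of morphisms. -/
@[reducible] def inMor (a b : ι) : F.mor a b ⟶ F.obj₁ :=
  Sigma.ι (fun p : ι × ι => F.mor p.1 p.2) (a, b)

/-- The source map. -/
def src : F.obj₁ ⟶ F.obj₀ := Sigma.desc fun p => F.s p.1 p.2 ≫ F.inOb p.1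

/-- The target map. -/
def tgt : F.obj₁ ⟶ F.obj₀ := Sigma.desc fun p => F.t p.1 p.2 ≫ F.inOb p.2

/-- The identity map. -/
def ident : F.obj₀ ⟶ F.obj₁ := Sigma.desc fun a => F.i a ≫ F.inMor a a

theorem in_src (a b : ι) : F.inMor a b ≫ F.src = F.s a b ≫ F.inOb a := Sigma.ι_desc _ _
theorem in_tgt (a b : ι) : F.inMor a b ≫ F.tgt = F.t a b ≫ F.inOb b := Sigma.ι_desc _ _
theorem in_ident (a : ι) : F.inOb a ≫ F.ident = F.i a ≫ F.inMor a a := Sigma.ι_desc _ _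

theorem in_src_assoc (a b : ι) {T : V} (k : F.obj₀ ⟶ T) :
    F.inMor a b ≫ F.src ≫ k = F.s a b ≫ F.inOb a ≫ k := by
  rw [← Category.assoc, in_src, Category.assoc]

theorem in_tgt_assoc (a b : ι) {T : V} (k : F.obj₀ ⟶ T) :
    F.inMor a b ≫ F.tgt ≫ k = F.t a b ≫ F.inOb b ≫ k := by
  rw [← Category.assoc, in_tgt, Category.assoc]

theorem in_ident_assoc (a : ι) {T : V} (k : F.obj₁ ⟶ T) :
    F.inOb a ≫ F.ident ≫ k = F.i a ≫ F.inMor a a ≫ k := by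
  rw [← Category.assoc, in_ident, Category.assoc]

variable {F}

/-- `m` extends the given composition along the coproduct inclusions. -/
def IsComp {X : V} (f g m : X ⟶ F.obj₁) : Prop :=
  ∀ (Z : V) (z : Z ⟶ X) (a b c : ι) (f' : Z ⟶ F.mor a b) (g' : Z ⟶ F.mor b c)
    (h : f' ≫ F.t a b = g' ≫ F.s b c), z ≫ f = f' ≫ F.inMor a b → z ≫ g = g' ≫ F.inMor b c →
    z ≫ m = F.comp f' g' h ≫ F.inMor a c

theorem middle {X : V} {f g : X ⟶ F.obj₁} (h : f ≫ F.tgt = g ≫ F.src) {Z : V} (z : Z ⟶ X)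
    {a b b' c : ι} {f' : Z ⟶ F.mor a b} {g' : Z ⟶ F.mor b' c} (hf : z ≫ f = f' ≫ F.inMor a b)
    (hg : z ≫ g = g' ≫ F.inMor b' c) :
    (f' ≫ F.t a b) ≫ F.inOb b = (g' ≫ F.s b' c) ≫ F.inOb b' := by
  have := congrArg (z ≫ ·) h
  simp only [← Category.assoc] at this
  rw [hf, hg, Category.assoc, Category.assoc, in_tgt, in_src] at this
  simpa only [Category.assoc] using this

theorem middle_eq {X : V} {f g : X ⟶ F.obj₁} (h : f ≫ F.tgt = g ≫ F.src) {Z : V} (z : Z ⟶ X)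
    {a b c : ι} {f' : Z ⟶ F.mor a b} {g' : Z ⟶ F.mor b c} (hf : z ≫ f = f' ≫ F.inMor a b)
    (hg : z ≫ g = g' ≫ F.inMor b c) : f' ≫ F.t a b = g' ≫ F.s b c :=
  sigma_ι_inj (middle h z hf hg)

theorem local_ext {X T : V} {f g : X ⟶ F.obj₁} (h : f ≫ F.tgt = g ≫ F.src) {u v : X ⟶ T}
    (H : ∀ (Z : V) (z : Z ⟶ X) (a b c : ι) (f' : Z ⟶ F.mor a b) (g' : Z ⟶ F.mor b c)
      (_ : f' ≫ F.t a b = g' ≫ F.s b c), z ≫ f = f' ≫ F.inMor a b → z ≫ g = g' ≫ F.inMor b c →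
      z ≫ u = z ≫ v) : u = v := by
  obtain ⟨Y, y, k, hk, hy⟩ := exists_cover _ f
  refine cover_ext hy fun p => ?_
  obtain ⟨Y', y', k', hk', hy'⟩ := exists_cover _ (y p ≫ g)
  refine cover_ext hy' fun q => ?_
  rw [← Category.assoc, ← Category.assoc]
  obtain ⟨a, b⟩ := p
  obtain ⟨b', c⟩ := q
  have e₁ : (y' (b', c) ≫ y (a, b)) ≫ f = (y' (b', c) ≫ k (a, b)) ≫ F.inMor a b := by
    rw [Category.assoc, hk, Category.assoc]
  have e₂ : (y' (b', c) ≫ y (a, b)) ≫ g = k' (b', c) ≫ F.inMor b' c := by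
    rw [Category.assoc, hk']
  by_cases hb : b = b'
  · subst hb
    exact H _ _ a b c _ _ (middle_eq h _ e₁ e₂) e₁ e₂
  · exact initial_hom_ext (sigma_disjoint hb _ _ (middle h _ e₁ e₂)) (𝟙 _) _ _

theorem isComp_base {X : V} {f g : X ⟶ F.obj₁} (h : f ≫ F.tgt = g ≫ F.src) {a b b' c : ι}
    (f₀ : X ⟶ F.mor a b) (g₀ : X ⟶ F.mor b' c) (hf : f = f₀ ≫ F.inMor a b)
    (hg : g = g₀ ≫ F.inMor b' c) : ∃ m, IsComp f g m := by
  have e₁ : 𝟙 X ≫ f = f₀ ≫ F.inMor a b := by rw [Category.id_comp, hf]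
  have e₂ : 𝟙 X ≫ g = g₀ ≫ F.inMor b' c := by rw [Category.id_comp, hg]
  by_cases hb : b = b'
  · subst hb
    refine ⟨F.comp f₀ g₀ (middle_eq h _ e₁ e₂) ≫ F.inMor a c, fun Z z a' b' c' f' g' h' hf' hg' => ?_⟩
    rw [hf, ← Category.assoc] at hf'
    rw [hg, ← Category.assoc] at hg'
    obtain hZ | ⟨rfl, rfl, hff⟩ := sigma_cases hf'
    · exact initial_hom_ext hZ (𝟙 _) _ _
    obtain hZ | ⟨-, rfl, hgg⟩ := sigma_cases hg'
    · exact initial_hom_ext hZ (𝟙 _) _ _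
    obtain rfl := eq_of_heq hff
    obtain rfl := eq_of_heq hgg
    rw [← Category.assoc, F.precomp]
  · have hX := sigma_disjoint hb _ _ (middle h _ e₁ e₂)
    exact ⟨hX.some.to _, fun Z z _ _ _ _ _ _ _ _ => initial_hom_ext hX z _ _⟩

theorem isComp_glue {X : V} {f g : X ⟶ F.obj₁} {J : Type w} {Y : J → V} {y : ∀ j, Y j ⟶ X}
    (hy : IsIso (Sigma.desc y)) (H : ∀ j, ∃ m, IsComp (y j ≫ f) (y j ≫ g) m) :
    ∃ m, IsComp f g m := by
  choose m hm using H
  refine ⟨inv (Sigma.desc y) ≫ Sigma.desc m, fun Z z a b c f' g' h hf hg => ?_⟩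
  obtain ⟨W, q, k, hk, hq⟩ := exists_cover _ (z ≫ inv (Sigma.desc y))
  refine cover_ext hq fun j => ?_
  have e : q j ≫ z = k j ≫ y j := by
    have := congrArg (· ≫ Sigma.desc y) (hk j)
    simpa using this
  have e₁ : q j ≫ z ≫ inv (Sigma.desc y) ≫ Sigma.desc m = k j ≫ m j := by
    have := congrArg (· ≫ Sigma.desc m) (hk j)
    simpa using this
  have h' : (q j ≫ f') ≫ F.t a b = (q j ≫ g') ≫ F.s b c := by
    rw [Category.assoc, h, Category.assoc]
  rw [e₁, hm j _ (k j) a b c (q j ≫ f') (q j ≫ g') h' (by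
    rw [← Category.assoc, ← e, Category.assoc, hf, Category.assoc]) (by
    rw [← Category.assoc, ← e, Category.assoc, hg, Category.assoc]), ← Category.assoc,
    F.precomp _ _ _ h h']

theorem exists_isComp {X : V} (f g : X ⟶ F.obj₁) (h : f ≫ F.tgt = g ≫ F.src) :
    ∃ m, IsComp f g m := by
  obtain ⟨Y, y, k, hk, hy⟩ := exists_cover _ f
  refine isComp_glue hy fun p => ?_
  obtain ⟨Y', y', k', hk', hy'⟩ := exists_cover _ (y p ≫ g)
  refine isComp_glue hy' fun q => ?_
  refine isComp_base (a := p.1) (b := p.2) (b' := q.1) (c := q.2) ?_ (y' q ≫ k p) (k' q) ?_ ?_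
  · simp only [Category.assoc, h]
  · rw [hk, Category.assoc]
  · exact hk' q

/-- The composition map: the unique map extending the given composition along the coproduct
inclusions. -/
def compMap {X : V} (f g : X ⟶ F.obj₁) (h : f ≫ F.tgt = g ≫ F.src) : X ⟶ F.obj₁ :=
  (exists_isComp f g h).choose

theorem compMap_spec {X : V} (f g : X ⟶ F.obj₁) (h : f ≫ F.tgt = g ≫ F.src) :
    IsComp f g (compMap f g h) :=
  (exists_isComp f g h).choose_spec

variable (F) [HasPullbacks V]

/-- The internal category obtained by taking coproducts. -/
@[reducible] def total : InternalCat V :=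
  InternalCat.ofElements F.obj₀ F.obj₁ F.src F.tgt F.ident (fun _ f g h => compMap f g h)
    (fun X Y z f g h h' => local_ext h' fun Z z' a b c f' g' h'' hf hg => by
      rw [compMap_spec _ _ h' Z z' a b c f' g' h'' hf hg, ← Category.assoc,
        compMap_spec _ _ h Z (z' ≫ z) a b c f' g' h'' (by rw [Category.assoc, hf])
          (by rw [Category.assoc, hg])])
    (Sigma.hom_ext _ _ fun a => by
      change F.inOb a ≫ F.ident ≫ F.src = F.inOb a ≫ 𝟙 _
      rw [← Category.assoc, in_ident, Category.assoc, in_src, ← Category.assoc, F.i_s]; simp)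
    (Sigma.hom_ext _ _ fun a => by
      change F.inOb a ≫ F.ident ≫ F.tgt = F.inOb a ≫ 𝟙 _
      rw [← Category.assoc, in_ident, Category.assoc, in_tgt, ← Category.assoc, F.i_t]; simp)
    (fun X f g h => local_ext h fun Z z a b c f' g' h' hf hg => by
      rw [← Category.assoc, compMap_spec _ _ h Z z a b c f' g' h' hf hg, ← Category.assoc z, hf,
        Category.assoc, Category.assoc, in_src, in_src, ← Category.assoc, ← Category.assoc,
        F.comp_s])
    (fun X f g h => local_ext h fun Z z a b c f' g' h' hf hg => by
      rw [← Category.assoc, compMap_spec _ _ h Z z a b c f' g' h' hf hg, ← Category.assoc z, hg,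
        Category.assoc, Category.assoc, in_tgt, in_tgt, ← Category.assoc, ← Category.assoc,
        F.comp_t])
    (fun X f h => by
      obtain ⟨Y, y, k, hk, hy⟩ := exists_cover _ f
      refine cover_ext hy fun p => ?_
      have e : y p ≫ f ≫ F.src ≫ F.ident = (k p ≫ F.s p.1 p.2 ≫ F.i p.1) ≫ F.inMor p.1 p.1 := by
        have := congrArg (· ≫ F.src ≫ F.ident) (hk p)
        simp only [Category.assoc] at this
        rw [this]
        have e := congrArg (k p ≫ · ≫ F.ident) (F.in_src p.1 p.2)
        simp only [Category.assoc] at e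
        rw [e, in_ident, Category.assoc, Category.assoc]
      rw [compMap_spec _ _ h _ (y p) p.1 p.1 p.2 _ (k p) (by
        simp [F.i_t]) e (hk p), F.id_comp]
      exact (hk p).symm)
    (fun X f h => by
      obtain ⟨Y, y, k, hk, hy⟩ := exists_cover _ f
      refine cover_ext hy fun p => ?_
      have e : y p ≫ f ≫ F.tgt ≫ F.ident = (k p ≫ F.t p.1 p.2 ≫ F.i p.2) ≫ F.inMor p.2 p.2 := by
        have := congrArg (· ≫ F.tgt ≫ F.ident) (hk p)
        simp only [Category.assoc] at this
        rw [this]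
        have e := congrArg (k p ≫ · ≫ F.ident) (F.in_tgt p.1 p.2)
        simp only [Category.assoc] at e
        rw [e, in_ident, Category.assoc, Category.assoc]
      rw [compMap_spec _ _ h _ (y p) p.1 p.2 p.2 (k p) _ (by
        simp [F.i_s]) (hk p) e, F.comp_id]
      exact (hk p).symm)
    (fun X f g k h₁ h₂ h₃ h₄ => local_ext h₁ fun Z z a b c f' g' h' hf hg => by
      refine local_ext (f := z ≫ g) (g := z ≫ k) (by simp only [Category.assoc, h₂]) ?_
      intro Z' z' b' c' d g'' k' h'' hg' hk
      have hg₂ : (z' ≫ g') ≫ F.inMor b c = g'' ≫ F.inMor b' c' := by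
        rw [← hg', hg, Category.assoc]
      obtain hZ | ⟨rfl, rfl, hgg⟩ := sigma_cases hg₂
      · exact initial_hom_ext hZ (𝟙 _) _ _
      obtain rfl := eq_of_heq hgg
      have hf₁ : (z' ≫ z) ≫ f = (z' ≫ f') ≫ F.inMor a b := by
        rw [Category.assoc, hf, Category.assoc]
      have hg₁ : (z' ≫ z) ≫ g = (z' ≫ g') ≫ F.inMor b c := by rw [Category.assoc, hg']
      have hk₁ : (z' ≫ z) ≫ k = k' ≫ F.inMor c d := by rw [Category.assoc, hk]
      have h'₁ := middle_eq h₁ _ hf₁ hg₁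
      have hfg := compMap_spec f g h₁ _ _ _ _ _ _ _ h'₁ hf₁ hg₁
      have hgk := compMap_spec g k h₂ _ _ _ _ _ _ _ h'' hg₁ hk₁
      have w₁ : F.comp (z' ≫ f') (z' ≫ g') h'₁ ≫ F.t a c = k' ≫ F.s c d := by rw [F.comp_t, h'']
      have w₂ : (z' ≫ f') ≫ F.t a b = F.comp (z' ≫ g') k' h'' ≫ F.s b d := by rw [F.comp_s, h'₁]
      rw [← Category.assoc z', ← Category.assoc z',
        compMap_spec _ k h₃ _ _ _ _ _ _ _ w₁ hfg hk₁,
        compMap_spec f _ h₄ _ _ _ _ _ _ _ w₂ hf₁ hgk, F.assoc])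

theorem total_comp {X : V} (f g : X ⟶ F.obj₁) (h : f ≫ F.tgt = g ≫ F.src) :
    F.total.comp f g h = compMap f g h :=
  InternalCat.ofElements_comp ..

theorem total_comp_spec {X : V} (f g : X ⟶ F.obj₁) (h : f ≫ F.tgt = g ≫ F.src) :
    IsComp f g (F.total.comp f g h) := by
  rw [total_comp]; exact compMap_spec f g h

theorem total_comp_in {X : V} {a b c : ι} (f : X ⟶ F.mor a b) (g : X ⟶ F.mor b c)
    (h : f ≫ F.t a b = g ≫ F.s b c)
    (h' : (f ≫ F.inMor a b) ≫ F.tgt = (g ≫ F.inMor b c) ≫ F.src) :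
    F.total.comp (f ≫ F.inMor a b) (g ≫ F.inMor b c) h' = F.comp f g h ≫ F.inMor a c := by
  have := F.total_comp_spec _ _ h' X (𝟙 X) a b c f g h (Category.id_comp _) (Category.id_comp _)
  rwa [Category.id_comp] at this

end FamCat

end Families

section Internalization

open CartesianMonoidalCategory MonoidalClosed

variable {V : Type u} [Category.{v} V] [CartesianMonoidalCategory V] [MonoidalClosed V]
  [HasCoproducts.{w} V] [Extensive.{w} V] [HasPullbacks V]

/-- The internal functor between totals given by families of maps. -/
def FamCat.map {ι ι' : Type w} (F : FamCat V ι) (F' : FamCat V ι') (φ : ι → ι')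
    (ob : ∀ a, F.ob a ⟶ F'.ob (φ a)) (mor : ∀ a b, F.mor a b ⟶ F'.mor (φ a) (φ b))
    (hs : ∀ a b, mor a b ≫ F'.s (φ a) (φ b) = F.s a b ≫ ob a)
    (ht : ∀ a b, mor a b ≫ F'.t (φ a) (φ b) = F.t a b ≫ ob b)
    (hi : ∀ a, F.i a ≫ mor a a = ob a ≫ F'.i (φ a))
    (hc : ∀ {X : V} {a b c : ι} (f : X ⟶ F.mor a b) (g : X ⟶ F.mor b c)
      (h : f ≫ F.t a b = g ≫ F.s b c)
      (h' : (f ≫ mor a b) ≫ F'.t (φ a) (φ b) = (g ≫ mor b c) ≫ F'.s (φ b) (φ c)),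
      F.comp f g h ≫ mor a c = F'.comp (f ≫ mor a b) (g ≫ mor b c) h') :
    F.total ⟶ F'.total where
  map₀ := Sigma.desc fun a => ob a ≫ F'.inOb (φ a)
  map₁ := Sigma.desc fun p => mor p.1 p.2 ≫ F'.inMor (φ p.1) (φ p.2)
  map_s := Sigma.hom_ext _ _ fun p => by
    rw [Sigma.ι_desc_assoc, Category.assoc, F'.in_src, reassoc_of% hs]
    refine Eq.trans ?_ (F.in_src_assoc p.1 p.2 _).symm
    rw [Sigma.ι_desc]
  map_t := Sigma.hom_ext _ _ fun p => by
    rw [Sigma.ι_desc_assoc, Category.assoc, F'.in_tgt, reassoc_of% ht]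
    refine Eq.trans ?_ (F.in_tgt_assoc p.1 p.2 _).symm
    rw [Sigma.ι_desc]
  map_i := Sigma.hom_ext _ _ fun a => by
    rw [Sigma.ι_desc_assoc, Category.assoc, F'.in_ident, ← reassoc_of% hi]
    refine (F.in_ident_assoc a _).trans ?_
    rw [Sigma.ι_desc]
  map_c := InternalCat.Hom.map_c_of (A := F.total) (B := F'.total) (fun X f g h h' => by
    have e : ∀ {Z : V} {a b : ι} (k : Z ⟶ F.mor a b), (k ≫ F.inMor a b) ≫
        Sigma.desc (fun p : ι × ι => mor p.1 p.2 ≫ F'.inMor (φ p.1) (φ p.2)) =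
        (k ≫ mor a b) ≫ F'.inMor (φ a) (φ b) := fun k => by
      rw [Category.assoc, Sigma.ι_desc, Category.assoc]
    refine FamCat.local_ext h fun Z z a b c f' g' h₁ hf hg => ?_
    have h₂ : (f' ≫ mor a b) ≫ F'.t (φ a) (φ b) = (g' ≫ mor b c) ≫ F'.s (φ b) (φ c) := by
      rw [Category.assoc, ht, reassoc_of% h₁, Category.assoc, hs]
    rw [← Category.assoc, F.total_comp_spec f g h Z z a b c f' g' h₁ hf hg, e, hc f' g' h₁ h₂]
    refine (F'.total_comp_spec _ _ h' Z z _ _ _ _ _ h₂ ?_ ?_).symm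
    · rw [← Category.assoc, hf, e]
    · rw [← Category.assoc, hg, e]) _

section

variable (C : Type w) [EnrichedCategory V C]

/-- The family of hom-objects of a `V`-category. -/
@[reducible] def intFam : FamCat V C where
  ob _ := 𝟙_ V
  mor a b := a ⟶[V] b
  s _ _ := toUnit _
  t _ _ := toUnit _
  i a := eId V a
  comp f g _ := ecomp f g
  precomp z f g _ _ := comp_ecomp z f g
  i_s _ := toUnit_unique _ _
  i_t _ := toUnit_unique _ _
  comp_s _ _ _ := toUnit_unique _ _
  comp_t _ _ _ := toUnit_unique _ _
  id_comp {X a b} f h := by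
    rw [← Category.assoc, toUnit_unique (f ≫ toUnit _) (toUnit X), id_ecomp]
  comp_id {X a b} f h := by
    rw [← Category.assoc, toUnit_unique (f ≫ toUnit _) (toUnit X), ecomp_id]
  assoc f g k _ _ _ _ := ecomp_assoc f g k

/-- The internalization of a `V`-category. -/
@[reducible] def IntCat : InternalCat V := (intFam (V := V) C).total

end

variable {I C : Type w} [EnrichedCategory V I] [EnrichedCategory V C]

/-- The internalization of a `V`-functor. -/
def intFunctor (G : EnrichedFunctor V I C) : IntCat (V := V) I ⟶ IntCat (V := V) C :=
  FamCat.map (intFam I) (intFam C) G.obj (fun _ => 𝟙 _) (fun a b => G.map a b)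
    (fun _ _ => toUnit_unique _ _) (fun _ _ => toUnit_unique _ _)
    (fun a => (G.map_id a).trans (Category.id_comp _).symm)
    (fun f g _ _ => ecomp_map G f g)

/-- The family of objects `W a` and `W a ⊗ I(a, b)` of `V` underlying the internal category of
elements of a `V`-functor `W : I ⥤ V`. -/
@[reducible] def elementsFam (W : EnrichedFunctor V I V) : FamCat V I where
  ob a := W.obj a
  mor a b := W.obj a ⊗ (a ⟶[V] b)
  s _ _ := fst _ _
  t a b := act (fst _ _) (snd _ _ ≫ W.map a b)
  i a := lift (𝟙 _) (toUnit _ ≫ eId V a)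
  comp f g _ := lift (f ≫ fst _ _) (ecomp (f ≫ snd _ _) (g ≫ snd _ _))
  precomp z f g _ _ := by
    rw [comp_lift, comp_ecomp]; simp only [Category.assoc]
  i_s _ := lift_fst _ _
  i_t a := by
    have e : lift (𝟙 (W.obj a)) (toUnit _ ≫ eId V a) ≫ snd _ _ ≫ W.map a a =
        toUnit _ ≫ eId V (W.obj a) := by
      rw [lift_snd_assoc, Category.assoc, W.map_id]
    rw [comp_act, lift_fst]
    exact (congrArg (act (𝟙 (W.obj a))) e).trans (act_id _ _)
  comp_s f g _ := lift_fst _ _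
  comp_t {X a b c} f g h := by
    rw [comp_act, comp_act, lift_fst, lift_snd_assoc, ← h, comp_act]
    refine (congrArg (act _) (ecomp_map W _ _)).trans ?_
    refine (act_ecomp _ _ _).trans ?_
    simp only [Category.assoc]
  id_comp {X a b} f h := by
    apply CartesianMonoidalCategory.hom_ext
    · simp
    · rw [lift_snd]
      have e : (f ≫ fst _ _ ≫ lift (𝟙 _) (toUnit _ ≫ eId V a)) ≫ snd _ _ =
          toUnit X ≫ eId V a := by
        simp only [Category.assoc, lift_snd]
        rw [← Category.assoc, ← Category.assoc]
        congr 1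
        exact toUnit_unique _ _
      rw [e, id_ecomp]
  comp_id {X a b} f h := by
    apply CartesianMonoidalCategory.hom_ext
    · simp
    · rw [lift_snd]
      have e : (f ≫ act (fst _ _) (snd _ _ ≫ W.map a b) ≫ lift (𝟙 _) (toUnit _ ≫ eId V b)) ≫
          snd _ _ = toUnit X ≫ eId V b := by
        simp only [Category.assoc, lift_snd]
        rw [← Category.assoc, ← Category.assoc]
        congr 1
        exact toUnit_unique _ _
      rw [e, ecomp_id]
  assoc f g k h₁ h₂ h₃ h₄ := by
    apply CartesianMonoidalCategory.hom_ext
    · simp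
    · simp only [lift_snd, ecomp_assoc]

/-- The internal category of elements `∫_I W` of a `V`-functor `W : I ⥤ V`. -/
@[reducible] def elements (W : EnrichedFunctor V I V) : InternalCat V := (elementsFam W).total

/-- The projection `∫_I W ⟶ Int I`. -/
def elementsProj (W : EnrichedFunctor V I V) : elements W ⟶ IntCat (V := V) I :=
  FamCat.map (elementsFam W) (intFam I) (fun a => a) (fun _ => toUnit _) (fun _ _ => snd _ _)
    (fun _ _ => toUnit_unique _ _) (fun _ _ => toUnit_unique _ _)
    (fun a => lift_snd _ _)
    (fun f g _ _ => lift_snd _ _)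

/-- The component of a `V`-natural transformation `W ⇒ C(L, G -)`, as a map `W a ⟶ C(L, G a)`. -/
def lamMap {W : EnrichedFunctor V I V} {G : EnrichedFunctor V I C} {L : C}
    (lam : VNatTrans W (G.comp V (coRep L))) (a : I) : W.obj a ⟶ (L ⟶[V] G.obj a) :=
  lam.toMap a

theorem lamMap_nat {W : EnrichedFunctor V I V} {G : EnrichedFunctor V I C} {L : C}
    (lam : VNatTrans W (G.comp V (coRep L))) {Z : V} (a b : I) (x : Z ⟶ W.obj a)
    (k : Z ⟶ (a ⟶[V] b)) :
    act x (k ≫ W.map a b) ≫ lamMap lam b = ecomp (x ≫ lamMap lam a) (k ≫ G.map a b) :=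
  (lam.toMap_nat a b x k).trans (act_comp_coRep G L _ k)

/-- The map `(∫_I W)₀ ⟶ (Int C)₁` given on `W a` by the component of a `V`-natural transformation
`W ⇒ C(L, G -)`. -/
@[reducible] def weightedApp {W : EnrichedFunctor V I V} {G : EnrichedFunctor V I C} {L : C}
    (lam : VNatTrans W (G.comp V (coRep L))) : (elements W).obj₀ ⟶ (IntCat (V := V) C).obj₁ :=
  Sigma.desc fun a => lamMap lam a ≫ (intFam (V := V) C).inMor L (G.obj a)

theorem in_weightedApp {W : EnrichedFunctor V I V} {G : EnrichedFunctor V I C} {L : C}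
    (lam : VNatTrans W (G.comp V (coRep L))) (a : I) :
    (elementsFam W).inOb a ≫ weightedApp lam =
      lamMap lam a ≫ (intFam (V := V) C).inMor L (G.obj a) :=
  Sigma.ι_desc _ _

theorem in_proj₀ (W : EnrichedFunctor V I V) (G : EnrichedFunctor V I C) (a : I) :
    (elementsFam W).inOb a ≫ (elementsProj W ≫ intFunctor G).map₀ =
      toUnit _ ≫ (intFam (V := V) C).inOb (G.obj a) := by
  have h₁ : (elementsFam W).inOb a ≫ (elementsProj W).map₀ =
      toUnit _ ≫ (intFam (V := V) I).inOb a := Sigma.ι_desc _ _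
  have h₂ : (intFam (V := V) I).inOb a ≫ (intFunctor G).map₀ =
      𝟙 _ ≫ (intFam (V := V) C).inOb (G.obj a) := Sigma.ι_desc _ _
  rw [InternalCat.comp_map₀, ← Category.assoc, h₁, Category.assoc, h₂, Category.id_comp]

theorem in_proj₁ (W : EnrichedFunctor V I V) (G : EnrichedFunctor V I C) (a b : I) :
    (elementsFam W).inMor a b ≫ (elementsProj W ≫ intFunctor G).map₁ =
      (snd _ _ ≫ G.map a b) ≫ (intFam (V := V) C).inMor (G.obj a) (G.obj b) := by
  have h₁ : (elementsFam W).inMor a b ≫ (elementsProj W).map₁ =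
      snd _ _ ≫ (intFam (V := V) I).inMor a b := Sigma.ι_desc _ _
  have h₂ : (intFam (V := V) I).inMor a b ≫ (intFunctor G).map₁ =
      G.map a b ≫ (intFam (V := V) C).inMor (G.obj a) (G.obj b) := Sigma.ι_desc _ _
  rw [InternalCat.comp_map₁, ← Category.assoc, h₁, Category.assoc, h₂, Category.assoc]

theorem weightedApp_s {W : EnrichedFunctor V I V} {G : EnrichedFunctor V I C} {L : C}
    (lam : VNatTrans W (G.comp V (coRep L))) :
    weightedApp lam ≫ (IntCat (V := V) C).s = toUnit _ ≫ (intFam (V := V) C).inOb L :=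
  Sigma.hom_ext _ _ fun a => by
    change (elementsFam W).inOb a ≫ weightedApp lam ≫ (intFam (V := V) C).src =
      (elementsFam W).inOb a ≫ _
    rw [← Category.assoc, in_weightedApp, Category.assoc, FamCat.in_src, ← Category.assoc,
      ← Category.assoc]
    congr 1
    exact toUnit_unique _ _

theorem weightedApp_t {W : EnrichedFunctor V I V} {G : EnrichedFunctor V I C} {L : C}
    (lam : VNatTrans W (G.comp V (coRep L))) :
    weightedApp lam ≫ (IntCat (V := V) C).t = (elementsProj W ≫ intFunctor G).map₀ :=
  Sigma.hom_ext _ _ fun a => by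
    change (elementsFam W).inOb a ≫ weightedApp lam ≫ (intFam (V := V) C).tgt =
      (elementsFam W).inOb a ≫ (elementsProj W ≫ intFunctor G).map₀
    rw [in_proj₀, ← Category.assoc, in_weightedApp, Category.assoc, FamCat.in_tgt,
      ← Category.assoc]
    congr 1
    exact toUnit_unique _ _

theorem weightedApp_nat {W : EnrichedFunctor V I V} {G : EnrichedFunctor V I C} {L : C}
    (lam : VNatTrans W (G.comp V (coRep L))) (h) (h') :
    (IntCat (V := V) C).comp
      (toUnit (elements W).obj₁ ≫ (intFam (V := V) C).inOb L ≫ (IntCat (V := V) C).i)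
      ((elements W).t ≫ weightedApp lam) h =
    (IntCat (V := V) C).comp ((elements W).s ≫ weightedApp lam)
      (elementsProj W ≫ intFunctor G).map₁ h' :=
  Sigma.hom_ext _ _ fun p => by
    obtain ⟨a, b⟩ := p
    change (elementsFam W).inMor a b ≫ _ = (elementsFam W).inMor a b ≫ _
    rw [InternalCat.precomp, InternalCat.precomp]
    have e₁ : (elementsFam W).inMor a b ≫ toUnit (elements W).obj₁ ≫
        (intFam (V := V) C).inOb L ≫ (intFam (V := V) C).ident =
        (toUnit _ ≫ eId V L) ≫ (intFam (V := V) C).inMor L L := by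
      rw [FamCat.in_ident, ← Category.assoc, ← Category.assoc]
      congr 2
      exact toUnit_unique _ _
    have e₂ : (elementsFam W).inMor a b ≫ (elementsFam W).tgt ≫ weightedApp lam =
        (act (fst _ _) (snd _ _ ≫ W.map a b) ≫ lamMap lam b) ≫
          (intFam (V := V) C).inMor L (G.obj b) := by
      rw [FamCat.in_tgt_assoc, in_weightedApp, Category.assoc]
    have e₃ : (elementsFam W).inMor a b ≫ (elementsFam W).src ≫ weightedApp lam =
        (fst _ _ ≫ lamMap lam a) ≫ (intFam (V := V) C).inMor L (G.obj a) := by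
      rw [FamCat.in_src_assoc, in_weightedApp, Category.assoc]
    refine (InternalCat.comp_congr _ e₁ e₂ _).trans
      (Eq.trans ?_ (InternalCat.comp_congr _ e₃ (in_proj₁ W G a b) _).symm)
    refine ((intFam (V := V) C).total_comp_in (toUnit _ ≫ eId V L)
      (act (fst _ _) (snd _ _ ≫ W.map a b) ≫ lamMap lam b) (toUnit_unique _ _) _).trans
      (Eq.trans ?_ ((intFam (V := V) C).total_comp_in (fst _ _ ≫ lamMap lam a)
        (snd _ _ ≫ G.map a b) (toUnit_unique _ _) _).symm)
    congr 1
    exact (id_ecomp (C := C) _).trans (lamMap_nat lam a b _ _)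

/-- The cone over `∫_I W ⟶ Int I ⟶ Int C` with summit `L` corresponding to a `V`-natural
transformation `W ⇒ C(L, G -)`. -/
def weightedCone (W : EnrichedFunctor V I V) (G : EnrichedFunctor V I C) (L : C)
    (lam : VNatTrans W (G.comp V (coRep L))) :
    InternalCat.Cone (elementsProj W ≫ intFunctor G) where
  pt := (intFam (V := V) C).inOb L
  transf :=
    { src := InternalCat.toPoint _ ≫ InternalCat.ofObj _ ((intFam (V := V) C).inOb L)
      tgt := elementsProj W ≫ intFunctor G
      app := weightedApp lam
      app_s := weightedApp_s lam
      app_t := weightedApp_t lam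
      naturality := weightedApp_nat lam _ _ }
  src_eq := rfl
  tgt_eq := rfl

end Internalization

end EnrInt

end

/-!
Both sides of the equivalence say that certain generalized elements factor uniquely, and the proof
reduces each of them to the same statement: for every object `A` of `C` and every object `X` of `V`,
every family of maps `W a ⊗ X ⟶ C(A, G a)` natural in `a` is of the form
`(w, x) ↦ k(x) ≫ λ_a(w)` for a unique `k : X ⟶ C(A, L)`.

On the enriched side, a `V`-natural transformation between `V`-valued functors is invertible as soon
as its components are (`VNatTrans.isIso_iff`), and maps `X ⟶ V^I(W, C(A, G -))` are exactly the
natural families (`famOf`). As the Yoneda transformation of `λ` acts on generalized elements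
by composition with the components of `λ` (`famOf_yonedaTrans`), the reduction follows by the
Yoneda lemma in `V` (`isWeightedLimit_iff`).

On the internal side, an element of an internal category is internally terminal if and only if every
generalized object has a unique generalized morphism to it (`isInternalTerminal_iff`); for the
internal category of cones this means that every generalized cone, with summit a generalized object
`a : X ⟶ A₀`, factors uniquely through the given one (`isInternalLimit_iff`). For cones in `Int C`,
extensivity decomposes `X` as a coproduct of pieces on which `a` is constant at an object `A` of
`C`, and unique factorization is local for this decomposition (`existsUnique_isFactor_of_cover`).
For a constant summit, extensivity again shows that the maps `W a ⊗ X ⟶ (Int C)₁` underlying a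
generalized cone land in the summand `C(A, G a)` (`exists_intCat_mor`), so that generalized cones
with summit `A` are the natural families (`isInternalLimit_weightedCone_iff`).
-/

noncomputable section

namespace EnrInt

open CartesianMonoidalCategory MonoidalClosed

/-! ### Representable presheaves and internal terminal objects -/

section Terminal

variable {V : Type u} [Category.{v} V]

theorem isIso_of_existsUnique {Y Z : V} (p : Y ⟶ Z)
    (h : ∀ (X : V) (b : X ⟶ Z), ∃! a : X ⟶ Y, a ≫ p = b) : IsIso p := by
  obtain ⟨q, hq, -⟩ := h Z (𝟙 Z)
  refine ⟨q, (h Y p).unique ?_ ?_, hq⟩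
  · rw [Category.assoc, hq, Category.comp_id]
  · rw [Category.id_comp]

/-- The map out of a representing object induced by a natural map `ψ` is invertible if and only if
`ψ` is bijective. -/
theorem Psh.Representable.isIso_iff {P : Psh V} (h : P.Representable) {Y : V}
    (ψ : ∀ {X : V}, P.obj X → (X ⟶ Y))
    (nat : ∀ {X X' : V} (z : X' ⟶ X) (a : P.obj X), ψ (P.map z a) = z ≫ ψ a) :
    IsIso (ψ h.elt) ↔ ∀ (X : V) (b : X ⟶ Y), ∃! a : P.obj X, ψ a = b := by
  constructor
  · intro hi X b
    refine ⟨P.map (b ≫ inv (ψ h.elt)) h.elt, ?_, fun a ha => ?_⟩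
    · change ψ (P.map _ _) = b
      rw [nat, Category.assoc, IsIso.inv_hom_id, Category.comp_id]
    · rw [← ha, ← h.map_lift a, nat, Category.assoc, IsIso.hom_inv_id, Category.comp_id]
  · intro H
    refine isIso_of_existsUnique _ fun X b => ?_
    obtain ⟨a, ha, hu⟩ := H X b
    refine ⟨h.lift a, ?_, fun f hf => ?_⟩
    · change h.lift a ≫ ψ h.elt = b
      rw [← nat, h.map_lift, ha]
    · exact (h.lift_eq (hu _ ((nat _ _).trans hf))).symm

variable [HasPullbacks V]

namespace InternalCat

theorem isIso_map₀ {A B : InternalCat V} (F : A ⟶ B) [IsIso F] : IsIso F.map₀ :=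
  ⟨(inv F).map₀, congrArg Hom.map₀ (IsIso.hom_inv_id F), congrArg Hom.map₀ (IsIso.inv_hom_id F)⟩

theorem isIso_of_isIso_map {A B : InternalCat V} (F : A ⟶ B) (h₀ : IsIso F.map₀)
    (h₁ : IsIso F.map₁) : IsIso F := by
  let G : B ⟶ A :=
    { map₀ := inv F.map₀
      map₁ := inv F.map₁
      map_s := by rw [IsIso.inv_comp_eq, ← Category.assoc, F.map_s, Category.assoc,
        IsIso.hom_inv_id, Category.comp_id]
      map_t := by rw [IsIso.inv_comp_eq, ← Category.assoc, F.map_t, Category.assoc,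
        IsIso.hom_inv_id, Category.comp_id]
      map_i := by rw [IsIso.eq_inv_comp, ← Category.assoc, ← F.map_i, Category.assoc,
        IsIso.hom_inv_id, Category.comp_id]
      map_c := Hom.map_c_of (fun X f g h h' => by
        rw [← cancel_mono F.map₁, F.map_comp, Category.assoc, IsIso.inv_hom_id, Category.comp_id]
        exact B.comp_congr (by simp) (by simp) _) _ }
  exact ⟨G, hom_ext (IsIso.hom_inv_id F.map₀) (IsIso.hom_inv_id F.map₁),
    hom_ext (IsIso.inv_hom_id F.map₀) (IsIso.inv_hom_id F.map₁)⟩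

variable [CartesianMonoidalCategory V]

/-- An element is internally terminal if and only if every generalized object has a unique
generalized morphism to it. The condition on generalized morphisms is automatic, as both composites
in the square that a morphism of the slice has to fill are morphisms to the terminal element. -/
theorem isInternalTerminal_iff {A : InternalCat V} (T : point V ⟶ A) :
    IsInternalTerminal T ↔ ∀ (X : V) (a : X ⟶ A.obj₀),
      ∃! f : X ⟶ A.obj₁, f ≫ A.s = a ∧ f ≫ A.t = toUnit X ≫ T.map₀ := by
  have h₀ := (commaOb_representable (𝟙 A) T).isIso_iff (fun x => x.left) (fun _ _ => rfl)
  have h₁ := (commaMor_representable (𝟙 A) T).isIso_iff (fun x => x.left) (fun _ _ => rfl)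
  constructor
  · intro h X a
    have : IsIso (commaProj (𝟙 A) T) := h
    obtain ⟨x, rfl, hx⟩ := h₀.1 (isIso_map₀ (commaProj (𝟙 A) T)) X a
    refine ⟨x.arr, ⟨x.arr_s.trans (Category.comp_id _), ?_⟩, fun f hf => ?_⟩
    · rw [x.arr_t, toUnit_unique x.right (toUnit X)]
    · exact congrArg CommaOb.arr
        (hx ⟨x.left, toUnit X, f, hf.1.trans (Category.comp_id _).symm, hf.2⟩ rfl)
  · intro H
    have uniq : ∀ {X : V} {f g : X ⟶ A.obj₁}, f ≫ A.s = g ≫ A.s → f ≫ A.t = toUnit X ≫ T.map₀ →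
        g ≫ A.t = toUnit X ≫ T.map₀ → f = g := fun {X f g} hs hf hg =>
      (H X (g ≫ A.s)).unique ⟨hs, hf⟩ ⟨rfl, hg⟩
    refine isIso_of_isIso_map _ (h₀.2 fun X a => ?_) (h₁.2 fun X f => ?_)
    · obtain ⟨f, ⟨hs, ht⟩, -⟩ := H X a
      refine ⟨⟨a, toUnit X, f, hs.trans (Category.comp_id _).symm, ht⟩, rfl, fun x hx => ?_⟩
      subst hx
      refine CommaOb.ext rfl (toUnit_unique _ _) (uniq ?_ ?_ ht)
      · rw [x.arr_s, hs]; exact Category.comp_id _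
      · rw [x.arr_t, toUnit_unique x.right (toUnit X)]
    · obtain ⟨g, ⟨hs, ht⟩, -⟩ := H X (f ≫ A.s)
      obtain ⟨g', ⟨hs', ht'⟩, -⟩ := H X (f ≫ A.t)
      have hT : ∀ k : X ⟶ (point V).obj₁, (k ≫ T.map₁) ≫ A.t = toUnit X ≫ T.map₀ := fun k => by
        rw [Category.assoc, T.map_t, ← Category.assoc]
        congr 1
        exact toUnit_unique _ _
      refine ⟨⟨f, toUnit X, g, g', hs.trans (Category.comp_id _).symm, ?_,
        hs'.trans (Category.comp_id _).symm, ?_, ?_⟩, rfl, fun x hx => ?_⟩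
      · rw [ht]; congr 1; exact toUnit_unique _ _
      · rw [ht']; congr 1; exact toUnit_unique _ _
      · refine uniq ?_ ?_ ?_
        · rw [A.comp_s, A.comp_s, hs, id_map₁, Category.comp_id]
        · rw [A.comp_t, hT]
        · rw [A.comp_t, ht']
      · subst hx
        refine CommaMor.ext rfl (toUnit_unique _ _) (uniq ?_ ?_ ht) (uniq ?_ ?_ ht')
        · rw [x.src_s, hs]; exact Category.comp_id _
        · rw [x.src_t]; congr 1; exact toUnit_unique _ _
        · rw [x.tgt_s, hs']; exact Category.comp_id _
        · rw [x.tgt_t]; congr 1; exact toUnit_unique _ _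

end InternalCat

end Terminal

/-! ### Internal limits in terms of generalized cones -/

section Cones

variable {V : Type u} [Category.{v} V] [HasPullbacks V]

/-- Generalized objects and morphisms of the internal category of a presheaf of categories `P`
are the elements of `P`. This translates the universal property of an internal terminal object. -/
theorem CatPsh.existsUnique_iff (P : CatPsh V) (h₀ : P.ob.Representable)
    (h₁ : P.mor.Representable) {X : V} (a b : P.ob.obj X) :
    (∃! f : X ⟶ (P.toInternal h₀ h₁).obj₁, f ≫ (P.toInternal h₀ h₁).s = h₀.lift a ∧
      f ≫ (P.toInternal h₀ h₁).t = h₀.lift b) ↔ ∃! f : P.mor.obj X, P.s f = a ∧ P.t f = b := by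
  have key : ∀ f : X ⟶ h₁.repr, (f ≫ (P.toInternal h₀ h₁).s = h₀.lift a ∧
      f ≫ (P.toInternal h₀ h₁).t = h₀.lift b) ↔
      (P.s (P.mor.map f h₁.elt) = a ∧ P.t (P.mor.map f h₁.elt) = b) := by
    intro f
    rw [← P.s_w h₀ h₁, ← P.t_w h₀ h₁]
    refine and_congr ⟨fun e => ?_, fun e => (h₀.lift_eq e).symm⟩
      ⟨fun e => ?_, fun e => (h₀.lift_eq e).symm⟩
    · exact (congrArg (fun q => P.ob.map q h₀.elt) e).trans (h₀.map_lift a)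
    · exact (congrArg (fun q => P.ob.map q h₀.elt) e).trans (h₀.map_lift b)
  constructor
  · rintro ⟨f, hf, hu⟩
    refine ⟨P.mor.map f h₁.elt, (key f).1 hf, fun g hg => ?_⟩
    rw [← hu (h₁.lift g) ((key _).2 (by rwa [h₁.map_lift])), h₁.map_lift]
  · rintro ⟨g, hg, hu⟩
    refine ⟨h₁.lift g, (key _).2 (by rwa [h₁.map_lift]), fun f hf => ?_⟩
    exact (h₁.lift_eq (hu _ ((key f).1 hf))).symm

namespace InternalCat

variable [CartesianMonoidalCategory V] {I A : InternalCat V}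

/-- The map `φ` underlies an internal natural transformation `I × cst X ⟶ A` from the constant
functor at the generalized object `a` to `F`: a generalized cone over `F` with summit `a`. -/
structure IsGenCone (F : I ⟶ A) {X : V} (a : X ⟶ A.obj₀) (φ : I.obj₀ ⊗ X ⟶ A.obj₁) : Prop where
  app_s : φ ≫ A.s = snd _ _ ≫ a
  app_t : φ ≫ A.t = fst _ _ ≫ F.map₀
  nat : I.t ▷ X ≫ φ = A.comp (I.s ▷ X ≫ φ) (fst _ _ ≫ F.map₁) (by
    rw [Category.assoc, Category.assoc, app_t, F.map_s, whiskerRight_fst_assoc])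

theorem IsGenCone.ofTransf {F : I ⟶ A} {X : V} {a : X ⟶ A.obj₀} (α : Transf (I.prodCst X) A)
    (hs : α.src = diagOb I a) (ht : α.tgt = I.prodCstFst X ≫ F) : IsGenCone F a α.app where
  app_s := by rw [α.app_s, hs]; rfl
  app_t := by rw [α.app_t, ht]; rfl
  nat := by
    have e : α.src.map₁ = (snd _ _ ≫ a) ≫ A.i := by
      rw [hs]; exact (Category.assoc _ _ _).symm
    have e' : α.tgt.map₁ = fst _ _ ≫ F.map₁ := by rw [ht]; rfl
    refine Eq.trans ?_ (α.naturality.trans (A.comp_congr rfl e' _))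
    exact ((A.comp_congr e rfl _).trans (A.id_comp _ _ _)).symm

/-- The internal natural transformation underlying a generalized cone. -/
def IsGenCone.transf {F : I ⟶ A} {X : V} {a : X ⟶ A.obj₀} {φ : I.obj₀ ⊗ X ⟶ A.obj₁}
    (h : IsGenCone F a φ) : Transf (I.prodCst X) A where
  src := diagOb I a
  tgt := I.prodCstFst X ≫ F
  app := φ
  app_s := h.app_s
  app_t := h.app_t
  naturality := by
    have e : (diagOb I a).map₁ = (snd (I.obj₁) X ≫ a) ≫ A.i := (Category.assoc _ _ _).symm
    refine (A.comp_congr e rfl _).trans ((A.id_comp _ _ _).trans h.nat)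

/-- The generalized morphism `f` factors the generalized cone `φ` with summit `a` through the
cone `c`. Composability is implied by `t`; it is quantified existentially so that `w` can state the
equation. -/
structure IsFactor {F : I ⟶ A} (c : Cone F) {X : V} (a : X ⟶ A.obj₀) (φ : I.obj₀ ⊗ X ⟶ A.obj₁)
    (f : X ⟶ A.obj₁) : Prop where
  s : f ≫ A.s = a
  t : f ≫ A.t = toUnit X ≫ c.pt
  w : ∃ h, A.comp (snd I.obj₀ X ≫ f) (fst I.obj₀ X ≫ c.transf.app) h = φ

variable [MonoidalClosed V]

/-- Composition in the internal functor category is vertical composition. -/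
theorem functorCat_comp {X : V} (u v : X ⟶ (functorCat I A).obj₁)
    (h : u ≫ (functorCat I A).t = v ≫ (functorCat I A).s) :
    (homMor I A).map ((functorCat I A).comp u v h) homMor_representable.elt =
      ((homMor I A).map u homMor_representable.elt).vcomp
        ((homMor I A).map v homMor_representable.elt)
        ((homPsh I A).comp_w homOb_representable homMor_representable h) :=
  (congrArg (fun q => (homMor I A).map q homMor_representable.elt)
    ((homPsh I A).toInternal_comp homOb_representable homMor_representable u v h)).trans
    (homMor_representable.map_lift _)

/-- The diagonal sends a generalized object to the constant functor at it. -/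
theorem map_diag₀ {X : V} (a : X ⟶ A.obj₀) :
    (homOb I A).map (a ≫ (diag I A).map₀) homOb_representable.elt = diagOb I a := by
  rw [(homOb I A).map_comp]
  refine (congrArg ((homOb I A).map a)
    ((homOb_representable (I := I) (A := A)).map_lift _)).trans ?_
  exact (map_diagOb a (𝟙 A.obj₀)).trans (congrArg (diagOb I) (Category.comp_id _))

/-- The diagonal sends a generalized morphism to the constant transformation at it. -/
theorem map_diag₁ {X : V} (f : X ⟶ A.obj₁) :
    (homMor I A).map (f ≫ (diag I A).map₁) homMor_representable.elt = diagMor I f := by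
  rw [(homMor I A).map_comp]
  refine (congrArg ((homMor I A).map f)
    ((homMor_representable (I := I) (A := A)).map_lift _)).trans ?_
  exact (map_diagMor f (𝟙 A.obj₁)).trans (congrArg (diagMor I) (Category.comp_id _))

theorem map_functorElt₀ (F : I ⟶ A) {X : V} (z : X ⟶ 𝟙_ V) :
    (homOb I A).map (z ≫ (functorElt F).map₀) homOb_representable.elt = I.prodCstFst X ≫ F := by
  rw [(homOb I A).map_comp]
  refine (congrArg ((homOb I A).map z)
    ((homOb_representable (I := I) (A := A)).map_lift _)).trans ?_
  exact hom_ext (whiskerLeft_fst_assoc _ _ _) (whiskerLeft_fst_assoc _ _ _)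

/-- The generalized object of the internal category of cones given by a generalized cone. -/
def IsGenCone.commaOb {F : I ⟶ A} {X : V} {a : X ⟶ A.obj₀} {φ : I.obj₀ ⊗ X ⟶ A.obj₁}
    (h : IsGenCone F a φ) : CommaOb (diag I A) (functorElt F) X where
  left := a
  right := toUnit X
  arr := homMor_representable.lift (P := homMor I A) h.transf
  arr_s := (homOb_representable (I := I) (A := A)).eq_of (by
    refine ((homPsh I A).s_w homOb_representable homMor_representable _).trans ?_
    rw [Psh.Representable.map_lift]
    exact (map_diag₀ a).symm)
  arr_t := (homOb_representable (I := I) (A := A)).eq_of (by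
    refine ((homPsh I A).t_w homOb_representable homMor_representable _).trans ?_
    rw [Psh.Representable.map_lift]
    exact (map_functorElt₀ F _).symm)

/-- Every generalized object of the internal category of cones comes from a generalized cone. -/
theorem exists_isGenCone {F : I ⟶ A} {X : V} (x : CommaOb (diag I A) (functorElt F) X) :
    ∃ (a : X ⟶ A.obj₀) (φ : I.obj₀ ⊗ X ⟶ A.obj₁) (h : IsGenCone F a φ), h.commaOb = x := by
  let α := (homMor I A).map x.arr homMor_representable.elt
  have hs : α.src = diagOb I x.left := by
    refine ((homPsh I A).s_w homOb_representable homMor_representable x.arr).symm.trans ?_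
    exact (congrArg (fun q => (homOb I A).map q homOb_representable.elt) x.arr_s).trans
      (map_diag₀ x.left)
  have ht : α.tgt = I.prodCstFst X ≫ F := by
    refine ((homPsh I A).t_w homOb_representable homMor_representable x.arr).symm.trans ?_
    exact (congrArg (fun q => (homOb I A).map q homOb_representable.elt) x.arr_t).trans
      (map_functorElt₀ F _)
  refine ⟨x.left, α.app, .ofTransf α hs ht, CommaOb.ext rfl (toUnit_unique _ _) ?_⟩
  exact (homMor_representable (I := I) (A := A)).lift_eq (Transf.ext hs ht rfl)

theorem IsGenCone.map_commaOb {F : I ⟶ A} {X : V} {a : X ⟶ A.obj₀} {φ : I.obj₀ ⊗ X ⟶ A.obj₁}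
    (h : IsGenCone F a φ) :
    (homMor I A).map h.commaOb.arr homMor_representable.elt = h.transf :=
  homMor_representable.map_lift _

/-- The generalized object of the internal category of cones that is constant at a cone. -/
def Cone.commaOb {F : I ⟶ A} (c : Cone F) (X : V) : CommaOb (diag I A) (functorElt F) X :=
  (InternalCat.commaOb (diag I A) (functorElt F)).map (toUnit X ≫ c.elt.map₀)
    (commaOb_representable (diag I A) (functorElt F)).elt

theorem Cone.lift_commaOb {F : I ⟶ A} (c : Cone F) (X : V) :
    (commaOb_representable (diag I A) (functorElt F)).lift (c.commaOb X) =
      toUnit X ≫ c.elt.map₀ :=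
  Psh.Representable.lift_eq _ rfl

theorem Cone.commaOb_left {F : I ⟶ A} (c : Cone F) (X : V) :
    (c.commaOb X).left = toUnit X ≫ c.pt := by
  refine (congrArg CommaOb.left ((InternalCat.commaOb _ _).map_comp _ _ _)).trans ?_
  exact congrArg (fun q => toUnit X ≫ CommaOb.left q)
    ((commaOb_representable (diag I A) (functorElt F)).map_lift _)

/-- The transformation underlying the constant generalized object at `c` is that of `c`. -/
theorem Cone.map_commaOb {F : I ⟶ A} (c : Cone F) (X : V) :
    ((homMor I A).map (c.commaOb X).arr homMor_representable.elt).app =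
      fst _ _ ≫ c.transf.app := by
  have e : (c.commaOb X).arr = toUnit X ≫
      homMor_representable.lift (P := homMor I A) (c.transf.whisker (I.prodCstFst (𝟙_ V))) := by
    refine (congrArg CommaOb.arr ((InternalCat.commaOb _ _).map_comp _ _ _)).trans ?_
    exact congrArg (fun q => toUnit X ≫ CommaOb.arr q)
      ((commaOb_representable (diag I A) (functorElt F)).map_lift _)
  rw [e, (homMor I A).map_comp]
  refine (congrArg (fun q => ((homMor I A).map (toUnit X) q).app)
    ((homMor_representable (I := I) (A := A)).map_lift _)).trans ?_
  exact whiskerLeft_fst_assoc _ _ _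

/-- The side of a square in the internal category of cones that lies over the terminal internal
category is an identity. -/
theorem comp_functorElt {F : I ⟶ A} {X : V} (u : X ⟶ (functorCat I A).obj₁) (k : X ⟶ 𝟙_ V)
    (h : u ≫ (functorCat I A).t = (k ≫ (functorElt F).map₁) ≫ (functorCat I A).s) :
    (functorCat I A).comp u (k ≫ (functorElt F).map₁) h = u := by
  have e : k ≫ (functorElt F).map₁ = (k ≫ (functorElt F).map₀) ≫ (functorCat I A).i :=
    (Category.assoc _ _ _).symm
  exact ((functorCat I A).comp_congr rfl e _).trans ((functorCat I A).comp_id _ _ _)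

/-- A generalized morphism to the constant generalized object at `c` in the internal category of
cones is a factorization through `c`. -/
theorem isFactor_of_commaMor {F : I ⟶ A} (c : Cone F) {X : V} {a : X ⟶ A.obj₀}
    {φ : I.obj₀ ⊗ X ⟶ A.obj₁} (h : IsGenCone F a φ)
    (m : CommaMor (diag I A) (functorElt F) X)
    (hs : (commaPsh (diag I A) (functorElt F)).s m = h.commaOb)
    (ht : (commaPsh (diag I A) (functorElt F)).t m = c.commaOb X) : IsFactor c a φ m.left where
  s := congrArg CommaOb.left hs
  t := (congrArg CommaOb.left ht).trans (c.commaOb_left X)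
  w := by
    have hw := (comp_functorElt _ _ _).symm.trans m.w
    have hsrc : m.src = h.commaOb.arr := congrArg CommaOb.arr hs
    have htgt : m.tgt = (c.commaOb X).arr := congrArg CommaOb.arr ht
    have h₁ := congrArg (fun q => ((homMor I A).map q homMor_representable.elt).app) hw
    have h₂ := h₁.trans (congrArg Transf.app (functorCat_comp _ _ _))
    have h₃ : ((homMor I A).map m.src homMor_representable.elt).app = φ := by
      rw [hsrc, h.map_commaOb]; rfl
    have e₁ : ((homMor I A).map (m.left ≫ (diag I A).map₁) homMor_representable.elt).app =
        snd _ _ ≫ m.left := by rw [map_diag₁]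
    have e₂ : ((homMor I A).map m.tgt homMor_representable.elt).app =
        fst _ _ ≫ c.transf.app := by rw [htgt, c.map_commaOb]
    have h₄ := h₂.trans (A.comp_congr e₁ e₂ _)
    exact ⟨_, h₄.symm.trans h₃⟩

/-- A factorization through `c` comes from a generalized morphism of the internal category of
cones. -/
theorem exists_commaMor {F : I ⟶ A} (c : Cone F) {X : V} {a : X ⟶ A.obj₀}
    {φ : I.obj₀ ⊗ X ⟶ A.obj₁} (h : IsGenCone F a φ) {f : X ⟶ A.obj₁} (hf : IsFactor c a φ f) :
    ∃ m : CommaMor (diag I A) (functorElt F) X, m.left = f ∧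
      (commaPsh (diag I A) (functorElt F)).s m = h.commaOb ∧
      (commaPsh (diag I A) (functorElt F)).t m = c.commaOb X := by
  have hu : ∀ k k' : X ⟶ (point V).obj₀, k = k' := fun k k' => toUnit_unique _ _
  have hleft : f ≫ A.t = (c.commaOb X).left := hf.t.trans (c.commaOb_left X).symm
  have src_s : h.commaOb.arr ≫ (functorCat I A).s = (f ≫ A.s) ≫ (diag I A).map₀ := by
    rw [hf.s]; exact h.commaOb.arr_s
  have src_t : h.commaOb.arr ≫ (functorCat I A).t =
      (toUnit X ≫ (point V).s) ≫ (functorElt F).map₀ :=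
    h.commaOb.arr_t.trans (congrArg (· ≫ (functorElt F).map₀) (hu _ _))
  have tgt_s : (c.commaOb X).arr ≫ (functorCat I A).s = (f ≫ A.t) ≫ (diag I A).map₀ := by
    rw [hleft]; exact (c.commaOb X).arr_s
  have tgt_t : (c.commaOb X).arr ≫ (functorCat I A).t =
      (toUnit X ≫ (point V).t) ≫ (functorElt F).map₀ :=
    (c.commaOb X).arr_t.trans (congrArg (· ≫ (functorElt F).map₀) (hu _ _))
  refine ⟨⟨f, toUnit X, h.commaOb.arr, (c.commaOb X).arr, src_s, src_t, tgt_s, tgt_t, ?_⟩, rfl,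
    CommaOb.ext hf.s (hu _ _) rfl, CommaOb.ext hleft (hu _ _) rfl⟩
  refine (comp_functorElt _ _ _).trans ((homMor_representable (I := I) (A := A)).eq_of ?_)
  refine Eq.trans ?_ (functorCat_comp _ _ _).symm
  rw [h.map_commaOb]
  have htgt : ((homMor I A).map (c.commaOb X).arr homMor_representable.elt).tgt =
      I.prodCstFst X ≫ F := by
    refine ((homPsh I A).t_w homOb_representable homMor_representable _).symm.trans ?_
    exact (congrArg (fun q => (homOb I A).map q homOb_representable.elt)
      (c.commaOb X).arr_t).trans (map_functorElt₀ F _)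
  have e₁ : ((homMor I A).map (f ≫ (diag I A).map₁) homMor_representable.elt).app =
      snd _ _ ≫ f := by rw [map_diag₁]
  have e₀ : ((homMor I A).map (f ≫ (diag I A).map₁) homMor_representable.elt).src =
      diagOb I a := by rw [map_diag₁, ← hf.s]
  obtain ⟨w, hw⟩ := hf.w
  refine Transf.ext e₀.symm htgt.symm ?_
  exact hw.symm.trans (A.comp_congr e₁.symm (c.map_commaOb X).symm _)

/-- A cone is an internal limit if and only if every generalized cone factors uniquely through
it. -/
theorem isInternalLimit_iff {F : I ⟶ A} (c : Cone F) :
    IsInternalLimit c ↔ ∀ (X : V) (a : X ⟶ A.obj₀) (φ : I.obj₀ ⊗ X ⟶ A.obj₁), IsGenCone F a φ →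
      ∃! f : X ⟶ A.obj₁, IsFactor c a φ f := by
  have key : IsInternalLimit c ↔ ∀ (X : V) (x : CommaOb (diag I A) (functorElt F) X),
      ∃! m : CommaMor (diag I A) (functorElt F) X,
        (commaPsh (diag I A) (functorElt F)).s m = x ∧
        (commaPsh (diag I A) (functorElt F)).t m = c.commaOb X := by
    refine (isInternalTerminal_iff c.elt).trans (forall_congr' fun X => ?_)
    constructor
    · intro H x
      refine ((commaPsh (diag I A) (functorElt F)).existsUnique_iff
        (commaOb_representable _ _) (commaMor_representable _ _) x (c.commaOb X)).1 ?_
      rw [c.lift_commaOb]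
      exact H _
    · intro H a
      have := ((commaPsh (diag I A) (functorElt F)).existsUnique_iff
        (commaOb_representable _ _) (commaMor_representable _ _) _ (c.commaOb X)).2
        (H ((InternalCat.commaOb _ _).map a (commaOb_representable _ _).elt))
      rw [c.lift_commaOb, Psh.Representable.lift_eq _ rfl] at this
      exact this
  rw [key]
  constructor
  · intro H X a φ h
    obtain ⟨m, ⟨hs, ht⟩, hu⟩ := H X h.commaOb
    refine ⟨m.left, isFactor_of_commaMor c h m hs ht, fun f hf => ?_⟩
    obtain ⟨m', rfl, hs', ht'⟩ := exists_commaMor c h hf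
    rw [hu m' ⟨hs', ht'⟩]
  · intro H X x
    obtain ⟨a, φ, h, rfl⟩ := exists_isGenCone x
    obtain ⟨f, hf, hu⟩ := H X _ φ h
    obtain ⟨m, rfl, hs, ht⟩ := exists_commaMor c h hf
    refine ⟨m, ⟨hs, ht⟩, fun m' hm' => ?_⟩
    exact CommaMor.ext (hu _ (isFactor_of_commaMor c h m' hm'.1 hm'.2)) (toUnit_unique _ _)
      (congrArg CommaOb.arr (hm'.1.trans hs.symm)) (congrArg CommaOb.arr (hm'.2.trans ht.symm))

end InternalCat

end Cones

/-! ### Generalized cones are local in the parameter -/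

section Local

variable {V : Type u} [Category.{v} V] [CartesianMonoidalCategory V]

section

variable [HasPullbacks V]

namespace InternalCat

variable {I A : InternalCat V} {F : I ⟶ A}

theorem IsGenCone.precomp {X Y : V} {a : X ⟶ A.obj₀} {φ : I.obj₀ ⊗ X ⟶ A.obj₁}
    (h : IsGenCone F a φ) (y : Y ⟶ X) : IsGenCone F (y ≫ a) (I.obj₀ ◁ y ≫ φ) where
  app_s := by rw [Category.assoc, h.app_s, whiskerLeft_snd_assoc]
  app_t := by rw [Category.assoc, h.app_t, whiskerLeft_fst_assoc]
  nat := by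
    have := congrArg (I.obj₁ ◁ y ≫ ·) h.nat
    beta_reduce at this
    rw [A.precomp, whisker_exchange_assoc] at this
    exact this.trans (A.comp_congr (whisker_exchange_assoc _ _ _)
      (whiskerLeft_fst_assoc _ _ _) _)

theorem IsFactor.precomp {c : Cone F} {X Y : V} {a : X ⟶ A.obj₀} {φ : I.obj₀ ⊗ X ⟶ A.obj₁}
    {f : X ⟶ A.obj₁} (h : IsFactor c a φ f) (y : Y ⟶ X) :
    IsFactor c (y ≫ a) (I.obj₀ ◁ y ≫ φ) (y ≫ f) where
  s := by rw [Category.assoc, h.s]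
  t := by rw [Category.assoc, h.t, ← Category.assoc, toUnit_unique (y ≫ toUnit X) (toUnit Y)]
  w := by
    obtain ⟨h₁, hw⟩ := h.w
    have := congrArg (I.obj₀ ◁ y ≫ ·) hw
    beta_reduce at this
    rw [A.precomp] at this
    have e₁ : I.obj₀ ◁ y ≫ snd _ _ ≫ f = snd _ _ ≫ y ≫ f := whiskerLeft_snd_assoc _ _ _
    have e₂ : I.obj₀ ◁ y ≫ fst _ _ ≫ c.transf.app = fst _ _ ≫ c.transf.app :=
      whiskerLeft_fst_assoc _ _ _
    exact ⟨_, (A.comp_congr e₁ e₂ _).symm.trans this⟩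

end InternalCat

end

variable [MonoidalClosed V]

theorem whiskerLeft_cover_ext [HasCoproducts.{w} V] {ι : Type w} {Y : ι → V} {X N T : V}
    {y : ∀ i, Y i ⟶ X} (hy : IsIso (Sigma.desc y)) {f g : N ⊗ X ⟶ T}
    (h : ∀ i, N ◁ y i ≫ f = N ◁ y i ≫ g) : f = g :=
  curry_injective (cover_ext hy fun i => by
    rw [← curry_natural_left, ← curry_natural_left, h])

theorem sigma_whiskerRight_ext [HasCoproducts.{w} V] {ι : Type w} {Y : ι → V} {X T : V}
    {f g : (∐ Y) ⊗ X ⟶ T} (h : ∀ i, Sigma.ι Y i ▷ X ≫ f = Sigma.ι Y i ▷ X ≫ g) : f = g := by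
  have e : ∀ f : (∐ Y) ⊗ X ⟶ T, lift (snd _ _) (fst _ _) ≫ lift (snd X (∐ Y)) (fst _ _) ≫ f = f :=
    fun f => by simp [← Category.assoc]
  rw [← e f, ← e g]
  congr 1
  refine tensor_sigma_ext fun i => ?_
  have e' : X ◁ Sigma.ι Y i ≫ lift (snd _ _) (fst _ _) =
      lift (snd _ _) (fst _ _) ≫ Sigma.ι Y i ▷ X := by
    apply CartesianMonoidalCategory.hom_ext <;> simp
  rw [reassoc_of% e', h, reassoc_of% e']

theorem exists_sigma_whiskerRight_desc [HasCoproducts.{w} V] {ι : Type w} {Y : ι → V} {X T : V}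
    (f : ∀ i, Y i ⊗ X ⟶ T) : ∃ m : (∐ Y) ⊗ X ⟶ T, ∀ i, Sigma.ι Y i ▷ X ≫ m = f i := by
  obtain ⟨m, hm⟩ := exists_tensor_desc fun i => lift (snd X (Y i)) (fst _ _) ≫ f i
  refine ⟨lift (snd _ _) (fst _ _) ≫ m, fun i => ?_⟩
  have e : Sigma.ι Y i ▷ X ≫ lift (snd _ _) (fst _ _) =
      lift (snd _ _) (fst _ _) ≫ X ◁ Sigma.ι Y i := by
    apply CartesianMonoidalCategory.hom_ext <;> simp
  rw [reassoc_of% e, hm, ← Category.assoc]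
  simp

variable [HasPullbacks V]

namespace InternalCat

variable {I A : InternalCat V} {F : I ⟶ A}

theorem isFactor_of_cover [HasCoproducts.{w} V] {c : Cone F} {X : V} {a : X ⟶ A.obj₀}
    {φ : I.obj₀ ⊗ X ⟶ A.obj₁} {f : X ⟶ A.obj₁} {ι : Type w} {Y : ι → V} {y : ∀ i, Y i ⟶ X}
    (hy : IsIso (Sigma.desc y))
    (h : ∀ i, IsFactor c (y i ≫ a) (I.obj₀ ◁ y i ≫ φ) (y i ≫ f)) : IsFactor c a φ f := by
  have ht : f ≫ A.t = toUnit X ≫ c.pt := cover_ext hy fun i => by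
    rw [← Category.assoc, (h i).t, ← Category.assoc, toUnit_unique (y i ≫ toUnit X) (toUnit _)]
  have hw : (snd I.obj₀ X ≫ f) ≫ A.t = (fst I.obj₀ X ≫ c.transf.app) ≫ A.s := by
    rw [Category.assoc, Category.assoc, ht, c.transf.app_s, c.src_eq]
    refine (Category.assoc _ _ _).symm.trans (Eq.trans ?_ (Category.assoc _ _ _))
    exact congrArg (· ≫ c.pt) (toUnit_unique _ _)
  refine ⟨cover_ext hy fun i => ?_, ht, hw, whiskerLeft_cover_ext hy fun i => ?_⟩
  · rw [← Category.assoc, (h i).s]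
  · obtain ⟨h₁, hw₁⟩ := (h i).w
    rw [A.precomp, ← hw₁]
    exact A.comp_congr (whiskerLeft_snd_assoc _ _ _) (whiskerLeft_fst_assoc _ _ _) _

/-- Unique factorization through a cone may be checked on a coproduct decomposition of the
parameter. -/
theorem existsUnique_isFactor_of_cover [HasCoproducts.{w} V] {c : Cone F} {X : V} {a : X ⟶ A.obj₀}
    {φ : I.obj₀ ⊗ X ⟶ A.obj₁} {ι : Type w} {Y : ι → V} {y : ∀ i, Y i ⟶ X}
    (hy : IsIso (Sigma.desc y))
    (h : ∀ i, ∃! f, IsFactor c (y i ≫ a) (I.obj₀ ◁ y i ≫ φ) f) : ∃! f, IsFactor c a φ f := by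
  choose f hf hu using h
  refine ⟨inv (Sigma.desc y) ≫ Sigma.desc f, isFactor_of_cover hy fun i => ?_, fun g hg => ?_⟩
  · have e : y i ≫ inv (Sigma.desc y) ≫ Sigma.desc f = f i := by
      have : y i ≫ inv (Sigma.desc y) = Sigma.ι Y i := by rw [IsIso.comp_inv_eq, Sigma.ι_desc]
      rw [reassoc_of% this, Sigma.ι_desc]
    rw [e]; exact hf i
  · rw [IsIso.eq_inv_comp]
    refine Sigma.hom_ext _ _ fun i => ?_
    rw [Sigma.ι_desc_assoc, Sigma.ι_desc]
    exact hu i _ (hg.precomp (y i))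

end InternalCat

end Local

/-! ### Generalized cones over the category of elements -/

section Elements

variable {V : Type u} [Category.{v} V] [CartesianMonoidalCategory V] [MonoidalClosed V]

section

variable {I C : Type*} [EnrichedCategory V I] [EnrichedCategory V C]

/-- A family of maps `W a ⊗ X ⟶ C(A, G a)` that is natural in `a`: a generalized element at `X`
of the object of `V`-natural transformations `W ⇒ C(A, G -)`. -/
def IsNatFam (W : EnrichedFunctor V I V) (G : EnrichedFunctor V I C) {A : C} {X : V}
    (ψ : ∀ a, W.obj a ⊗ X ⟶ (A ⟶[V] G.obj a)) : Prop :=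
  ∀ {Z : V} (a b : I) (x : Z ⟶ W.obj a) (k : Z ⟶ (a ⟶[V] b)) (z : Z ⟶ X),
    lift (act x (k ≫ W.map a b)) z ≫ ψ b = ecomp (lift x z ≫ ψ a) (k ≫ G.map a b)

/-- Naturality at the universal generalized element, the identity of `W a ⊗ I(a, b) ⊗ X`. -/
theorem isNatFam_iff {W : EnrichedFunctor V I V} {G : EnrichedFunctor V I C} {A : C} {X : V}
    {ψ : ∀ a, W.obj a ⊗ X ⟶ (A ⟶[V] G.obj a)} :
    IsNatFam W G ψ ↔ ∀ a b, (elementsFam W).t a b ▷ X ≫ ψ b =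
      ecomp ((elementsFam W).s a b ▷ X ≫ ψ a) (fst _ _ ≫ snd _ _ ≫ G.map a b) := by
  constructor
  · intro h a b
    have := h a b (fst _ _ ≫ fst (W.obj a) (a ⟶[V] b)) (fst _ _ ≫ snd _ _) (snd _ X)
    have e₁ : lift (act (fst _ _ ≫ fst (W.obj a) (a ⟶[V] b)) ((fst _ X ≫ snd _ _) ≫ W.map a b))
        (snd _ _) = act (fst _ _) (snd _ _ ≫ W.map a b) ▷ X := by
      apply CartesianMonoidalCategory.hom_ext <;> simp [comp_act]
    have e₂ : lift (fst _ _ ≫ fst (W.obj a) (a ⟶[V] b)) (snd _ _) = fst _ _ ▷ X := by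
      apply CartesianMonoidalCategory.hom_ext <;> simp
    rw [e₁, e₂, Category.assoc] at this
    exact this
  · intro h Z a b x k z
    have := congrArg (lift (lift x k) z ≫ ·) (h a b)
    beta_reduce at this
    rw [comp_ecomp] at this
    simpa [comp_act] using this

end

variable [HasCoproducts.{w} V] [Extensive.{w} V] [HasPullbacks V]

/-- By extensivity, a generalized morphism of `Int C` between constant objects `A` and `B` is a
generalized element of `C(A, B)`. -/
theorem exists_intCat_mor {C : Type w} [EnrichedCategory V C] {X : V} {A B : C}
    (m : X ⟶ (IntCat (V := V) C).obj₁)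
    (hs : m ≫ (IntCat (V := V) C).s = toUnit X ≫ (intFam (V := V) C).inOb A)
    (ht : m ≫ (IntCat (V := V) C).t = toUnit X ≫ (intFam (V := V) C).inOb B) :
    ∃ k : X ⟶ (A ⟶[V] B), k ≫ (intFam (V := V) C).inMor A B = m := by
  let N : C × C → V := fun p => (p.1 ⟶[V] p.2)
  -- `m` lies over the point `(A, B)` of `∐ 1`, which can be checked on a decomposition of `X`.
  have key : m ≫ Limits.Sigma.map (fun p : C × C => toUnit (N p)) =
      toUnit X ≫ Sigma.ι (fun _ : C × C => 𝟙_ V) (A, B) := by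
    obtain ⟨Y, y, k, hk, hy⟩ := exists_cover N m
    refine cover_ext hy fun p => ?_
    obtain ⟨A', B'⟩ := p
    have e : ∀ {r : (IntCat (V := V) C).obj₁ ⟶ (IntCat (V := V) C).obj₀} {D D' : C},
        (intFam (V := V) C).inMor A' B' ≫ r = toUnit _ ≫ (intFam (V := V) C).inOb D' →
        m ≫ r = toUnit X ≫ (intFam (V := V) C).inOb D →
        toUnit (Y (A', B')) ≫ Sigma.ι (fun _ : C => 𝟙_ V) D' =
          toUnit (Y (A', B')) ≫ Sigma.ι (fun _ : C => 𝟙_ V) D := fun {r D D'} h h' => by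
      have h₁ := congrArg (y (A', B') ≫ ·) h'
      have h₂ := congrArg (k (A', B') ≫ ·) h
      have h₃ := congrArg (· ≫ r) (hk (A', B'))
      simp only [Category.assoc] at h₁ h₂ h₃
      have h₄ := h₂.symm.trans (h₃.symm.trans h₁)
      simp only [← Category.assoc] at h₄
      rw [toUnit_unique (k (A', B') ≫ _) (toUnit _),
        toUnit_unique (y (A', B') ≫ _) (toUnit _)] at h₄
      exact h₄
    -- The pieces on which `m` takes values in another summand are initial.
    by_cases hA : A' = A
    · by_cases hB : B' = B
      · subst hA hB
        have h₃ := congrArg (· ≫ Limits.Sigma.map (fun p : C × C => toUnit (N p))) (hk (A', B'))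
        beta_reduce at h₃
        rw [Category.assoc, Category.assoc, Sigma.ι_map] at h₃
        rw [h₃, ← Category.assoc, ← Category.assoc]
        congr 1
        exact toUnit_unique _ _
      · exact initial_hom_ext (sigma_disjoint (X := fun _ : C => 𝟙_ V) hB _ _
          (e ((intFam (V := V) C).in_tgt A' B') ht)) (𝟙 _) _ _
    · exact initial_hom_ext (sigma_disjoint (X := fun _ : C => 𝟙_ V) hA _ _
        (e ((intFam (V := V) C).in_src A' B') hs)) (𝟙 _) _ _
  obtain ⟨k, hk, -⟩ := exists_lift (X := fun _ : C × C => 𝟙_ V)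
    (fun p => toUnit (N p)) m (toUnit X) key
  exact ⟨k, hk⟩

variable {I C : Type w} [EnrichedCategory V I] [EnrichedCategory V C]

variable {W : EnrichedFunctor V I V} {G : EnrichedFunctor V I C}

/-- Compatibility of a map out of `(∫ W)₀ ⊗ X` with a family of maps out of the `W a ⊗ X`. -/
def Restricts {A : C} {X : V} (φ : (elements W).obj₀ ⊗ X ⟶ (IntCat (V := V) C).obj₁)
    (ψ : ∀ a, W.obj a ⊗ X ⟶ (A ⟶[V] G.obj a)) : Prop :=
  ∀ a, (elementsFam W).inOb a ▷ X ≫ φ = ψ a ≫ (intFam (V := V) C).inMor A (G.obj a)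

/-- The left-hand side of the naturality square of a generalized cone on a summand. -/
theorem Restricts.tgt {A : C} {X : V} {φ : (elements W).obj₀ ⊗ X ⟶ (IntCat (V := V) C).obj₁}
    {ψ : ∀ a, W.obj a ⊗ X ⟶ (A ⟶[V] G.obj a)} (h : Restricts φ ψ) (a b : I) :
    (elementsFam W).inMor a b ▷ X ≫ (elements W).t ▷ X ≫ φ =
      ((elementsFam W).t a b ▷ X ≫ ψ b) ≫ (intFam (V := V) C).inMor A (G.obj b) := by
  rw [← comp_whiskerRight_assoc, FamCat.in_tgt, comp_whiskerRight_assoc, h b, Category.assoc]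

theorem Restricts.src {A : C} {X : V} {φ : (elements W).obj₀ ⊗ X ⟶ (IntCat (V := V) C).obj₁}
    {ψ : ∀ a, W.obj a ⊗ X ⟶ (A ⟶[V] G.obj a)} (h : Restricts φ ψ) (a b : I) :
    (elementsFam W).inMor a b ▷ X ≫ (elements W).s ▷ X ≫ φ =
      ((elementsFam W).s a b ▷ X ≫ ψ a) ≫ (intFam (V := V) C).inMor A (G.obj a) := by
  rw [← comp_whiskerRight_assoc, FamCat.in_src, comp_whiskerRight_assoc, h a, Category.assoc]

/-- The right-hand side of the naturality square of a generalized cone on a summand. -/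
theorem Restricts.comp {A : C} {X : V} {φ : (elements W).obj₀ ⊗ X ⟶ (IntCat (V := V) C).obj₁}
    {ψ : ∀ a, W.obj a ⊗ X ⟶ (A ⟶[V] G.obj a)} (h : Restricts φ ψ) (a b : I)
    (h' : ((elements W).s ▷ X ≫ φ) ≫ (IntCat (V := V) C).t =
      (fst _ X ≫ (elementsProj W ≫ intFunctor G).map₁) ≫ (IntCat (V := V) C).s) :
    (elementsFam W).inMor a b ▷ X ≫ (IntCat (V := V) C).comp ((elements W).s ▷ X ≫ φ)
      (fst _ _ ≫ (elementsProj W ≫ intFunctor G).map₁) h' =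
      ecomp ((elementsFam W).s a b ▷ X ≫ ψ a) (fst _ _ ≫ snd _ _ ≫ G.map a b) ≫
        (intFam (V := V) C).inMor A (G.obj b) := by
  have e : (elementsFam W).inMor a b ▷ X ≫ fst _ X ≫ (elementsProj W ≫ intFunctor G).map₁ =
      (fst _ _ ≫ snd _ _ ≫ G.map a b) ≫ (intFam (V := V) C).inMor (G.obj a) (G.obj b) := by
    rw [whiskerRight_fst_assoc, Category.assoc]
    exact congrArg (fst _ _ ≫ ·) (in_proj₁ W G a b)
  rw [InternalCat.precomp]
  refine (InternalCat.comp_congr _ (h.src a b) e _).trans ?_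
  exact (intFam (V := V) C).total_comp_in _ _ (toUnit_unique _ _) _

theorem Restricts.isGenCone {A : C} {X : V}
    {φ : (elements W).obj₀ ⊗ X ⟶ (IntCat (V := V) C).obj₁}
    {ψ : ∀ a, W.obj a ⊗ X ⟶ (A ⟶[V] G.obj a)} (h : Restricts φ ψ) (hψ : IsNatFam W G ψ) :
    InternalCat.IsGenCone (elementsProj W ≫ intFunctor G)
      (toUnit X ≫ (intFam (V := V) C).inOb A) φ := by
  have hu : ∀ {Y : V} (k k' : Y ⟶ 𝟙_ V), k = k' := fun k k' => toUnit_unique k k'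
  have hs : φ ≫ (IntCat (V := V) C).s = snd _ _ ≫ toUnit X ≫ (intFam (V := V) C).inOb A := by
    refine sigma_whiskerRight_ext fun a => ?_
    refine (reassoc_of% h a) _ |>.trans ?_
    rw [FamCat.in_src, ← Category.assoc, ← Category.assoc (snd _ _), ← Category.assoc]
    exact congrArg (· ≫ (intFam (V := V) C).inOb A) (hu _ _)
  have ht : φ ≫ (IntCat (V := V) C).t = fst _ _ ≫ (elementsProj W ≫ intFunctor G).map₀ := by
    refine sigma_whiskerRight_ext fun a => ?_
    refine (reassoc_of% h a) _ |>.trans ?_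
    rw [FamCat.in_tgt, ← Category.assoc, whiskerRight_fst_assoc]
    refine Eq.trans ?_ (congrArg (fst _ _ ≫ ·) (in_proj₀ W G a)).symm
    refine Eq.trans ?_ (Category.assoc _ _ _)
    exact congrArg (· ≫ (intFam (V := V) C).inOb (G.obj a)) (hu _ _)
  refine ⟨hs, ht, sigma_whiskerRight_ext fun p => ?_⟩
  refine (h.tgt p.1 p.2).trans (Eq.trans ?_ (h.comp p.1 p.2 _).symm)
  rw [isNatFam_iff.1 hψ]

theorem InternalCat.IsGenCone.exists_restricts {A : C} {X : V}
    {φ : (elements W).obj₀ ⊗ X ⟶ (IntCat (V := V) C).obj₁}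
    (h : InternalCat.IsGenCone (elementsProj W ≫ intFunctor G)
      (toUnit X ≫ (intFam (V := V) C).inOb A) φ) :
    ∃ ψ : ∀ a, W.obj a ⊗ X ⟶ (A ⟶[V] G.obj a), Restricts φ ψ ∧ IsNatFam W G ψ := by
  have hu : ∀ {Y : V} (k k' : Y ⟶ 𝟙_ V), k = k' := fun k k' => toUnit_unique k k'
  have key : ∀ a, ∃ k : W.obj a ⊗ X ⟶ (A ⟶[V] G.obj a),
      k ≫ (intFam (V := V) C).inMor A (G.obj a) = (elementsFam W).inOb a ▷ X ≫ φ := by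
    refine fun a => exists_intCat_mor _ ?_ ?_
    · rw [Category.assoc, h.app_s, whiskerRight_snd_assoc, ← Category.assoc]
      exact congrArg (· ≫ (intFam (V := V) C).inOb A) (hu _ _)
    · rw [Category.assoc, h.app_t, whiskerRight_fst_assoc]
      refine (congrArg (fst _ _ ≫ ·) (in_proj₀ W G a)).trans ?_
      refine (Category.assoc _ _ _).symm.trans ?_
      exact congrArg (· ≫ (intFam (V := V) C).inOb (G.obj a)) (hu _ _)
  choose ψ hψ using key
  have hr : Restricts φ ψ := fun a => (hψ a).symm
  refine ⟨ψ, hr, isNatFam_iff.2 fun a b => ?_⟩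
  have := congrArg ((elementsFam W).inMor a b ▷ X ≫ ·) h.nat
  exact sigma_ι_inj (X := fun p : C × C => (p.1 ⟶[V] p.2)) (a := (A, G.obj b))
    ((hr.tgt a b).symm.trans (this.trans (hr.comp a b _)))

/-- Factorizations through the weighted cone, in terms of hom-objects of `C`. -/
theorem isFactor_iff {L A : C} (lam : VNatTrans W (G.comp V (coRep L))) {X : V}
    {φ : (elements W).obj₀ ⊗ X ⟶ (IntCat (V := V) C).obj₁}
    {ψ : ∀ a, W.obj a ⊗ X ⟶ (A ⟶[V] G.obj a)} (h : Restricts φ ψ) (k : X ⟶ (A ⟶[V] L)) :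
    InternalCat.IsFactor (weightedCone W G L lam) (toUnit X ≫ (intFam (V := V) C).inOb A) φ
      (k ≫ (intFam (V := V) C).inMor A L) ↔
      ∀ a, ecomp (snd _ _ ≫ k) (fst _ _ ≫ lamMap lam a) = ψ a := by
  have hu : ∀ {Y : V} (k k' : Y ⟶ 𝟙_ V), k = k' := fun k k' => toUnit_unique k k'
  have hs : (k ≫ (intFam (V := V) C).inMor A L) ≫ (IntCat (V := V) C).s =
      toUnit X ≫ (intFam (V := V) C).inOb A := by
    rw [Category.assoc, FamCat.in_src, ← Category.assoc]
    exact congrArg (· ≫ (intFam (V := V) C).inOb A) (hu _ _)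
  have ht : (k ≫ (intFam (V := V) C).inMor A L) ≫ (IntCat (V := V) C).t =
      toUnit X ≫ (intFam (V := V) C).inOb L := by
    rw [Category.assoc, FamCat.in_tgt, ← Category.assoc]
    exact congrArg (· ≫ (intFam (V := V) C).inOb L) (hu _ _)
  have hw : (snd (elements W).obj₀ X ≫ k ≫ (intFam (V := V) C).inMor A L) ≫
      (IntCat (V := V) C).t = (fst _ _ ≫ weightedApp lam) ≫ (IntCat (V := V) C).s := by
    rw [Category.assoc, Category.assoc (fst _ _), ht, weightedApp_s, ← Category.assoc,
      ← Category.assoc]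
    exact congrArg (· ≫ (intFam (V := V) C).inOb L) (hu _ _)
  have hc : ∀ a, (elementsFam W).inOb a ▷ X ≫ (IntCat (V := V) C).comp _ _ hw =
      ecomp (snd _ _ ≫ k) (fst _ _ ≫ lamMap lam a) ≫
        (intFam (V := V) C).inMor A (G.obj a) := by
    intro a
    have e₁ : (elementsFam W).inOb a ▷ X ≫ snd _ X ≫ k ≫ (intFam (V := V) C).inMor A L =
        (snd _ _ ≫ k) ≫ (intFam (V := V) C).inMor A L := by
      rw [whiskerRight_snd_assoc, Category.assoc]
    have e₂ : (elementsFam W).inOb a ▷ X ≫ fst _ X ≫ weightedApp lam =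
        (fst _ _ ≫ lamMap lam a) ≫ (intFam (V := V) C).inMor L (G.obj a) := by
      rw [whiskerRight_fst_assoc, in_weightedApp, Category.assoc]
    rw [InternalCat.precomp]
    refine (InternalCat.comp_congr _ e₁ e₂ _).trans ?_
    exact (intFam (V := V) C).total_comp_in _ _ (hu _ _) _
  constructor
  · intro hf a
    obtain ⟨_, w⟩ := hf.w
    have := congrArg ((elementsFam W).inOb a ▷ X ≫ ·) w
    exact sigma_ι_inj (X := fun p : C × C => (p.1 ⟶[V] p.2)) (a := (A, G.obj a))
      ((hc a).symm.trans (this.trans (h a)))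
  · intro hk
    refine ⟨hs, ht, hw, sigma_whiskerRight_ext fun a => ?_⟩
    exact (hc a).trans ((congrArg (· ≫ _) (hk a)).trans (h a).symm)

theorem isInternalLimit_weightedCone_iff {L : C} (lam : VNatTrans W (G.comp V (coRep L))) :
    InternalCat.IsInternalLimit (weightedCone W G L lam) ↔
      ∀ (A : C) (X : V) (ψ : ∀ a, W.obj a ⊗ X ⟶ (A ⟶[V] G.obj a)), IsNatFam W G ψ →
        ∃! k : X ⟶ (A ⟶[V] L), ∀ a, ecomp (snd _ _ ≫ k) (fst _ _ ≫ lamMap lam a) = ψ a := by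
  rw [InternalCat.isInternalLimit_iff]
  constructor
  · intro H A X ψ hψ
    obtain ⟨φ, hφ⟩ := exists_sigma_whiskerRight_desc (X := X)
      fun a => ψ a ≫ (intFam (V := V) C).inMor A (G.obj a)
    obtain ⟨f, hf, hu⟩ := H X _ φ (Restricts.isGenCone hφ hψ)
    obtain ⟨k, rfl⟩ := exists_intCat_mor f hf.s hf.t
    refine ⟨k, (isFactor_iff lam hφ k).1 hf, fun k' hk' => ?_⟩
    exact sigma_ι_inj (X := fun p : C × C => (p.1 ⟶[V] p.2)) (a := (A, L))
      (hu _ ((isFactor_iff lam hφ k').2 hk'))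
  · intro H X a φ h
    -- Decompose `X` into pieces on which the summit is constant.
    obtain ⟨Y, y, g, hg, hy⟩ := exists_cover _ a
    refine InternalCat.existsUnique_isFactor_of_cover hy fun A => ?_
    have e : y A ≫ a = toUnit (Y A) ≫ (intFam (V := V) C).inOb A :=
      (hg A).trans (congrArg (· ≫ (intFam (V := V) C).inOb A) (toUnit_unique _ _))
    have h' := h.precomp (y A)
    rw [e] at h' ⊢
    obtain ⟨ψ, hψ, hn⟩ := h'.exists_restricts
    obtain ⟨k, hk, hu⟩ := H A (Y A) ψ hn
    refine ⟨_, (isFactor_iff lam hψ k).2 hk, fun f hf => ?_⟩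
    obtain ⟨k', rfl⟩ := exists_intCat_mor f hf.s hf.t
    exact congrArg (· ≫ (intFam (V := V) C).inMor A L) (hu k' ((isFactor_iff lam hψ k').1 hf))

end Elements

/-! ### Weighted limits in terms of natural families -/

section Weighted

variable {V : Type u} [Category.{v} V] [CartesianMonoidalCategory V] [MonoidalClosed V]

section

variable {C : Type*} [EnrichedCategory V C]

theorem VNatTrans.curry'_toMap {F G : EnrichedFunctor V C V} (α : VNatTrans F G) (a : C) :
    curry' (α.toMap a) = α.app a :=
  curry'_uncurry' _

/-- Composition in the self-enrichment of `V` corresponds to composition in `V`. -/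
theorem ecomp_curry'_eq_eId_iff {X Y : V} (f : X ⟶ Y) (g : Y ⟶ X) :
    ecomp (V := V) (C := V) (curry' f) (curry' g) = eId V X ↔ f ≫ g = 𝟙 X := by
  have e : ∀ {Z : V} (z : Z ⟶ 𝟙_ V) (x : Z ⟶ X),
      act x (z ≫ ecomp (V := V) (C := V) (curry' f) (curry' g)) = x ≫ f ≫ g := fun z x => by
    rw [comp_ecomp (C := V), act_ecomp, act_curry', act_curry', Category.assoc]
  constructor
  · intro h
    have := e (toUnit X) (𝟙 X)
    rw [h, act_id, Category.id_comp] at this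
    exact this.symm
  · intro h
    refine hom_ext_act fun z x => ?_
    rw [e, act_id, h, Category.comp_id]

/-- A `V`-natural transformation between `V`-valued `V`-functors is invertible if and only if
its components are. -/
theorem VNatTrans.isIso_iff {F G : EnrichedFunctor V C V} (α : VNatTrans F G) :
    α.IsIso ↔ ∀ a, CategoryTheory.IsIso (α.toMap a) := by
  constructor
  · rintro ⟨β, hβ⟩ a
    refine ⟨β.toMap a, (ecomp_curry'_eq_eId_iff _ _).1 ?_, (ecomp_curry'_eq_eId_iff _ _).1 ?_⟩
    · rw [curry'_toMap, curry'_toMap]; exact (hβ a).1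
    · rw [curry'_toMap, curry'_toMap]; exact (hβ a).2
  · intro h
    refine ⟨VNatTrans.ofMaps (fun a => inv (α.toMap a)) fun a b x k => ?_, fun a => ⟨?_, ?_⟩⟩
    · rw [IsIso.comp_inv_eq, α.toMap_nat, Category.assoc, IsIso.inv_hom_id, Category.comp_id]
    · rw [← α.curry'_toMap]
      exact (ecomp_curry'_eq_eId_iff _ _).2 (IsIso.hom_inv_id _)
    · rw [← α.curry'_toMap]
      exact (ecomp_curry'_eq_eId_iff _ _).2 (IsIso.inv_hom_id _)

end

variable [HasCoproducts.{w} V] [Extensive.{w} V] [HasPullbacks V]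
  {I : Type w} [EnrichedCategory V I] {C : Type*} [EnrichedCategory V C]

/-- The family of maps corresponding to a generalized element of the object of `V`-natural
transformations. -/
def famOf {W : EnrichedFunctor V I V} {G : EnrichedFunctor V I C} {A : C} {X : V}
    (g : X ⟶ funHom W (G.comp V (coRep A))) (a : I) : W.obj a ⊗ X ⟶ (A ⟶[V] G.obj a) :=
  uncurry (g ≫ funProj W (G.comp V (coRep A)) a)

theorem lift_famOf {W : EnrichedFunctor V I V} {G : EnrichedFunctor V I C} {A : C} {X : V}
    (g : X ⟶ funHom W (G.comp V (coRep A))) (a : I) {Z : V} (x : Z ⟶ W.obj a) (z : Z ⟶ X) :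
    lift x z ≫ famOf g a = act x (z ≫ g ≫ funProj W (G.comp V (coRep A)) a) := by
  have := act_curry x z (famOf g a)
  rw [famOf, curry_uncurry] at this
  exact this.symm

theorem isNatFam_famOf {W : EnrichedFunctor V I V} {G : EnrichedFunctor V I C} {A : C} {X : V}
    (g : X ⟶ funHom W (G.comp V (coRep A))) : IsNatFam W G (famOf g) := by
  intro Z a b x k z
  have h := congrArg (act x) (funProj_wedge k (z ≫ g))
  rw [act_ecomp, act_ecomp, Category.assoc, Category.assoc] at h
  rw [lift_famOf, lift_famOf, h]
  exact act_comp_coRep G A _ k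

theorem exists_famOf {W : EnrichedFunctor V I V} {G : EnrichedFunctor V I C} {A : C} {X : V}
    {ψ : ∀ a, W.obj a ⊗ X ⟶ (A ⟶[V] G.obj a)} (h : IsNatFam W G ψ) :
    ∃ g : X ⟶ funHom W (G.comp V (coRep A)), famOf g = ψ := by
  obtain ⟨g, hg⟩ := exists_funLift (F := W) (G := G.comp V (coRep A)) (Z := X)
    (fun a => curry (ψ a)) fun Z z a b k => hom_ext_act fun {Z'} z' x => by
      refine (congrArg (act x) (comp_ecomp (C := V) z' _ _)).trans ?_
      refine Eq.trans ?_ (congrArg (act x) (comp_ecomp (C := V) z' _ _)).symm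
      refine (act_ecomp _ _ _).trans (Eq.trans ?_ (act_ecomp _ _ _).symm)
      have h₁ := h a b x (z' ≫ k) (z' ≫ z)
      have e₁ := act_curry_assoc (act x ((z' ≫ k) ≫ W.map a b)) z' z (ψ b)
      have e₂ := act_curry_assoc x z' z (ψ a)
      have e₃ := act_comp_coRep G A (lift x (z' ≫ z) ≫ ψ a) (z' ≫ k)
      rw [Category.assoc z' k] at e₁ h₁
      refine e₁.trans (h₁.trans (e₃.symm.trans ((congrArg (act · _) e₂.symm).trans ?_)))
      exact congrArg (act _) (Category.assoc _ _ _)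
  exact ⟨g, funext fun a => (congrArg uncurry (hg a)).trans (uncurry_curry _)⟩

theorem famOf_injective {W : EnrichedFunctor V I V} {G : EnrichedFunctor V I C} {A : C} {X : V}
    {g g' : X ⟶ funHom W (G.comp V (coRep A))} (h : famOf g = famOf g') : g = g' :=
  funHom_ext fun a => uncurry_injective (congrFun h a)

variable [BraidedCategory V]

/-- The components of the values of the Yoneda transformation of `λ` on generalized elements. -/
theorem comp_yonedaTrans_proj {W : EnrichedFunctor V I V} {G : EnrichedFunctor V I C} {L A : C}
    (lam : VNatTrans W (G.comp V (coRep L))) {X : V} (k : X ⟶ (A ⟶[V] L)) (a : I) :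
    (k ≫ (yonedaTrans (coneFunctor W G) (d := Opposite.op L) lam.elt).toMap (Opposite.op A) :
      X ⟶ funHom W (G.comp V (coRep A))) ≫ funProj W (G.comp V (coRep A)) a =
      ecomp (V := V) (C := V) (toUnit X ≫ lam.app a) (k ≫ preMap L A (G.obj a)) := by
  have h₁ : (k ≫ (yonedaTrans (coneFunctor W G) (d := Opposite.op L) lam.elt).toMap
      (Opposite.op A) : X ⟶ funHom W (G.comp V (coRep A))) =
      funComp (toUnit X ≫ lam.elt) (k ≫ preTrans G L A) := by
    refine (congrArg (k ≫ ·) (uncurry'_curry' _)).trans ?_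
    refine (comp_act k _ _).trans ?_
    refine Eq.trans ?_ (funCategory_ecomp _ _)
    refine Eq.trans ?_ (act_comp_coRep (homFunctor G) W (a := Opposite.op L)
      (b := Opposite.op A) (toUnit X ≫ lam.elt) k)
    refine congrArg (act · _) ?_
    refine (Category.assoc _ _ _).symm.trans ?_
    exact congrArg (· ≫ lam.elt) (toUnit_unique _ _)
  rw [h₁, funComp_proj, Category.assoc, Category.assoc, preTrans_proj]
  congr 2
  exact funLift_proj _ _ a

/-- In terms of natural families, the Yoneda transformation of `λ` is composition with `λ`. -/
theorem famOf_yonedaTrans {I C : Type w} [EnrichedCategory V I] [EnrichedCategory V C]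
    {W : EnrichedFunctor V I V} {G : EnrichedFunctor V I C} {L A : C}
    (lam : VNatTrans W (G.comp V (coRep L))) {X : V} (k : X ⟶ (A ⟶[V] L)) (a : I) :
    famOf (G := G) (A := A) (k ≫ (yonedaTrans (coneFunctor W G) (d := Opposite.op L)
      lam.elt).toMap (Opposite.op A)) a = ecomp (snd _ _ ≫ k) (fst _ _ ≫ lamMap lam a) := by
  have h := lift_famOf (G := G) (A := A) (k ≫ (yonedaTrans (coneFunctor W G)
    (d := Opposite.op L) lam.elt).toMap (Opposite.op A)) a (fst (W.obj a) X) (snd _ _)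
  rw [lift_fst_snd, Category.id_comp, comp_yonedaTrans_proj] at h
  refine h.trans ((congrArg (act _) (comp_ecomp (C := V) _ _ _)).trans ((act_ecomp _ _ _).trans ?_))
  refine (act_preMap' _ _ _).trans (congrArg (ecomp (snd (W.obj a) X ≫ k)) ?_)
  exact (congrArg (act _) (Category.assoc _ _ _).symm).trans (act_point _ _ _)

/-- A pair `(L, λ)` is a weighted limit if and only if every generalized natural family factors
uniquely through `λ`. -/
theorem isWeightedLimit_iff {I C : Type w} [EnrichedCategory V I] [EnrichedCategory V C]
    {W : EnrichedFunctor V I V} {G : EnrichedFunctor V I C} {L : C}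
    (lam : VNatTrans W (G.comp V (coRep L))) :
    IsWeightedLimit W G L lam ↔
      ∀ (A : C) (X : V) (ψ : ∀ a, W.obj a ⊗ X ⟶ (A ⟶[V] G.obj a)), IsNatFam W G ψ →
        ∃! k : X ⟶ (A ⟶[V] L), ∀ a, ecomp (snd _ _ ≫ k) (fst _ _ ≫ lamMap lam a) = ψ a := by
  refine (VNatTrans.isIso_iff _).trans ⟨fun H A X ψ hψ => ?_, fun H A => ?_⟩
  · have := H (Opposite.op A)
    obtain ⟨g, rfl⟩ := exists_famOf hψ
    let Θ : (A ⟶[V] L) ⟶ funHom W (G.comp V (coRep A)) :=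
      (yonedaTrans (coneFunctor W G) (d := Opposite.op L) lam.elt).toMap (Opposite.op A)
    have : IsIso Θ := this
    have e : (g ≫ inv Θ) ≫ Θ = g :=
      (Category.assoc _ _ _).trans ((congrArg (g ≫ ·) (IsIso.inv_hom_id Θ)).trans
        (Category.comp_id _))
    refine ⟨g ≫ inv Θ, fun a => ?_, fun k hk => ?_⟩
    · refine (famOf_yonedaTrans lam (A := A) (g ≫ inv Θ) a).symm.trans ?_
      exact congrArg (fun q => famOf q a) e
    · refine (cancel_mono Θ).1 (Eq.trans ?_ e.symm)
      refine famOf_injective (funext fun a => ?_)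
      exact (famOf_yonedaTrans lam (A := A) k a).trans (hk a)
  · refine isIso_of_existsUnique _ fun X g => ?_
    obtain ⟨k, hk, hu⟩ := H A.unop X (famOf g) (isNatFam_famOf g)
    refine ⟨k, ?_, fun k' hk' => hu k' fun a => ?_⟩
    · refine famOf_injective (funext fun a => ?_)
      exact (famOf_yonedaTrans lam (A := A.unop) k a).trans (hk a)
    · refine (famOf_yonedaTrans lam (A := A.unop) k' a).symm.trans ?_
      exact congrArg (fun q => famOf q a) hk'

end Weighted

end EnrInt

end

/-- Weighted `V`-limits are conical internal limits. -/
theorem mainTheorem3 {V : Type u} [Category.{v} V] [CartesianMonoidalCategory V]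
    [BraidedCategory V] [MonoidalClosed V] [HasPullbacks V] [HasCoproducts.{w} V]
    [EnrInt.Extensive.{w} V] {I C : Type w} [EnrichedCategory V I] [EnrichedCategory V C]
    (G : EnrichedFunctor V I C) (W : EnrichedFunctor V I V) (L : C)
    (lam : EnrInt.VNatTrans W (G.comp V (EnrInt.coRep L))) :
    EnrInt.IsWeightedLimit W G L lam ↔
      EnrInt.InternalCat.IsInternalLimit (EnrInt.weightedCone W G L lam) :=
  (EnrInt.isWeightedLimit_iff lam).trans (EnrInt.isInternalLimit_weightedCone_iff lam).symm
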